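/- Let $\mathcal S,\mathcal A$ be finite sets, $d=|\mathcal S||\mathcal A|$, and consider an episodic Markov decision process with initial distribution $p_0$, transition probabilities $\overline p(s'\mid s,a)$ and horizon $h$. For $r\in\mathbb R^{d}$, transition parameters $p$ and a deterministic policy $\pi:\mathcal S\times\{1,\dots,h\}\to\mathcal A$, let $V(p,r,\pi)$ be the expected total reward $\mathbb E[\sum_{t=1}^h r(s_t,a_t)]$ of an episode. For a trajectory $\tau$ let $\phi(\tau)\in\mathbb R^{d}$ be its vector of state-action visit counts. Let $\overline r\in\mathbb R^d$ be the true reward vector, with $\|\overline r\|_2\le S_r$ and $|\overline r^T(\phi(\tau')-\phi(\tau))|\le\frac12$ for all trajectories $\tau,\tau'$ possible in the process. Fix $\delta\in(0,1)$, $\lambda\ge 1$, $R\ge 0$ and Dirichlet prior parameters $\alpha_{s,a,s'}>0$. Dueling Posterior Sampling runs for $i=1,2,\dots$. With $x_k=\phi(\tau_{k2})-\phi(\tau_{k1})$ put $$M_i=\lambda I+\sum_{k<i}x_kx_k^T,\qquad \hat r_i=M_i^{-1}\sum_{k<i}y_kx_k,\qquad \beta_i(\delta)=R\sqrt{2\log\frac{\det(M_i)^{1/2}\lambda^{-d/2}}{\delta}}+\sqrt\lambda\,S_r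 .$$ Given the past, draw independently, for $j=1,2$, transition parameters $\tilde p_{ij}$ from the Dirichlet posterior (independent over state-action pairs, prior parameters plus transition counts of all past trajectories) and rewards $\tilde r_{ij}\sim\mathcal N(\hat r_i,\beta_i(\delta)^2M_i^{-1})$; let $\pi_{ij}$ maximize $V(\tilde p_{ij},\tilde r_{ij},\cdot)$ over deterministic policies, ties broken uniformly at random; roll out $\pi_{i1},\pi_{i2}$ independently in the true process to obtain $\tau_{i1},\tau_{i2}$; and observe $y_i\in\{-\frac12,\frac12\}$ with $P(y_i=\frac12)=\frac12+\overline r^Tx_i$. Assume that the noise $\eta_i=y_i-\overline r^Tx_i$ is conditionally $R$-sub-Gaussian: $\mathbb E[e^{s\eta_i}\mid x_1,\dots,x_{i-1},\eta_1,\dots,\eta_{i-1}]\le e^{s^2R^2/2}$ almost surely for all $s\in\mathbb R$. Call $v\in\mathbb R^d$ irrelevant if $V(\overline p,v,\pi)$ is the same for all deterministic policies $\pi$, and let $\Pi$ be the orthogonal projection of $\mathbb R^d$ onto the orthogonal complement of the subspace of irrelevant vectors (the relevant subspace). Then, with probability at least $1-\delta$, the reward samples, projected onto the relevant subspace, converge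 in distribution to the true reward vector, projected likewise: there is an event $E$ with $P(E)\ge 1-\delta$ such that 1. at every outcome in $E$, the image under $\Pi$ of the posterior $\mathcal N(\hat r_i,\beta_i(\delta)^2M_i^{-1})$, from which $\tilde r_{i1}$ and $\tilde r_{i2}$ are drawn, converges weakly to the point mass at $\Pi\overline r$ as $i\to\infty$; 2. conditionally on $E$, $\Pi\tilde r_{i1}\to\Pi\overline r$ and $\Pi\tilde r_{i2}\to\Pi\overline r$ in distribution as $i\to\infty$. -/

import Mathlib

open MeasureTheory ProbabilityTheory Filter Topology

noncomputable section

namespace DPS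

/-- A finite Markov decision process without rewards: an initial distribution and transition
probabilities `trans s a s'`. -/
structure MDP (S A : Type*) [Fintype S] where
  init : S → ℝ
  init_nonneg : ∀ s, 0 ≤ init s
  init_sum : ∑ s, init s = 1
  trans : S → A → S → ℝ
  trans_nonneg : ∀ s a s', 0 ≤ trans s a s'
  trans_sum : ∀ s a, ∑ s', trans s a s' = 1

/-- Deterministic time-dependent policies for episodes of length `h`: `act s t` is the action
taken in state `s` at time `t`. -/
structure Policy (S A : Type*) (h : ℕ) where
  act : S → Fin h → A

/-- Trajectories `s₁, a₁, …, s_h, a_h, s_{h+1}`: the states and the actions. -/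
structure Traj (S A : Type*) (h : ℕ) where
  state : Fin (h + 1) → S
  act : Fin h → A

/-- A policy is a function. -/
def Policy.equivFun (S A : Type*) (h : ℕ) : (S → Fin h → A) ≃ Policy S A h where
  toFun f := ⟨f⟩
  invFun π := π.act
  left_inv _ := rfl
  right_inv _ := rfl

/-- A trajectory is a pair of sequences. -/
def Traj.equivProd (S A : Type*) (h : ℕ) : (Fin (h + 1) → S) × (Fin h → A) ≃ Traj S A h where
  toFun x := ⟨x.1, x.2⟩
  invFun τ := (τ.state, τ.act)
  left_inv _ := rfl
  right_inv _ := rfl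

/-- The outcome of one iteration seen by the learner: the two trajectories and the preference;
the Boolean is `true` when the second trajectory (index `1`) is preferred to the first
(index `0`). -/
abbrev Obs (S A : Type*) (h : ℕ) : Type _ := (Fin 2 → Traj S A h) × Bool

/-- A sample of the model: transition parameters and a reward vector. -/
abbrev Draw (S A : Type*) : Type _ := (S → A → S → ℝ) × EuclideanSpace ℝ (S × A)

/-- Everything that happens in one iteration: the two model samples, the two policies, and the
observation. -/
abbrev Round (S A : Type*) (h : ℕ) : Type _ :=
  (Fin 2 → Draw S A) × (Fin 2 → Policy S A h) × Obs S A h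

variable {S A : Type*} [Fintype S] [DecidableEq S] [Fintype A] [DecidableEq A] {h : ℕ}

instance : Fintype (Policy S A h) := Fintype.ofEquiv _ (Policy.equivFun S A h)
instance : Fintype (Traj S A h) := Fintype.ofEquiv _ (Traj.equivProd S A h)
instance : MeasurableSpace (Policy S A h) := ⊤
instance : MeasurableSpace (Traj S A h) := ⊤

/-- Visit counts of a trajectory, as a vector indexed by the state-action pairs. -/
def features (τ : Traj S A h) : EuclideanSpace ℝ (S × A) :=
  WithLp.toLp 2 fun sa =>
    ((Finset.univ.filter fun t : Fin h => (τ.state t.castSucc, τ.act t) = sa).card : ℝ)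

/-- The number of transitions from `s` to `s'` under action `a` in a trajectory. -/
def transCount (τ : Traj S A h) (s : S) (a : A) (s' : S) : ℕ :=
  (Finset.univ.filter fun t : Fin h => τ.state t.castSucc = s ∧ τ.act t = a ∧ τ.state t.succ = s').card

/-- The probability of a trajectory when `π` is rolled out under dynamics `p`. -/
def trajProb (p₀ : S → ℝ) (p : S → A → S → ℝ) (π : Policy S A h) (τ : Traj S A h) : ℝ :=
  p₀ (τ.state 0) * ∏ t : Fin h,
    ((if τ.act t = π.act (τ.state t.castSucc) t then 1 else 0) *
      p (τ.state t.castSucc) (τ.act t) (τ.state t.succ))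

/-- A trajectory is feasible if some choice of actions produces it with positive probability. -/
def Feasible (mdp : MDP S A) (τ : Traj S A h) : Prop :=
  0 < mdp.init (τ.state 0) ∧ ∀ t : Fin h, 0 < mdp.trans (τ.state t.castSucc) (τ.act t) (τ.state t.succ)

/-- The value `V(p, r, π)`: the expected total reward of an episode. -/
def value (p₀ : S → ℝ) (p : S → A → S → ℝ) (r : EuclideanSpace ℝ (S × A)) (π : Policy S A h) : ℝ :=
  ∑ τ : Traj S A h, trajProb p₀ p π τ * inner ℝ r (features τ)

open Classical in
/-- The set of deterministic policies that are optimal for the dynamics `p` and rewards `r`. -/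
def optimalPolicies (h : ℕ) (p₀ : S → ℝ) (d : Draw S A) : Finset (Policy S A h) :=
  Finset.univ.filter fun π => ∀ π' : Policy S A h, value p₀ d.1 d.2 π' ≤ value p₀ d.1 d.2 π

open Classical in
/-- The probability that `π` is selected for the sampled model `d`: the optimal policy for `d`,
with ties broken uniformly at random. -/
def selectProb (p₀ : S → ℝ) (d : Draw S A) (π : Policy S A h) : ℝ :=
  if π ∈ optimalPolicies h p₀ d then ((optimalPolicies h p₀ d).card : ℝ)⁻¹ else 0

/-- The parameters of the learner: Dirichlet prior parameters `prior s a s'`, the ridge parameter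
`lam`, the sub-Gaussian parameter `R`, the norm bound `Sr` and the failure probability `delta`. -/
structure Params (S A : Type*) where
  prior : S → A → S → ℝ
  prior_pos : ∀ s a s', 0 < prior s a s'
  lam : ℝ
  one_le_lam : 1 ≤ lam
  R : ℝ
  R_nonneg : 0 ≤ R
  Sr : ℝ
  delta : ℝ
  delta_pos : 0 < delta
  delta_lt_one : delta < 1

/-- The feature difference `x = x₂ - x₁` of an observation. -/
def diff (o : Obs S A h) : EuclideanSpace ℝ (S × A) := features (o.1 1) - features (o.1 0)

/-- The label `y ∈ {-1/2, 1/2}`. -/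
def label (o : Obs S A h) : ℝ := if o.2 then 1 / 2 else -(1 / 2)

/-- The matrix `M = λ I + ∑ x xᵀ` of a history. -/
def gram (P : Params S A) {n : ℕ} (H : Fin n → Obs S A h) : Matrix (S × A) (S × A) ℝ :=
  P.lam • (1 : Matrix (S × A) (S × A) ℝ) +
    ∑ i, Matrix.vecMulVec (diff (H i)).ofLp (diff (H i)).ofLp

/-- The ridge regression (MAP) estimate `M⁻¹ ∑ y x`. -/
def ridge (P : Params S A) {n : ℕ} (H : Fin n → Obs S A h) : EuclideanSpace ℝ (S × A) :=
  WithLp.toLp 2 (Matrix.mulVec (gram P H)⁻¹ (∑ i, label (H i) • diff (H i)).ofLp)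

/-- The confidence radius
`β(δ) = R √(2 log (det(M)^{1/2} λ^{-d/2} / δ)) + √λ S_r`, with `d = |S × A|`. -/
def beta (P : Params S A) {n : ℕ} (H : Fin n → Obs S A h) : ℝ :=
  P.R * √(2 * Real.log
      ((gram P H).det ^ (1 / 2 : ℝ) * P.lam ^ (-(Fintype.card (S × A) : ℝ) / 2) / P.delta)) +
    √P.lam * P.Sr

/-- The reward posterior `N(r̂, β(δ)² M⁻¹)`. -/
def rewardPosterior (P : Params S A) {n : ℕ} (H : Fin n → Obs S A h) :
    Measure (EuclideanSpace ℝ (S × A)) :=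
  multivariateGaussian (ridge P H) (beta P H ^ 2 • (gram P H)⁻¹)

instance (P : Params S A) {n : ℕ} (H : Fin n → Obs S A h) :
    IsProbabilityMeasure (rewardPosterior P H) := by
  unfold rewardPosterior; infer_instance

/-- The Dirichlet distribution with parameters `α`, as the law of a normalized vector of
independent Gamma variables. -/
def dirichlet (α : S → ℝ) : Measure (S → ℝ) :=
  (Measure.pi fun s => gammaMeasure (α s) 1).map fun g s => g s / ∑ s', g s'

/-- The dynamics posterior: independent Dirichlet distributions, one for each state-action pair,
updated by the transition counts of both trajectories of every past iteration. -/
def dynamicsPosterior (P : Params S A) {n : ℕ} (H : Fin n → Obs S A h) :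
    Measure (S → A → S → ℝ) :=
  Measure.pi fun s => Measure.pi fun a => dirichlet fun s' =>
    P.prior s a s' + ∑ i, ∑ j : Fin 2, (transCount ((H i).1 j) s a s' : ℝ)

/-- The law of one model sample given the history. -/
def drawLaw (P : Params S A) {n : ℕ} (H : Fin n → Obs S A h) : Measure (Draw S A) :=
  (dynamicsPosterior P H).prod (rewardPosterior P H)

/-- The probability of the preference in `o` given its two trajectories, under the linear link
function: the second trajectory is preferred with probability `1/2 + ⟨r, x⟩`. -/
def prefProb (r : EuclideanSpace ℝ (S × A)) (o : Obs S A h) : ℝ :=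
  if o.2 then 1 / 2 + inner ℝ r (diff o) else 1 / 2 - inner ℝ r (diff o)

/-- The law of an iteration of dueling posterior sampling given the history `H`: two independent
model samples are drawn, an optimal policy is selected for each, the two policies are rolled out
independently in the true process, and a preference is drawn. -/
def roundLaw (mdp : MDP S A) (r : EuclideanSpace ℝ (S × A)) (P : Params S A) {n : ℕ}
    (H : Fin n → Obs S A h) : Measure (Round S A h) :=
  ((Measure.pi fun _ : Fin 2 => drawLaw P H).prod
    (Measure.count : Measure ((Fin 2 → Policy S A h) × Obs S A h))).withDensity fun w =>
      ENNReal.ofReal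
        ((∏ j, selectProb mdp.init (w.1 j) (w.2.1 j)) *
          (∏ j, trajProb mdp.init mdp.trans (w.2.1 j) (w.2.2.1 j)) *
          prefProb r w.2.2)

/-- The observations made in the first `n` iterations. -/
def history {Ω : Type*} (W : ℕ → Ω → Round S A h) (n : ℕ) (ω : Ω) : Fin n → Obs S A h :=
  fun i => (W i ω).2.2

/-- `W 0, W 1, …` are the iterations of a run of dueling posterior sampling: given all of the
first `n` iterations, the next one has the law `roundLaw` of the observed history. -/
structure IsDPS {Ω : Type*} [MeasurableSpace Ω] (μ : Measure Ω) (mdp : MDP S A)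
    (r : EuclideanSpace ℝ (S × A)) (P : Params S A) (W : ℕ → Ω → Round S A h) : Prop where
  measurable : ∀ n, Measurable (W n)
  law : ∀ (n : ℕ) (H : Fin n → Obs S A h) (C : Set (Fin n → Round S A h)) (B : Set (Round S A h)),
    MeasurableSet C → MeasurableSet B →
      μ {ω | (fun i : Fin n => W i ω) ∈ C ∧ history W n ω = H ∧ W n ω ∈ B} =
        μ {ω | (fun i : Fin n => W i ω) ∈ C ∧ history W n ω = H} * roundLaw mdp r P H B

/-- The reward sample `r̃` number `j` of iteration `n`. -/
def rewardSample {Ω : Type*} (W : ℕ → Ω → Round S A h) (n : ℕ) (j : Fin 2) (ω : Ω) :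
    EuclideanSpace ℝ (S × A) :=
  ((W n ω).1 j).2

/-- The label noise `η = y - ⟨r, x⟩` of iteration `n`. -/
def noise {Ω : Type*} (r : EuclideanSpace ℝ (S × A)) (W : ℕ → Ω → Round S A h) (n : ℕ)
    (ω : Ω) : ℝ :=
  label (W n ω).2.2 - inner ℝ r (diff (W n ω).2.2)

/-- The label noise is conditionally `R`-sub-Gaussian given the earlier feature differences and
noise terms. -/
def SubGaussianNoise {Ω : Type*} [MeasurableSpace Ω] (μ : Measure Ω)
    (r : EuclideanSpace ℝ (S × A)) (W : ℕ → Ω → Round S A h) (R : ℝ) : Prop :=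
  ∀ (n : ℕ) (s : ℝ),
    μ[fun ω => Real.exp (s * noise r W n ω) |
      MeasurableSpace.comap
        (fun ω (i : Fin n) => (diff (W i ω).2.2, noise r W i ω)) inferInstance]
    ≤ᵐ[μ] fun _ => Real.exp (s ^ 2 * R ^ 2 / 2)

lemma value_add (p₀ : S → ℝ) (p : S → A → S → ℝ) (v w : EuclideanSpace ℝ (S × A))
    (π : Policy S A h) : value p₀ p (v + w) π = value p₀ p v π + value p₀ p w π := by
  simp [value, inner_add_left, mul_add, Finset.sum_add_distrib]

lemma value_smul (p₀ : S → ℝ) (p : S → A → S → ℝ) (c : ℝ) (v : EuclideanSpace ℝ (S × A))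
    (π : Policy S A h) : value p₀ p (c • v) π = c * value p₀ p v π := by
  simp only [value, real_inner_smul_left, Finset.mul_sum]
  exact Finset.sum_congr rfl fun _ _ => by ring

/-- The irrelevant reward directions: as rewards, they give every policy the same value in the
true process. -/
def irrelevant (mdp : MDP S A) (h : ℕ) : Submodule ℝ (EuclideanSpace ℝ (S × A)) where
  carrier := {v | ∀ π π' : Policy S A h,
    value mdp.init mdp.trans v π = value mdp.init mdp.trans v π'}
  zero_mem' := fun π π' => by simp [value]
  add_mem' := fun {v w} hv hw π π' => by rw [value_add, value_add, hv π π', hw π π']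
  smul_mem' := fun c v hv π π' => by rw [value_smul, value_smul, hv π π']

/-- The orthogonal projection onto the relevant subspace, the orthogonal complement of the
irrelevant directions. -/
def relProj (mdp : MDP S A) (h : ℕ) :
    EuclideanSpace ℝ (S × A) →L[ℝ] EuclideanSpace ℝ (S × A) :=
  (irrelevant mdp h)ᗮ.starProjection

end DPS

end

/-!
Along almost every path the reward posteriors collapse to the true rewards in all relevant
directions, so the event can be taken of full measure. Write `M` for the Gram matrix of a history,
`L = log det (M / λ)`, `unc v = vᵀ M⁻¹ v` and `φ π` for the expected features of `π` in the true
process. The relevant subspace is spanned by the differences `φ πa - φ πb`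
(`orthogonal_irrelevant_le`), and the squared confidence radius is of order `1 + L`
(`exists_beta_sq_le`, `exists_le_beta_sq`; its lower bound needs `0 < R`, which the sub-Gaussian
hypothesis forces already in the first iteration, `SubGaussianNoise.R_pos`). Hence everything
reduces to `(1 + L) * unc (φ πa - φ πb) → 0`.

Three nonnegative supermartingales, with the maximal inequality, give three facts about almost
every path. The self-normalized noise satisfies `‖∑ η x‖²_{M⁻¹} ≤ L + O(1)`, hence the ridge
estimate is within `O(√(1 + L))` of the truth in the metric of `M` (`ae_ridgeClose`). The
transition counts differ from their compensators by at most `O(N ^ (3/5))` after `N` visits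
(`ae_countsClose`). The expected information gains `q`, the conditional means of the increments of
`L`, satisfy `∑ q / (1 + L) ^ 2 < ∞` (`ae_infoGain_bounded`), because `1 / (1 + L)` decreases in
mean by a multiple of `q / (1 + L) ^ 2`.

The heart of the matter is a lower bound for exploration, `exists_le_infoGain`: on histories with
the first two properties, if `(1 + L) * unc (φ πa - φ πb) ≥ ε` for some pair of policies, then
`q ≥ c / (1 + L) * exp (-K (1 + L) ^ (3/4))`. Indeed, the dynamics sample is within
`ρ ~ (1 + L) ^ (-1/2)` of the true dynamics with probability at least `exp (-K ρ ^ (-3/2))`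
(`exists_le_dynamicsPosterior`; when there are few visits the Dirichlet density is bounded below,
and when there are many, Chebyshev's inequality applies), and the Gaussian reward
sample, whose standard deviation in the uncertain direction stays away from `0`, beats all
policies that are close to the most likely one by a policy far from it, with probability bounded
below. Hence two independently selected policies differ with sufficient probability, and the
difference of their trajectories is informative (`le_infoGain`).

On the other hand `det` is at most a power of the trace, so `L` grows at most logarithmically over
any window of iterations (`logDet_firstObs_le`). If `(1 + L) * unc` is at least `ε` at a late
time, then it was at least `ε / 2` at all times since `1 + L` had half its present value, and
these are at least `exp (c (1 + L))` many. As `exp (c m)` beats `exp (-K m ^ (3/4))`, the sum of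
the discounted information gains would be unbounded; if `L` itself is bounded, already the terms
stay away from `0` (`tendsto_unc_of_infoGain_bounded`).

Finally the characteristic function of a Gaussian posterior in a relevant direction depends only
on its mean and variance there, which converge to those of the point mass. The law of a reward
sample is the mixture of the posteriors over the histories (`map_rewardSample`), so the second
convergence follows from the first by dominated convergence.
-/

open MeasureTheory ProbabilityTheory Filter Topology

set_option linter.unusedSectionVars false

noncomputable section

namespace DPS

/-! ### Rank-one updates of positive definite matrices -/

section Matrix

open Matrix
open scoped MatrixOrder Matrix.Norms.L2Operator

variable {ι : Type*} [Fintype ι] [DecidableEq ι]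

/-- The quadratic form `vᵀ M⁻¹ v`. -/
def invQuad (M : Matrix ι ι ℝ) (v : ι → ℝ) : ℝ := v ⬝ᵥ M⁻¹ *ᵥ v

lemma posDef_add_vecMulVec {M : Matrix ι ι ℝ} (hM : M.PosDef) (x : ι → ℝ) :
    (M + vecMulVec x x).PosDef := by
  have h := posSemidef_vecMulVec_self_star x
  simp only [star_trivial] at h
  exact hM.add_posSemidef h

lemma inv_dotProduct_comm {M : Matrix ι ι ℝ} (hM : M.PosDef) (v w : ι → ℝ) :
    v ⬝ᵥ M⁻¹ *ᵥ w = w ⬝ᵥ M⁻¹ *ᵥ v := by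
  have hT : (M⁻¹)ᵀ = M⁻¹ := by
    have := hM.inv.isHermitian
    rwa [IsHermitian, conjTranspose_eq_transpose_of_trivial] at this
  rw [dotProduct_mulVec, ← mulVec_transpose, hT, dotProduct_comm]

lemma invQuad_nonneg {M : Matrix ι ι ℝ} (hM : M.PosDef) (v : ι → ℝ) : 0 ≤ invQuad M v := by
  have := hM.inv.posSemidef.dotProduct_mulVec_nonneg v
  simpa [invQuad] using this

lemma invQuad_add_smul {M : Matrix ι ι ℝ} (hM : M.PosDef) (v w : ι → ℝ) (c : ℝ) :
    invQuad M (v + c • w) =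
      invQuad M v + 2 * c * (v ⬝ᵥ M⁻¹ *ᵥ w) + c ^ 2 * invQuad M w := by
  have := inv_dotProduct_comm hM w v
  simp only [invQuad, mulVec_add, mulVec_smul, dotProduct_add, add_dotProduct, smul_dotProduct,
    dotProduct_smul, smul_eq_mul, this]
  ring

lemma invQuad_smul (M : Matrix ι ι ℝ) (v : ι → ℝ) (c : ℝ) :
    invQuad M (c • v) = c ^ 2 * invQuad M v := by
  simp only [invQuad, mulVec_smul, smul_dotProduct, dotProduct_smul, smul_eq_mul]
  ring

lemma invQuad_neg (M : Matrix ι ι ℝ) (v : ι → ℝ) : invQuad M (-v) = invQuad M v := by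
  simp [invQuad, mulVec_neg]

/-- The Cauchy–Schwarz inequality for the form `M⁻¹`. -/
lemma inv_dotProduct_sq_le {M : Matrix ι ι ℝ} (hM : M.PosDef) (v w : ι → ℝ) :
    (v ⬝ᵥ M⁻¹ *ᵥ w) ^ 2 ≤ invQuad M v * invQuad M w := by
  have h := discrim_le_zero (a := invQuad M w) (b := 2 * (v ⬝ᵥ M⁻¹ *ᵥ w)) (c := invQuad M v)
    fun c => by
      have := invQuad_nonneg hM (v + c • w)
      rw [invQuad_add_smul hM] at this
      linarith
  rw [discrim] at h
  linarith

lemma invQuad_add_le {M : Matrix ι ι ℝ} (hM : M.PosDef) (v w : ι → ℝ) :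
    invQuad M (v + w) ≤ 2 * invQuad M v + 2 * invQuad M w := by
  have h1 := invQuad_add_smul hM v w 1
  have h2 := invQuad_add_smul hM v w (-1)
  have h3 := invQuad_nonneg hM (v + (-1 : ℝ) • w)
  rw [one_smul] at h1
  linarith

/-- The **Sherman–Morrison formula**. -/
lemma inv_add_vecMulVec {M : Matrix ι ι ℝ} (hM : M.PosDef) (x : ι → ℝ) :
    (M + vecMulVec x x)⁻¹ =
      M⁻¹ - (1 + invQuad M x)⁻¹ • vecMulVec (M⁻¹ *ᵥ x) (M⁻¹ *ᵥ x) := by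
  have hq : 1 + invQuad M x ≠ 0 := by have := invQuad_nonneg hM x; positivity
  have hdet : IsUnit M.det := hM.det_pos.ne'.isUnit
  have hT : (M⁻¹)ᵀ = M⁻¹ := by
    have := hM.inv.isHermitian
    rwa [IsHermitian, conjTranspose_eq_transpose_of_trivial] at this
  refine inv_eq_right_inv ?_
  have e1 : M * vecMulVec (M⁻¹ *ᵥ x) (M⁻¹ *ᵥ x) = vecMulVec x (M⁻¹ *ᵥ x) := by
    rw [mul_vecMulVec, mulVec_mulVec, mul_nonsing_inv _ hdet, one_mulVec]
  have e2 : vecMulVec x x * M⁻¹ = vecMulVec x (M⁻¹ *ᵥ x) := by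
    rw [vecMulVec_mul, ← mulVec_transpose, hT]
  have e3 : vecMulVec x x * vecMulVec (M⁻¹ *ᵥ x) (M⁻¹ *ᵥ x) =
      invQuad M x • vecMulVec x (M⁻¹ *ᵥ x) := by
    rw [vecMulVec_mul_vecMulVec]
    simp [invQuad, vecMulVec_smul]
  rw [add_mul, mul_sub, mul_sub, mul_nonsing_inv _ hdet, mul_smul_comm, mul_smul_comm, e1, e2, e3]
  have e4 : (1 + invQuad M x)⁻¹ • (vecMulVec x (M⁻¹ *ᵥ x)) +
      (1 + invQuad M x)⁻¹ • invQuad M x • vecMulVec x (M⁻¹ *ᵥ x) = vecMulVec x (M⁻¹ *ᵥ x) := by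
    rw [smul_smul, ← add_smul]
    have : (1 + invQuad M x)⁻¹ + (1 + invQuad M x)⁻¹ * invQuad M x = 1 := by field_simp
    rw [this, one_smul]
  rw [← sub_eq_zero]
  calc _ = vecMulVec x (M⁻¹ *ᵥ x) - ((1 + invQuad M x)⁻¹ • (vecMulVec x (M⁻¹ *ᵥ x)) +
      (1 + invQuad M x)⁻¹ • invQuad M x • vecMulVec x (M⁻¹ *ᵥ x)) := by abel
    _ = 0 := by rw [e4, sub_self]

lemma invQuad_add_vecMulVec {M : Matrix ι ι ℝ} (hM : M.PosDef) (x v : ι → ℝ) :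
    invQuad (M + vecMulVec x x) v =
      invQuad M v - (v ⬝ᵥ M⁻¹ *ᵥ x) ^ 2 / (1 + invQuad M x) := by
  rw [invQuad, inv_add_vecMulVec hM, sub_mulVec, dotProduct_sub, smul_mulVec, vecMulVec_mulVec,
    dotProduct_smul, op_smul_eq_smul, dotProduct_smul, dotProduct_comm (M⁻¹ *ᵥ x) v]
  simp only [invQuad, smul_eq_mul]
  ring

lemma dotProduct_inv_add_vecMulVec {M : Matrix ι ι ℝ} (hM : M.PosDef) (x v : ι → ℝ) :
    v ⬝ᵥ (M + vecMulVec x x)⁻¹ *ᵥ x = (v ⬝ᵥ M⁻¹ *ᵥ x) / (1 + invQuad M x) := by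
  have hq : 1 + invQuad M x ≠ 0 := by have := invQuad_nonneg hM x; positivity
  rw [inv_add_vecMulVec hM, sub_mulVec, dotProduct_sub, smul_mulVec, vecMulVec_mulVec,
    dotProduct_smul, op_smul_eq_smul, dotProduct_smul, dotProduct_comm (M⁻¹ *ᵥ x) x]
  simp only [smul_eq_mul]
  rw [← invQuad]
  field_simp
  ring

/-- The **matrix determinant lemma**. -/
lemma det_add_vecMulVec_self {M : Matrix ι ι ℝ} (hM : M.PosDef) (x : ι → ℝ) :
    (M + vecMulVec x x).det = M.det * (1 + invQuad M x) := by
  have hdet : IsUnit M.det := hM.det_pos.ne'.isUnit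
  rw [vecMulVec_eq Unit, det_add_replicateCol_mul_replicateRow hdet]
  congr 2
  rw [Matrix.mul_assoc, ← replicateCol_mulVec]
  simp [invQuad, det_unique, mul_apply, dotProduct]

/-- A determinant is bounded by a power of a relative trace: both sides are functions of the
eigenvalues of `M^{-1/2} Q M^{-1/2}`, each of which is at most their sum. -/
lemma det_le_det_mul_trace_pow {M Q : Matrix ι ι ℝ} (hM : M.PosDef) (hQ : Q.PosSemidef) :
    Q.det ≤ M.det * (M⁻¹ * Q).trace ^ Fintype.card ι := by
  obtain ⟨C, hC⟩ := CStarAlgebra.nonneg_iff_eq_star_mul_self.mp hM.inv.posSemidef.nonneg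
  rw [star_eq_conjTranspose] at hC
  rw [conjTranspose_eq_transpose_of_trivial] at hC
  set G := C * Q * Cᵀ with hG
  have hGp : G.PosSemidef := by
    have := hQ.mul_mul_conjTranspose_same C
    rwa [conjTranspose_eq_transpose_of_trivial] at this
  have htr : (M⁻¹ * Q).trace = G.trace := by
    rw [hC, hG, trace_mul_comm (C * Q), ← mul_assoc]
  have hdetM : M.det * (C.det * C.det) = 1 := by
    have : (M⁻¹).det = C.det * C.det := by rw [hC, det_mul, det_transpose]
    rw [← this, ← det_mul, mul_nonsing_inv _ hM.det_pos.ne'.isUnit, det_one]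
  have hdet : Q.det = M.det * G.det := by
    rw [hG, det_mul, det_mul, det_transpose]
    linear_combination (-Q.det) * hdetM
  rw [hdet, htr]
  refine mul_le_mul_of_nonneg_left ?_ hM.det_pos.le
  have h1 := hGp.isHermitian.det_eq_prod_eigenvalues
  have h2 := hGp.isHermitian.trace_eq_sum_eigenvalues
  simp only [RCLike.ofReal_real_eq_id, id] at h1 h2
  rw [h1, h2]
  calc ∏ i, hGp.isHermitian.eigenvalues i ≤ ∏ _i : ι, ∑ j, hGp.isHermitian.eigenvalues j :=
        Finset.prod_le_prod (fun i _ => hGp.eigenvalues_nonneg i) fun i _ =>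
          Finset.single_le_sum (fun j _ => hGp.eigenvalues_nonneg j) (Finset.mem_univ i)
    _ = _ := by simp

end Matrix

/-! ### Histories, log-determinants and ridge estimates -/

section Histories

open Matrix

variable {S A : Type*} [Fintype S] [DecidableEq S] [Fintype A] [DecidableEq A] {h : ℕ}

/-- The history obtained from `H` by appending the observation `o`. -/
def extend {n : ℕ} (H : Fin n → Obs S A h) (o : Obs S A h) : Fin (n + 1) → Obs S A h :=
  Fin.snoc (α := fun _ => Obs S A h) H o

/-- The first `n` observations of an infinite sequence. -/
def firstObs (o : ℕ → Obs S A h) (n : ℕ) : Fin n → Obs S A h := fun i => o i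

lemma firstObs_succ (o : ℕ → Obs S A h) (n : ℕ) :
    firstObs o (n + 1) = extend (firstObs o n) (o n) := by
  funext i
  refine Fin.lastCases ?_ (fun i => ?_) i <;> simp [firstObs, extend]

lemma exists_extend_eq {n : ℕ} (H : Fin (n + 1) → Obs S A h) :
    ∃ H' o, H = extend H' o :=
  ⟨Fin.init H, H (Fin.last n), (Fin.snoc_init_self H).symm⟩

variable (P : Params S A)

lemma lam_pos : 0 < P.lam := lt_of_lt_of_le one_pos P.one_le_lam

lemma gram_extend {n : ℕ} (H : Fin n → Obs S A h) (o : Obs S A h) :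
    gram P (extend H o) = gram P H + vecMulVec (diff o).ofLp (diff o).ofLp := by
  simp [gram, extend, Fin.sum_univ_castSucc, add_assoc]

lemma gram_zero (H : Fin 0 → Obs S A h) :
    gram P H = P.lam • (1 : Matrix (S × A) (S × A) ℝ) := by
  simp [gram]

lemma gram_posDef {n : ℕ} (H : Fin n → Obs S A h) : (gram P H).PosDef := by
  induction n with
  | zero =>
    rw [gram_zero]
    exact PosDef.one.smul (lam_pos P)
  | succ n ih =>
    obtain ⟨H', o, rfl⟩ := exists_extend_eq H
    rw [gram_extend]
    exact posDef_add_vecMulVec (ih H') _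

/-- The information gain `log (det M / λ^d)` of a history. -/
def logDet {n : ℕ} (H : Fin n → Obs S A h) : ℝ :=
  Real.log (gram P H).det - Fintype.card (S × A) * Real.log P.lam

lemma logDet_zero (H : Fin 0 → Obs S A h) : logDet P H = 0 := by
  simp [logDet, gram_zero, Real.log_pow]

/-- The squared length of a vector in the metric `M⁻¹` of a history. -/
def unc {n : ℕ} (H : Fin n → Obs S A h) (v : EuclideanSpace ℝ (S × A)) : ℝ :=
  invQuad (gram P H) v.ofLp

lemma unc_nonneg {n : ℕ} (H : Fin n → Obs S A h) (v : EuclideanSpace ℝ (S × A)) :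
    0 ≤ unc P H v := invQuad_nonneg (gram_posDef P H) _

lemma unc_add_le {n : ℕ} (H : Fin n → Obs S A h) (v w : EuclideanSpace ℝ (S × A)) :
    unc P H (v + w) ≤ 2 * unc P H v + 2 * unc P H w :=
  invQuad_add_le (gram_posDef P H) _ _

lemma unc_smul {n : ℕ} (H : Fin n → Obs S A h) (c : ℝ) (v : EuclideanSpace ℝ (S × A)) :
    unc P H (c • v) = c ^ 2 * unc P H v := invQuad_smul _ _ _

lemma unc_neg {n : ℕ} (H : Fin n → Obs S A h) (v : EuclideanSpace ℝ (S × A)) :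
    unc P H (-v) = unc P H v := invQuad_neg _ _

lemma unc_sub_comm {n : ℕ} (H : Fin n → Obs S A h) (v w : EuclideanSpace ℝ (S × A)) :
    unc P H (v - w) = unc P H (w - v) := by rw [← unc_neg, neg_sub]

lemma logDet_extend {n : ℕ} (H : Fin n → Obs S A h) (o : Obs S A h) :
    logDet P (extend H o) = logDet P H + Real.log (1 + unc P H (diff o)) := by
  have h1 := (gram_posDef P H).det_pos
  have h2 := unc_nonneg P H (diff o)
  rw [logDet, gram_extend, det_add_vecMulVec_self (gram_posDef P H),
    Real.log_mul h1.ne' (by rw [unc] at h2; positivity), logDet, unc]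
  ring

lemma log_one_add_unc_nonneg {n : ℕ} (H : Fin n → Obs S A h) (v : EuclideanSpace ℝ (S × A)) :
    0 ≤ Real.log (1 + unc P H v) :=
  Real.log_nonneg (by linarith [unc_nonneg P H v])

lemma logDet_nonneg {n : ℕ} (H : Fin n → Obs S A h) : 0 ≤ logDet P H := by
  induction n with
  | zero => rw [logDet_zero]
  | succ n ih =>
    obtain ⟨H', o, rfl⟩ := exists_extend_eq H
    rw [logDet_extend]
    exact add_nonneg (ih H') (log_one_add_unc_nonneg P H' _)

lemma unc_extend_le {n : ℕ} (H : Fin n → Obs S A h) (o : Obs S A h)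
    (v : EuclideanSpace ℝ (S × A)) : unc P (extend H o) v ≤ unc P H v := by
  have h2 := unc_nonneg P H (diff o)
  rw [unc, gram_extend, invQuad_add_vecMulVec (gram_posDef P H)]
  rw [unc] at h2
  have : 0 ≤ (v.ofLp ⬝ᵥ (gram P H)⁻¹ *ᵥ (diff o).ofLp) ^ 2 /
    (1 + invQuad (gram P H) (diff o).ofLp) := by positivity
  rw [unc]
  linarith

lemma unc_le_norm_sq {n : ℕ} (H : Fin n → Obs S A h) (v : EuclideanSpace ℝ (S × A)) :
    unc P H v ≤ ‖v‖ ^ 2 := by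
  induction n with
  | zero =>
    have hinv : (P.lam • (1 : Matrix (S × A) (S × A) ℝ))⁻¹ = P.lam⁻¹ • 1 :=
      inv_eq_right_inv (by simp [smul_smul, (lam_pos P).ne'])
    have hv : v.ofLp ⬝ᵥ v.ofLp = ‖v‖ ^ 2 := by
      rw [EuclideanSpace.real_norm_sq_eq]
      simp [dotProduct, pow_two]
    rw [unc, gram_zero, invQuad, hinv, smul_mulVec, one_mulVec, dotProduct_smul, hv, smul_eq_mul]
    have := inv_le_one_of_one_le₀ P.one_le_lam
    nlinarith [sq_nonneg ‖v‖]
  | succ n ih =>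
    obtain ⟨H', o, rfl⟩ := exists_extend_eq H
    exact (unc_extend_le P H' o v).trans (ih H')

/-- Squared lengths of feature differences are uniformly bounded. -/
lemma exists_norm_diff_sq_le :
    ∃ B : ℝ, 1 ≤ B ∧ ∀ o : Obs S A h, ‖diff o‖ ^ 2 ≤ B := by
  obtain ⟨B, hB⟩ := (Set.finite_range fun o : Obs S A h => ‖diff o‖ ^ 2).bddAbove
  exact ⟨max B 1, le_max_right _ _, fun o => (hB ⟨o, rfl⟩).trans (le_max_left _ _)⟩

lemma unc_firstObs_antitone (o : ℕ → Obs S A h) (v : EuclideanSpace ℝ (S × A)) :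
    Antitone fun n => unc P (firstObs o n) v :=
  antitone_nat_of_succ_le fun n => by
    rw [firstObs_succ]
    exact unc_extend_le P _ _ _

lemma logDet_firstObs_monotone (o : ℕ → Obs S A h) :
    Monotone fun n => logDet P (firstObs o n) :=
  monotone_nat_of_le_succ fun n => by
    rw [firstObs_succ, logDet_extend]
    linarith [log_one_add_unc_nonneg P (firstObs o n) (diff (o n))]

/-- Over any window of rounds, the information gain grows at most logarithmically in the length
of the window, whatever happened before. -/
lemma logDet_firstObs_le {B : ℝ} (hB1 : 1 ≤ B) (hB : ∀ o : Obs S A h, ‖diff o‖ ^ 2 ≤ B)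
    (o : ℕ → Obs S A h) (j k : ℕ) :
    logDet P (firstObs o (j + k)) ≤ logDet P (firstObs o j) +
      Fintype.card (S × A) * Real.log (Fintype.card (S × A) + 1 + B * k) := by
  set d : ℝ := (Fintype.card (S × A) : ℝ) with hd
  have hd0 : 0 ≤ d := by positivity
  have htr : ∀ k : ℕ, d ≤ ((gram P (firstObs o j))⁻¹ * gram P (firstObs o (j + k))).trace ∧
      ((gram P (firstObs o j))⁻¹ * gram P (firstObs o (j + k))).trace ≤ d + B * k := by
    intro k
    induction k with
    | zero =>
      rw [add_zero, nonsing_inv_mul _ (gram_posDef P _).det_pos.ne'.isUnit, trace_one]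
      simp [hd]
    | succ k ih =>
      have h1 := unc_nonneg P (firstObs o j) (diff (o (j + k)))
      have h2 := (unc_le_norm_sq P (firstObs o j) (diff (o (j + k)))).trans (hB _)
      have h3 : ((gram P (firstObs o j))⁻¹ * gram P (firstObs o (j + (k + 1)))).trace =
          ((gram P (firstObs o j))⁻¹ * gram P (firstObs o (j + k))).trace +
            unc P (firstObs o j) (diff (o (j + k))) := by
        rw [← add_assoc, firstObs_succ, gram_extend, mul_add, trace_add, mul_vecMulVec,
          trace_vecMulVec, dotProduct_comm]
        rfl
      rw [h3]
      push_cast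
      constructor <;> linarith [ih.1, ih.2]
  obtain ⟨h1, h2⟩ := htr k
  have hj := (gram_posDef P (firstObs o j)).det_pos
  have hk := (gram_posDef P (firstObs o (j + k))).det_pos
  have hpos : 0 < d + 1 + B * k := by positivity
  have hdet := det_le_det_mul_trace_pow (gram_posDef P (firstObs o j))
    (gram_posDef P (firstObs o (j + k))).posSemidef
  have hdet2 : (gram P (firstObs o (j + k))).det ≤
      (gram P (firstObs o j)).det * (d + 1 + B * k) ^ Fintype.card (S × A) :=
    hdet.trans (mul_le_mul_of_nonneg_left
      (pow_le_pow_left₀ (hd0.trans h1) (by linarith) _) hj.le)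
  have hlog := Real.log_le_log hk hdet2
  rw [Real.log_mul hj.ne' (by positivity), Real.log_pow] at hlog
  simp only [logDet]
  linarith

/-- The noise-weighted feature sum `∑ η x`. -/
def noiseSum (r : EuclideanSpace ℝ (S × A)) {n : ℕ} (H : Fin n → Obs S A h) : S × A → ℝ :=
  ∑ i, (label (H i) - inner ℝ r (diff (H i))) • (diff (H i)).ofLp

/-- The self-normalized noise `‖∑ η x‖²` in the metric `M⁻¹`. -/
def selfNorm (r : EuclideanSpace ℝ (S × A)) {n : ℕ} (H : Fin n → Obs S A h) : ℝ :=
  invQuad (gram P H) (noiseSum r H)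

/-- The increment of the self-normalized noise, by the Sherman–Morrison formula; `w` is the product
of the noise sum and the new feature difference in the metric `M⁻¹`, which does not involve the
new label. -/
lemma selfNorm_extend (r : EuclideanSpace ℝ (S × A)) {n : ℕ} (H : Fin n → Obs S A h)
    (o : Obs S A h) :
    ∃ w : ℝ, ∀ b : Bool,
      selfNorm P r (extend H (o.1, b)) = selfNorm P r H +
        (-w ^ 2 + 2 * (label (o.1, b) - inner ℝ r (diff o)) * w +
          (label (o.1, b) - inner ℝ r (diff o)) ^ 2 * unc P H (diff o)) /
          (1 + unc P H (diff o)) := by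
  refine ⟨noiseSum r H ⬝ᵥ (gram P H)⁻¹ *ᵥ (diff o).ofLp, fun b => ?_⟩
  have hd : diff ((o.1, b) : Obs S A h) = diff o := rfl
  have hS : noiseSum r (extend H (o.1, b)) = noiseSum r H +
      (label (o.1, b) - inner ℝ r (diff o)) • (diff o).ofLp := by
    simp [noiseSum, extend, Fin.sum_univ_castSucc, hd]
  have hM := gram_posDef P H
  have hq : 1 + invQuad (gram P H) (diff o).ofLp ≠ 0 := by
    have := invQuad_nonneg hM (diff o).ofLp
    positivity
  have hM' := posDef_add_vecMulVec hM (diff o).ofLp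
  rw [selfNorm, gram_extend, hd, hS, invQuad_add_smul hM', dotProduct_inv_add_vecMulVec hM,
    invQuad_add_vecMulVec hM, invQuad_add_vecMulVec hM, selfNorm, unc]
  rw [← invQuad]
  field_simp
  ring

/-- The error of the ridge estimate in any direction, in terms of the self-normalized noise. -/
lemma inner_ridge_sub_sq_le (r : EuclideanSpace ℝ (S × A)) {n : ℕ} (H : Fin n → Obs S A h)
    (v : EuclideanSpace ℝ (S × A)) :
    (inner ℝ v (ridge P H - r)) ^ 2 ≤
      unc P H v * (2 * selfNorm P r H + 2 * (P.lam ^ 2 * ‖r‖ ^ 2)) := by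
  have hM := gram_posDef P H
  have hinner : ∀ x y : EuclideanSpace ℝ (S × A), inner ℝ x y = y.ofLp ⬝ᵥ x.ofLp := fun x y => by
    simp [EuclideanSpace.inner_eq_star_dotProduct]
  have hMr : gram P H *ᵥ r.ofLp =
      P.lam • r.ofLp + ∑ i, (inner ℝ r (diff (H i))) • (diff (H i)).ofLp := by
    rw [gram, add_mulVec, smul_mulVec, one_mulVec, sum_mulVec]
    congr 1
    refine Finset.sum_congr rfl fun i _ => ?_
    rw [vecMulVec_mulVec, hinner, op_smul_eq_smul]
  have hsum : (∑ i, label (H i) • diff (H i)).ofLp =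
      noiseSum r H + (-P.lam) • r.ofLp + gram P H *ᵥ r.ofLp := by
    rw [hMr, noiseSum, WithLp.ofLp_sum]
    simp only [sub_smul, Finset.sum_sub_distrib, neg_smul, WithLp.ofLp_smul]
    abel
  have hdev : (ridge P H - r).ofLp = (gram P H)⁻¹ *ᵥ (noiseSum r H + (-P.lam) • r.ofLp) := by
    rw [WithLp.ofLp_sub, ridge, hsum, mulVec_add _ _ (gram P H *ᵥ r.ofLp), mulVec_mulVec,
      nonsing_inv_mul _ hM.det_pos.ne'.isUnit, one_mulVec]
    simp
  rw [hinner, dotProduct_comm, hdev]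
  refine (inv_dotProduct_sq_le hM _ _).trans ?_
  refine mul_le_mul_of_nonneg_left ?_ (invQuad_nonneg hM _)
  have h1 := invQuad_add_le hM (noiseSum r H) ((-P.lam) • r.ofLp)
  rw [invQuad_smul] at h1
  have h2 := unc_le_norm_sq P H r
  have h3 := mul_le_mul_of_nonneg_left h2 (sq_nonneg P.lam)
  rw [unc] at h3
  rw [selfNorm]
  linarith

/-- The confidence radius in terms of `logDet`. -/
lemma beta_eq {n : ℕ} (H : Fin n → Obs S A h) :
    beta P H = P.R * √(logDet P H + 2 * Real.log P.delta⁻¹) + √P.lam * P.Sr := by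
  have h1 := (gram_posDef P H).det_pos
  have h2 := lam_pos P
  have h3 := P.delta_pos
  rw [beta, Real.log_div (by positivity) h3.ne', Real.log_mul (by positivity) (by positivity),
    Real.log_rpow h1, Real.log_rpow h2, Real.log_inv, logDet]
  congr 3
  ring

lemma log_inv_delta_pos : 0 < Real.log P.delta⁻¹ :=
  Real.log_pos ((one_lt_inv₀ P.delta_pos).2 P.delta_lt_one)

lemma exists_beta_sq_le :
    ∃ C : ℝ, 0 < C ∧ ∀ (n : ℕ) (H : Fin n → Obs S A h), beta P H ^ 2 ≤ C * (1 + logDet P H) := by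
  have hl := log_inv_delta_pos P
  refine ⟨2 * P.R ^ 2 * (1 + 2 * Real.log P.delta⁻¹) + 2 * (P.lam * P.Sr ^ 2) + 1, ?_, ?_⟩
  · have := lam_pos P
    positivity
  intro n H
  have h0 := logDet_nonneg P H
  have h1 : √(logDet P H + 2 * Real.log P.delta⁻¹) ^ 2 = logDet P H + 2 * Real.log P.delta⁻¹ :=
    Real.sq_sqrt (by positivity)
  have h2 : √P.lam ^ 2 = P.lam := Real.sq_sqrt (lam_pos P).le
  have h3 : beta P H ^ 2 ≤ 2 * P.R ^ 2 * (logDet P H + 2 * Real.log P.delta⁻¹) +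
      2 * (P.lam * P.Sr ^ 2) := by
    rw [beta_eq]
    calc _ ≤ 2 * ((P.R * √(logDet P H + 2 * Real.log P.delta⁻¹)) ^ 2 +
          (√P.lam * P.Sr) ^ 2) := add_sq_le
      _ = _ := by rw [mul_pow, mul_pow, h1, h2]; ring
  have hlam := (lam_pos P).le
  nlinarith [mul_nonneg (sq_nonneg P.R) (mul_nonneg hl.le h0), sq_nonneg P.R,
    mul_nonneg (mul_nonneg hlam (sq_nonneg P.Sr)) h0]

lemma exists_le_beta_sq (hR : 0 < P.R) (hS : 0 ≤ P.Sr) :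
    ∃ c : ℝ, 0 < c ∧ ∀ (n : ℕ) (H : Fin n → Obs S A h), c * (1 + logDet P H) ≤ beta P H ^ 2 := by
  have hl := log_inv_delta_pos P
  refine ⟨P.R ^ 2 * min 1 (2 * Real.log P.delta⁻¹), by positivity, fun n H => ?_⟩
  have h0 := logDet_nonneg P H
  have h1 : √(logDet P H + 2 * Real.log P.delta⁻¹) ^ 2 = logDet P H + 2 * Real.log P.delta⁻¹ :=
    Real.sq_sqrt (by positivity)
  have h3 : P.R ^ 2 * (logDet P H + 2 * Real.log P.delta⁻¹) ≤ beta P H ^ 2 := by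
    rw [beta_eq]
    have h4 : 0 ≤ √P.lam * P.Sr := by positivity
    have h5 : 0 ≤ P.R * √(logDet P H + 2 * Real.log P.delta⁻¹) := by positivity
    calc _ = (P.R * √(logDet P H + 2 * Real.log P.delta⁻¹)) ^ 2 := by rw [mul_pow, h1]
      _ ≤ _ := pow_le_pow_left₀ h5 (by linarith) 2
  refine le_trans ?_ h3
  rw [mul_assoc]
  refine mul_le_mul_of_nonneg_left ?_ (sq_nonneg _)
  have h6 := min_le_left 1 (2 * Real.log P.delta⁻¹)
  have h7 := min_le_right 1 (2 * Real.log P.delta⁻¹)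
  nlinarith

end Histories

/-! ### Lower bounds for Gamma and Dirichlet distributions -/

section GammaDirichlet

open Set

/-- The function `x ↦ x ^ b e^{-x}` has its maximum at `b`. -/
lemma rpow_mul_exp_neg_le {b x : ℝ} (hb : 0 < b) (hx : 0 < x) :
    x ^ b * Real.exp (-x) ≤ b ^ b * Real.exp (-b) := by
  rw [Real.rpow_def_of_pos hx, Real.rpow_def_of_pos hb, ← Real.exp_add, ← Real.exp_add,
    Real.exp_le_exp]
  have h1 := Real.log_le_sub_one_of_pos (div_pos hx hb)
  rw [Real.log_div hx.ne' hb.ne'] at h1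
  have h2 := mul_le_mul_of_nonneg_right h1 hb.le
  have h3 : (x / b - 1) * b = x - b := by field_simp
  rw [h3] at h2
  linarith

/-- A quadratic lower bound for `x ↦ x ^ b e^{-x}` relative to its maximum. -/
lemma le_rpow_mul_exp_neg {b y : ℝ} (hb : 0 < b) (hy : 0 < y) :
    b ^ b * Real.exp (-b) * Real.exp (-((y - b) ^ 2 / y)) ≤ y ^ b * Real.exp (-y) := by
  rw [Real.rpow_def_of_pos hy, Real.rpow_def_of_pos hb, ← Real.exp_add, ← Real.exp_add,
    ← Real.exp_add, Real.exp_le_exp]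
  have h1 := Real.log_le_sub_one_of_pos (div_pos hb hy)
  rw [Real.log_div hb.ne' hy.ne'] at h1
  have h2 := mul_le_mul_of_nonneg_right h1 hb.le
  have h3 : (b / y - 1) * b = (b - y) + (y - b) ^ 2 / y := by field_simp; ring
  rw [h3] at h2
  linarith

/-- A bound for the Gamma function that is off by at most a polynomial factor: the integrand is at
most `x ^ (a - 1)` on `(0, 1]`, and at most the maximum of `x ^ (a + 1) e^{-x}` times `x ^ (-2)` on
`(1, ∞)`. -/
lemma Gamma_le {a : ℝ} (ha : 0 < a) :
    Real.Gamma a ≤ 1 / a + (a + 1) ^ (a + 1) * Real.exp (-(a + 1)) := by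
  set M := (a + 1) ^ (a + 1) * Real.exp (-(a + 1)) with hM
  have hM0 : 0 ≤ M := by positivity
  have hint := Real.GammaIntegral_convergent ha
  rw [Real.Gamma_eq_integral ha, ← Ioc_union_Ioi_eq_Ioi (zero_le_one' ℝ),
    setIntegral_union Ioc_disjoint_Ioi_same measurableSet_Ioi
      (hint.mono_set Ioc_subset_Ioi_self) (hint.mono_set (Ioi_subset_Ioi zero_le_one))]
  refine add_le_add ?_ ?_
  · have hi : IntervalIntegrable (fun x : ℝ => x ^ (a - 1)) volume 0 1 :=
      intervalIntegral.intervalIntegrable_rpow' (by linarith)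
    have h1 : ∫ x in Ioc (0 : ℝ) 1, x ^ (a - 1) = 1 / a := by
      rw [← intervalIntegral.integral_of_le zero_le_one, integral_rpow (Or.inl (by linarith))]
      simp [ha.ne']
    rw [← h1]
    refine setIntegral_mono_on (hint.mono_set Ioc_subset_Ioi_self)
      ((intervalIntegrable_iff_integrableOn_Ioc_of_le zero_le_one).1 hi) measurableSet_Ioc ?_
    intro x hx
    have : Real.exp (-x) ≤ 1 := Real.exp_le_one_iff.2 (by linarith [hx.1])
    exact mul_le_of_le_one_left (Real.rpow_nonneg hx.1.le _) this
  · have hi : IntegrableOn (fun x : ℝ => M * x ^ (-2 : ℝ)) (Ioi 1) :=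
      (integrableOn_Ioi_rpow_of_lt (by norm_num) one_pos).const_mul _
    have h1 : ∫ x in Ioi (1 : ℝ), M * x ^ (-2 : ℝ) = M := by
      rw [integral_const_mul, integral_Ioi_rpow_of_lt (by norm_num) one_pos]
      norm_num
    rw [← h1]
    refine setIntegral_mono_on (hint.mono_set (Ioi_subset_Ioi zero_le_one)) hi
      measurableSet_Ioi ?_
    intro x hx
    have hx0 : 0 < x := one_pos.trans hx
    have h2 := rpow_mul_exp_neg_le (b := a + 1) (by linarith) hx0
    have h3 : x ^ (a - 1) = x ^ (a + 1) * x ^ (-2 : ℝ) := by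
      rw [← Real.rpow_add hx0]; congr 1; ring
    rw [h3]
    calc Real.exp (-x) * (x ^ (a + 1) * x ^ (-2 : ℝ))
        = (x ^ (a + 1) * Real.exp (-x)) * x ^ (-2 : ℝ) := by ring
      _ ≤ _ := mul_le_mul_of_nonneg_right h2 (by positivity)

/-- The variance of a Gamma variable of shape `a` and rate `1` is `a`. -/
lemma integral_sq_sub_mul_Gamma {a : ℝ} (ha : 0 < a) :
    IntegrableOn (fun x : ℝ => (x - a) ^ 2 * (x ^ (a - 1) * Real.exp (-x))) (Ioi 0) ∧
    ∫ x in Ioi (0 : ℝ), (x - a) ^ 2 * (x ^ (a - 1) * Real.exp (-x)) = a * Real.Gamma a := by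
  have i0 := Real.GammaIntegral_convergent ha
  have i1 := Real.GammaIntegral_convergent (s := a + 1) (by linarith)
  have i2 := Real.GammaIntegral_convergent (s := a + 1 + 1) (by linarith)
  have hi := (i2.sub (i1.const_mul (2 * a))).add (i0.const_mul (a ^ 2))
  have heq : EqOn (fun x : ℝ => Real.exp (-x) * x ^ (a + 1 + 1 - 1) -
      2 * a * (Real.exp (-x) * x ^ (a + 1 - 1)) + a ^ 2 * (Real.exp (-x) * x ^ (a - 1)))
      (fun x : ℝ => (x - a) ^ 2 * (x ^ (a - 1) * Real.exp (-x))) (Ioi 0) := by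
    intro x hx
    have hx0 : (0 : ℝ) < x := hx
    have h1 : x ^ (a + 1 - 1) = x ^ (a - 1) * x := by
      rw [← Real.rpow_add_one hx0.ne']; congr 1; ring
    have h2 : x ^ (a + 1 + 1 - 1) = x ^ (a - 1) * x * x := by
      rw [← Real.rpow_add_one hx0.ne', ← Real.rpow_add_one hx0.ne']; congr 1; ring
    simp only [h1, h2]
    ring
  refine ⟨IntegrableOn.congr_fun hi heq measurableSet_Ioi, ?_⟩
  rw [← setIntegral_congr_fun measurableSet_Ioi heq, integral_add, integral_sub,
    integral_const_mul, integral_const_mul, ← Real.Gamma_eq_integral ha,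
    ← Real.Gamma_eq_integral (by linarith), ← Real.Gamma_eq_integral (by linarith),
    Real.Gamma_add_one (by linarith : a + 1 ≠ 0), Real.Gamma_add_one ha.ne']
  · ring
  · exact i2
  · exact i1.const_mul _
  · exact i2.sub (i1.const_mul (2 * a))
  · exact i0.const_mul _

/-- Chebyshev's inequality for Gamma variables. -/
lemma gammaMeasure_abs_sub_ge_le {a t : ℝ} (ha : 0 < a) (ht : 0 < t) :
    gammaMeasure a 1 {x | t ≤ |x - a|} ≤ ENNReal.ofReal (a / t ^ 2) := by
  have hmeas : MeasurableSet {x : ℝ | t ≤ |x - a|} :=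
    measurableSet_le measurable_const (by fun_prop)
  have hG := Real.Gamma_pos_of_pos ha
  obtain ⟨hi, hval⟩ := integral_sq_sub_mul_Gamma ha
  rw [gammaMeasure, withDensity_apply _ hmeas]
  calc ∫⁻ x in {x | t ≤ |x - a|}, gammaPDF a 1 x
      ≤ ∫⁻ x, (Ioi (0 : ℝ)).indicator (fun x => ENNReal.ofReal
          ((t ^ 2)⁻¹ * (Real.Gamma a)⁻¹ * ((x - a) ^ 2 * (x ^ (a - 1) * Real.exp (-x))))) x := by
        rw [← lintegral_indicator hmeas]
        refine lintegral_mono_ae ?_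
        have h0 : ∀ᵐ x : ℝ, x ≠ 0 := by simp [ae_iff]
        filter_upwards [h0] with x hx
        by_cases hx1 : t ≤ |x - a|
        swap
        · rw [indicator_of_notMem (by simpa using hx1)]; exact zero_le
        rw [indicator_of_mem (by simpa using hx1)]
        rcases lt_or_gt_of_ne hx with hx | hx
        · rw [gammaPDF_of_neg hx]; exact zero_le
        rw [indicator_of_mem (by simpa using hx), gammaPDF_of_nonneg hx.le]
        refine ENNReal.ofReal_le_ofReal ?_
        have h1 : 1 ≤ (t ^ 2)⁻¹ * (x - a) ^ 2 := by
          rw [inv_mul_eq_div, one_le_div (by positivity), ← sq_abs (x - a)]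
          exact pow_le_pow_left₀ ht.le hx1 2
        have h2 : 0 ≤ (Real.Gamma a)⁻¹ * (x ^ (a - 1) * Real.exp (-x)) := by positivity
        calc 1 ^ a / Real.Gamma a * x ^ (a - 1) * Real.exp (-(1 * x))
            = 1 * ((Real.Gamma a)⁻¹ * (x ^ (a - 1) * Real.exp (-x))) := by
              rw [Real.one_rpow, one_mul x]; ring
          _ ≤ ((t ^ 2)⁻¹ * (x - a) ^ 2) * ((Real.Gamma a)⁻¹ * (x ^ (a - 1) * Real.exp (-x))) :=
              mul_le_mul_of_nonneg_right h1 h2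
          _ = _ := by ring
    _ = ENNReal.ofReal (∫ x in Ioi (0 : ℝ),
          (t ^ 2)⁻¹ * (Real.Gamma a)⁻¹ * ((x - a) ^ 2 * (x ^ (a - 1) * Real.exp (-x)))) := by
        rw [lintegral_indicator measurableSet_Ioi, ofReal_integral_eq_lintegral_ofReal]
        · exact hi.const_mul _
        · rw [EventuallyLE, ae_restrict_iff' measurableSet_Ioi]
          refine ae_of_all _ fun x (hx : 0 < x) => ?_
          simp only [Pi.zero_apply]
          positivity
    _ = _ := by
        rw [integral_const_mul, hval]
        congr 1
        field_simp

/-- A Gaussian lower bound, with variance `y`, for the Gamma density, uniform over all shapes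
`a ≥ a₀`. -/
lemma le_gammaPDFReal {a a₀ y : ℝ} (ha₀ : 0 < a₀) (ha : a₀ ≤ a) (hy : 0 < y) :
    (1 + Real.exp 1 / a₀)⁻¹ * (y ^ 2)⁻¹ * Real.exp (-((y - (a + 1)) ^ 2 / y)) ≤
      gammaPDFReal a 1 y := by
  have ha' : 0 < a := ha₀.trans_le ha
  have hb : 0 < a + 1 := by linarith
  set M := (a + 1) ^ (a + 1) * Real.exp (-(a + 1)) with hM
  have hM0 : 0 < M := by positivity
  have hM1 : Real.exp (-1) ≤ M := by
    have := rpow_mul_exp_neg_le hb one_pos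
    rwa [Real.one_rpow, one_mul] at this
  have hG := Real.Gamma_pos_of_pos ha'
  have hGle : Real.Gamma a ≤ (1 + Real.exp 1 / a₀) * M := by
    have h1 : 1 / a ≤ Real.exp 1 / a₀ * M := by
      calc 1 / a ≤ 1 / a₀ := one_div_le_one_div_of_le ha₀ ha
        _ = Real.exp 1 / a₀ * Real.exp (-1) := by
            rw [div_mul_eq_mul_div, ← Real.exp_add]; simp
        _ ≤ _ := mul_le_mul_of_nonneg_left hM1 (by positivity)
    linarith [Gamma_le ha']
  have h2 := le_rpow_mul_exp_neg hb hy
  have h3 : y ^ (a - 1) = y ^ (a + 1) * (y ^ 2)⁻¹ := by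
    rw [← Real.rpow_natCast y 2, ← Real.rpow_neg hy.le, ← Real.rpow_add hy]
    congr 1
    push_cast
    ring
  rw [gammaPDFReal, if_pos hy.le, Real.one_rpow, one_mul, h3]
  have hc : 0 < 1 + Real.exp 1 / a₀ := by positivity
  calc (1 + Real.exp 1 / a₀)⁻¹ * (y ^ 2)⁻¹ * Real.exp (-((y - (a + 1)) ^ 2 / y))
      = ((1 + Real.exp 1 / a₀) * M)⁻¹ * (y ^ 2)⁻¹ *
          (M * Real.exp (-((y - (a + 1)) ^ 2 / y))) := by field_simp
    _ ≤ (Real.Gamma a)⁻¹ * (y ^ 2)⁻¹ * (y ^ (a + 1) * Real.exp (-y)) := by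
        gcongr
    _ = _ := by ring

/-- Gamma variables put mass at least `exp (-O(z³))` on the window of relative width `z⁻²` around
a target `p u⁵` that differs from the shape by `O(u³)`. For `u ≫ z` this is Chebyshev's inequality;
otherwise the density is bounded below. -/
lemma exists_le_gammaMeasure {K a₀ : ℝ} (hK : 0 ≤ K) (ha₀ : 0 < a₀) :
    ∃ K' : ℝ, 0 ≤ K' ∧ ∀ z u p a : ℝ, 1 ≤ z → 1 ≤ u → 0 ≤ p → p ≤ 1 → a₀ ≤ a →
      |a - p * u ^ 5| ≤ K * u ^ 3 →
      ENNReal.ofReal (Real.exp (-(K' * z ^ 3))) ≤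
        gammaMeasure a 1 {g | |g - p * u ^ 5| ≤ u ^ 5 / z ^ 2} := by
  set k : ℝ := 8 * (1 + K) with hk
  have hk1 : 1 ≤ k := by linarith
  set K2 : ℝ := k ^ 2 + K + 1 with hK2
  set c : ℝ := (1 + Real.exp 1 / a₀)⁻¹ * (8 * k ^ 10)⁻¹ with hc
  have hc0 : 0 < c := by positivity
  refine ⟨1 + 2 * K2 ^ 2 * k + 12 + |Real.log c|, by positivity, ?_⟩
  intro z u p a hz hu hp0 hp1 ha hap
  have ha' : 0 < a := ha₀.trans_le ha
  have hz0 : 0 < z := by linarith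
  have hu0 : 0 < u := by linarith
  have hz3 : 1 ≤ z ^ 3 := one_le_pow₀ hz
  have hprob := isProbabilityMeasure_gammaMeasure ha' one_pos
  rcases le_total (k * z) u with hcase | hcase
  · -- the mean is within half the radius of the target, and the variance is much smaller than its
    -- square
    set t : ℝ := u ^ 5 / (2 * z ^ 2) with ht
    have ht0 : 0 < t := by positivity
    have hku : k ^ 2 * z ^ 2 ≤ u ^ 2 := by
      rw [← mul_pow]; exact pow_le_pow_left₀ (by positivity) hcase 2
    have h1 : K * u ^ 3 ≤ t := by
      rw [ht, le_div_iff₀ (by positivity)]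
      have : 2 * K * z ^ 2 ≤ u ^ 2 := by
        refine le_trans ?_ hku
        refine mul_le_mul_of_nonneg_right ?_ (by positivity)
        nlinarith
      calc K * u ^ 3 * (2 * z ^ 2) = (2 * K * z ^ 2) * u ^ 3 := by ring
        _ ≤ u ^ 2 * u ^ 3 := mul_le_mul_of_nonneg_right this (by positivity)
        _ = u ^ 5 := by ring
    have h2 : a / t ^ 2 ≤ 1 / 2 := by
      have hu35 : u ^ 3 ≤ u ^ 5 := pow_le_pow_right₀ hu (by norm_num)
      have ha1 : a ≤ (1 + K) * u ^ 5 := by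
        have := (abs_le.1 hap).2
        have h3 : p * u ^ 5 ≤ 1 * u ^ 5 := mul_le_mul_of_nonneg_right hp1 (by positivity)
        have h4 : K * u ^ 3 ≤ K * u ^ 5 := mul_le_mul_of_nonneg_left hu35 hK
        linarith
      have h5 : 8 * (1 + K) * z ^ 4 ≤ u ^ 5 := by
        calc 8 * (1 + K) * z ^ 4 = k * z ^ 4 := by rw [hk]
          _ ≤ k ^ 5 * z ^ 5 :=
            mul_le_mul (le_self_pow₀ hk1 (by norm_num)) (pow_le_pow_right₀ hz (by norm_num))
              (by positivity) (by positivity)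
          _ = (k * z) ^ 5 := by ring
          _ ≤ u ^ 5 := pow_le_pow_left₀ (by positivity) hcase 5
      rw [ht, div_pow, div_div_eq_mul_div, div_le_iff₀ (by positivity)]
      calc a * (2 * z ^ 2) ^ 2 ≤ ((1 + K) * u ^ 5) * (2 * z ^ 2) ^ 2 :=
            mul_le_mul_of_nonneg_right ha1 (by positivity)
        _ = 1 / 2 * ((8 * (1 + K) * z ^ 4) * u ^ 5) := by ring
        _ ≤ 1 / 2 * (u ^ 5 * u ^ 5) := by gcongr
        _ = _ := by ring
    have hsub : {g | |g - p * u ^ 5| ≤ u ^ 5 / z ^ 2}ᶜ ⊆ {x | t ≤ |x - a|} := by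
      intro g hg
      simp only [mem_compl_iff, mem_ofPred_eq, not_le] at hg ⊢
      have h3 : u ^ 5 / z ^ 2 = t + t := by rw [ht]; field_simp; ring
      have h4 := abs_sub_le g a (p * u ^ 5)
      linarith
    have hm : MeasurableSet {g : ℝ | |g - p * u ^ 5| ≤ u ^ 5 / z ^ 2} :=
      measurableSet_le (by fun_prop) measurable_const
    have hbad : gammaMeasure a 1 {g | |g - p * u ^ 5| ≤ u ^ 5 / z ^ 2}ᶜ ≤ ENNReal.ofReal (1 / 2) :=
      (measure_mono hsub).trans ((gammaMeasure_abs_sub_ge_le ha' ht0).trans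
        (ENNReal.ofReal_le_ofReal h2))
    rw [prob_compl_eq_one_sub hm, tsub_le_iff_right] at hbad
    have hhalf : ENNReal.ofReal (1 / 2) ≤
        gammaMeasure a 1 {g | |g - p * u ^ 5| ≤ u ^ 5 / z ^ 2} := by
      have h5 : (1 : ENNReal) = ENNReal.ofReal (1 / 2) + ENNReal.ofReal (1 / 2) := by
        rw [← ENNReal.ofReal_add (by norm_num) (by norm_num)]; norm_num
      rw [h5] at hbad
      exact (ENNReal.add_le_add_iff_left ENNReal.ofReal_ne_top).1 hbad
    refine le_trans (ENNReal.ofReal_le_ofReal ?_) hhalf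
    have h6 : Real.exp (-((1 + 2 * K2 ^ 2 * k + 12 + |Real.log c|) * z ^ 3)) ≤ Real.exp (-1) := by
      rw [Real.exp_le_exp]
      have : 0 ≤ 2 * K2 ^ 2 * k + 12 + |Real.log c| := by positivity
      nlinarith
    have h7 := Real.exp_neg_one_lt_half
    rw [one_div]
    linarith
  · -- the density is integrated over the upper part of the window, which stays away from `0` even
    -- when `p = 0`
    set J := Icc (p * u ^ 5 + u ^ 5 / (2 * z ^ 2)) (p * u ^ 5 + u ^ 5 / z ^ 2) with hJ
    have hsub : J ⊆ {g | |g - p * u ^ 5| ≤ u ^ 5 / z ^ 2} := by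
      intro g hg
      have h1 : 0 ≤ u ^ 5 / (2 * z ^ 2) := by positivity
      have h2 : 0 ≤ u ^ 5 / z ^ 2 := by positivity
      rw [mem_ofPred_eq, abs_le]
      constructor <;> linarith [hg.1, hg.2]
    refine le_trans ?_ (measure_mono hsub)
    rw [gammaMeasure, withDensity_apply _ measurableSet_Icc]
    have hdens : ∀ y ∈ J, ENNReal.ofReal (c * 2 * (z ^ 10)⁻¹ *
        Real.exp (-(2 * K2 ^ 2 * k * z ^ 3))) ≤ gammaPDF a 1 y := by
      intro y hy
      have hpu : 0 ≤ p * u ^ 5 := by positivity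
      have hylow : u ^ 5 / (2 * z ^ 2) ≤ y := by linarith [hy.1]
      have hy0 : 0 < y := lt_of_lt_of_le (by positivity) hylow
      have huz : u ^ 5 / z ^ 2 ≤ u ^ 5 := div_le_self (by positivity) (one_le_pow₀ hz)
      have hyup : y ≤ 2 * k ^ 5 * z ^ 5 := by
        have h1 : p * u ^ 5 ≤ 1 * u ^ 5 := mul_le_mul_of_nonneg_right hp1 (by positivity)
        have h2 : u ^ 5 ≤ (k * z) ^ 5 := pow_le_pow_left₀ hu0.le hcase 5
        rw [mul_pow] at h2
        linarith [hy.2]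
      have hdev : |y - (a + 1)| ≤ K2 * u ^ 3 := by
        have h1 : u ^ 5 / z ^ 2 ≤ k ^ 2 * u ^ 3 := by
          rw [div_le_iff₀ (by positivity)]
          have : u ^ 2 ≤ (k * z) ^ 2 := pow_le_pow_left₀ hu0.le hcase 2
          calc u ^ 5 = u ^ 2 * u ^ 3 := by ring
            _ ≤ (k * z) ^ 2 * u ^ 3 := mul_le_mul_of_nonneg_right this (by positivity)
            _ = _ := by ring
        have h2 : (1 : ℝ) ≤ u ^ 3 := one_le_pow₀ hu
        have h3 := abs_le.1 hap
        have h4 : 0 ≤ u ^ 5 / (2 * z ^ 2) := by positivity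
        have h5 : 0 ≤ k ^ 2 * u ^ 3 := by positivity
        have h6 : K2 * u ^ 3 = k ^ 2 * u ^ 3 + K * u ^ 3 + u ^ 3 := by rw [hK2]; ring
        rw [abs_le, h6]
        constructor <;> linarith [hy.1, hy.2, h3.1, h3.2]
      have hexp : (y - (a + 1)) ^ 2 / y ≤ 2 * K2 ^ 2 * k * z ^ 3 := by
        rw [div_le_iff₀ hy0]
        have h1 : (y - (a + 1)) ^ 2 ≤ (K2 * u ^ 3) ^ 2 := by
          rw [← sq_abs]; exact pow_le_pow_left₀ (abs_nonneg _) hdev 2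
        calc (y - (a + 1)) ^ 2 ≤ (K2 * u ^ 3) ^ 2 := h1
          _ = (2 * K2 ^ 2 * u * z ^ 2) * (u ^ 5 / (2 * z ^ 2)) := by field_simp
          _ ≤ (2 * K2 ^ 2 * (k * z) * z ^ 2) * y := by gcongr
          _ = _ := by ring
      rw [gammaPDF]
      refine ENNReal.ofReal_le_ofReal (le_trans ?_ (le_gammaPDFReal ha₀ ha hy0))
      have h1 : c * 2 * (z ^ 10)⁻¹ ≤ (1 + Real.exp 1 / a₀)⁻¹ * (y ^ 2)⁻¹ := by
        have h2 : y ^ 2 ≤ 4 * k ^ 10 * z ^ 10 := by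
          calc y ^ 2 ≤ (2 * k ^ 5 * z ^ 5) ^ 2 := pow_le_pow_left₀ hy0.le hyup 2
            _ = _ := by ring
        have h3 : (4 * k ^ 10 * z ^ 10)⁻¹ ≤ (y ^ 2)⁻¹ := inv_anti₀ (by positivity) h2
        calc c * 2 * (z ^ 10)⁻¹ = (1 + Real.exp 1 / a₀)⁻¹ * (4 * k ^ 10 * z ^ 10)⁻¹ := by
              rw [hc]; field_simp; ring
          _ ≤ _ := mul_le_mul_of_nonneg_left h3 (by positivity)
      exact mul_le_mul h1 (Real.exp_le_exp.2 (neg_le_neg hexp)) (by positivity) (by positivity)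
    have hlen : p * u ^ 5 + u ^ 5 / z ^ 2 - (p * u ^ 5 + u ^ 5 / (2 * z ^ 2)) =
        u ^ 5 / (2 * z ^ 2) := by field_simp; ring
    calc ENNReal.ofReal (Real.exp (-((1 + 2 * K2 ^ 2 * k + 12 + |Real.log c|) * z ^ 3)))
        ≤ ENNReal.ofReal (c * 2 * (z ^ 10)⁻¹ * Real.exp (-(2 * K2 ^ 2 * k * z ^ 3)) *
            (u ^ 5 / (2 * z ^ 2))) := by
          refine ENNReal.ofReal_le_ofReal ?_
          have h1 : (1 : ℝ) ≤ u ^ 5 := one_le_pow₀ hu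
          have h2 : c * (z ^ 12)⁻¹ * Real.exp (-(2 * K2 ^ 2 * k * z ^ 3)) ≤
              c * 2 * (z ^ 10)⁻¹ * Real.exp (-(2 * K2 ^ 2 * k * z ^ 3)) *
                (u ^ 5 / (2 * z ^ 2)) := by
            calc c * (z ^ 12)⁻¹ * Real.exp (-(2 * K2 ^ 2 * k * z ^ 3))
                = c * 2 * (z ^ 10)⁻¹ * Real.exp (-(2 * K2 ^ 2 * k * z ^ 3)) *
                  (1 / (2 * z ^ 2)) := by field_simp
              _ ≤ _ := by gcongr
          refine le_trans ?_ h2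
          have h3 : Real.exp (-(12 * z ^ 3)) ≤ (z ^ 12)⁻¹ := by
            rw [Real.exp_neg]
            refine inv_anti₀ (by positivity) ?_
            have h4 : z ≤ Real.exp (z ^ 3) := by
              have := Real.add_one_le_exp (z ^ 3)
              have h5 : z ≤ z ^ 3 := le_self_pow₀ hz (by norm_num)
              linarith
            calc z ^ 12 ≤ Real.exp (z ^ 3) ^ 12 := pow_le_pow_left₀ hz0.le h4 12
              _ = _ := by rw [← Real.exp_nat_mul]; norm_num
          have h6 : Real.exp (-(|Real.log c| * z ^ 3)) ≤ c := by
            rw [← Real.le_log_iff_exp_le hc0]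
            have := neg_abs_le (Real.log c)
            nlinarith [abs_nonneg (Real.log c)]
          have h7 : Real.exp (-(1 * z ^ 3)) ≤ 1 := Real.exp_le_one_iff.2 (by linarith)
          calc Real.exp (-((1 + 2 * K2 ^ 2 * k + 12 + |Real.log c|) * z ^ 3))
              = Real.exp (-(1 * z ^ 3)) * (Real.exp (-(|Real.log c| * z ^ 3)) *
                  Real.exp (-(12 * z ^ 3)) * Real.exp (-(2 * K2 ^ 2 * k * z ^ 3))) := by
                rw [← Real.exp_add, ← Real.exp_add, ← Real.exp_add]; congr 1; ring
            _ ≤ 1 * (c * (z ^ 12)⁻¹ * Real.exp (-(2 * K2 ^ 2 * k * z ^ 3))) := by gcongr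
            _ = _ := one_mul _
      _ = ∫⁻ _ in J, ENNReal.ofReal (c * 2 * (z ^ 10)⁻¹ *
            Real.exp (-(2 * K2 ^ 2 * k * z ^ 3))) := by
          rw [setLIntegral_const, hJ, Real.volume_Icc, hlen, ← ENNReal.ofReal_mul (by positivity)]
      _ ≤ ∫⁻ y in J, gammaPDF a 1 y := setLIntegral_mono' measurableSet_Icc hdens

variable {S A : Type*} [Fintype S] [DecidableEq S] [Fintype A] [DecidableEq A] {h : ℕ}

lemma isProbabilityMeasure_dirichlet {α : S → ℝ} (hα : ∀ s, 0 < α s) :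
    IsProbabilityMeasure (dirichlet α) := by
  have := fun s => isProbabilityMeasure_gammaMeasure (hα s) one_pos
  exact Measure.isProbabilityMeasure_map (by fun_prop)

/-- Normalizing a vector whose entries are close to those of `T p` gives a vector close to `p`. -/
lemma abs_normalize_sub_le {p g : S → ℝ} {T e : ℝ} (hp0 : ∀ s, 0 ≤ p s) (hp1 : ∑ s, p s = 1)
    (hT : 0 < T) (he : 0 ≤ e) (he1 : 2 * (1 + Fintype.card S) * e ≤ 1)
    (hg : ∀ s, |g s - p s * T| ≤ e * T) (s : S) :
    |g s / ∑ s', g s' - p s| ≤ 2 * (1 + Fintype.card S) * e := by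
  set c : ℝ := (Fintype.card S : ℝ) with hc
  have hsum : |∑ s', g s' - T| ≤ c * (e * T) := by
    have h1 : ∑ s', g s' - T = ∑ s', (g s' - p s' * T) := by
      rw [Finset.sum_sub_distrib, ← Finset.sum_mul, hp1, one_mul]
    rw [h1]
    refine (Finset.abs_sum_le_sum_abs _ _).trans ((Finset.sum_le_sum fun s _ => hg s).trans ?_)
    simp [hc]
  have hc0 : 0 ≤ c := by positivity
  have hhalf : T / 2 ≤ ∑ s', g s' := by
    have h1 := (abs_le.1 hsum).1
    have h2 : c * (e * T) ≤ T / 2 := by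
      have : c * e ≤ 1 / 2 := by nlinarith
      nlinarith
    linarith
  have hpos : 0 < ∑ s', g s' := by linarith
  have hps : p s ≤ 1 := by
    rw [← hp1]; exact Finset.single_le_sum (fun s _ => hp0 s) (Finset.mem_univ s)
  have h3 : g s / ∑ s', g s' - p s =
      ((g s - p s * T) - p s * (∑ s', g s' - T)) / ∑ s', g s' := by
    field_simp; ring
  rw [h3, abs_div, abs_of_pos hpos, div_le_iff₀ hpos]
  calc |(g s - p s * T) - p s * (∑ s', g s' - T)|
      ≤ |g s - p s * T| + |p s * (∑ s', g s' - T)| := abs_sub _ _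
    _ ≤ e * T + 1 * (c * (e * T)) := by
        refine add_le_add (hg s) ?_
        rw [abs_mul, abs_of_nonneg (hp0 s)]
        exact mul_le_mul hps hsum (abs_nonneg _) zero_le_one
    _ = 2 * (1 + c) * e * (T / 2) := by ring
    _ ≤ _ := mul_le_mul_of_nonneg_left hhalf (by positivity)

/-- The corresponding bound for Dirichlet vectors: it suffices that each Gamma variable is close to
its target. -/
lemma exists_le_dirichlet (S : Type*) [Fintype S] [DecidableEq S] {K a₀ : ℝ} (hK : 0 ≤ K)
    (ha₀ : 0 < a₀) :
    ∃ K' : ℝ, 0 ≤ K' ∧ ∀ (z u : ℝ) (p α : S → ℝ), 1 ≤ z → 1 ≤ u → (∀ s, 0 ≤ p s) →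
      ∑ s, p s = 1 → (∀ s, a₀ ≤ α s) → (∀ s, |α s - p s * u ^ 5| ≤ K * u ^ 3) →
      ENNReal.ofReal (Real.exp (-(K' * z ^ 3))) ≤
        dirichlet α {q | ∀ s, |q s - p s| ≤ 1 / z ^ 2} := by
  obtain ⟨K₁, hK₁, hmass⟩ := exists_le_gammaMeasure hK ha₀
  set c : ℝ := 2 * (1 + (Fintype.card S : ℝ)) with hc
  have hc1 : 1 ≤ c := by
    have : (0 : ℝ) ≤ Fintype.card S := by positivity
    linarith
  refine ⟨Fintype.card S * (K₁ * c ^ 3), by positivity, ?_⟩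
  intro z u p α hz hu hp0 hp1 hα hclose
  have hα' : ∀ s, 0 < α s := fun s => ha₀.trans_le (hα s)
  have hprob := fun s => isProbabilityMeasure_gammaMeasure (hα' s) one_pos
  have hcz : 1 ≤ c * z := one_le_mul_of_one_le_of_one_le hc1 hz
  have hps : ∀ s, p s ≤ 1 := fun s => by
    rw [← hp1]; exact Finset.single_le_sum (fun s _ => hp0 s) (Finset.mem_univ s)
  have hbox : Set.univ.pi (fun s => {g : ℝ | |g - p s * u ^ 5| ≤ u ^ 5 / (c * z) ^ 2}) ⊆
      (fun (g : S → ℝ) s => g s / ∑ s', g s') ⁻¹' {q | ∀ s, |q s - p s| ≤ 1 / z ^ 2} := by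
    intro g hg s
    have he : c * (1 / (c * z) ^ 2) ≤ 1 / z ^ 2 := by
      rw [mul_pow, mul_one_div, div_le_div_iff₀ (by positivity) (by positivity)]
      have : c ≤ c ^ 2 := le_self_pow₀ hc1 (by norm_num)
      nlinarith [sq_nonneg z]
    have hz2 : 1 / z ^ 2 ≤ 1 := by
      rw [div_le_one (by positivity)]; exact one_le_pow₀ hz
    refine (abs_normalize_sub_le (T := u ^ 5) (e := 1 / (c * z) ^ 2) hp0 hp1 (by positivity)
      (by positivity) (he.trans hz2) (fun s => ?_) s).trans he
    have := hg s (Set.mem_univ s)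
    rw [Set.mem_ofPred_eq] at this
    rwa [one_div_mul_eq_div]
  have hmeas : Measurable (fun (g : S → ℝ) s => g s / ∑ s', g s') := by fun_prop
  refine le_trans ?_ (Measure.le_map_apply hmeas.aemeasurable _)
  refine le_trans ?_ (measure_mono hbox)
  rw [Measure.pi_pi]
  calc ENNReal.ofReal (Real.exp (-(Fintype.card S * (K₁ * c ^ 3) * z ^ 3)))
      = ∏ _s : S, ENNReal.ofReal (Real.exp (-(K₁ * (c * z) ^ 3))) := by
        rw [Finset.prod_const, ← ENNReal.ofReal_pow (Real.exp_pos _).le, ← Real.exp_nat_mul,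
          Finset.card_univ]
        congr 2
        ring
    _ ≤ _ := Finset.prod_le_prod' fun s _ =>
        hmass (c * z) u (p s) (α s) hcz hu (hp0 s) (hps s) (hα s) (hclose s)

/-- The number of transitions from `s` to `s'` under action `a` in a history. -/
def transTotal {n : ℕ} (H : Fin n → Obs S A h) (s : S) (a : A) (s' : S) : ℝ :=
  ∑ i, ∑ j : Fin 2, (transCount ((H i).1 j) s a s' : ℝ)

/-- The number of visits of a state-action pair in a history. -/
def visits {n : ℕ} (H : Fin n → Obs S A h) (s : S) (a : A) : ℝ := ∑ s', transTotal H s a s'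

lemma transTotal_nonneg {n : ℕ} (H : Fin n → Obs S A h) (s : S) (a : A) (s' : S) :
    0 ≤ transTotal H s a s' := by unfold transTotal; positivity

lemma visits_nonneg {n : ℕ} (H : Fin n → Obs S A h) (s : S) (a : A) : 0 ≤ visits H s a :=
  Finset.sum_nonneg fun _ _ => transTotal_nonneg H _ _ _

/-- The transition counts of a history deviate from what the transition probabilities predict by
at most a multiple of the power `3/5` of the number of visits (plus one). The exponent has to
exceed `1/2` for this to hold almost surely along a whole path, and has to be smaller than `2/3`
for the bound on exploration: it makes the exponent `3` in `exists_le_gammaMeasure` smaller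
than `4`. -/
def CountsClose (mdp : MDP S A) (K : ℝ) {n : ℕ} (H : Fin n → Obs S A h) : Prop :=
  ∀ s a s', |transTotal H s a s' - mdp.trans s a s' * visits H s a| ≤
    K * (1 + visits H s a) ^ (3 / 5 : ℝ)

lemma exists_prior_bounds (P : Params S A) :
    ∃ a₀ b₀ : ℝ, 0 < a₀ ∧ 0 ≤ b₀ ∧ ∀ s a s', a₀ ≤ P.prior s a s' ∧ P.prior s a s' ≤ b₀ := by
  have hfin := Set.finite_range fun x : S × A × S => P.prior x.1 x.2.1 x.2.2
  obtain ⟨b, hb⟩ := hfin.bddAbove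
  obtain ⟨c, hc⟩ := (Set.finite_range fun x : S × A × S => (P.prior x.1 x.2.1 x.2.2)⁻¹).bddAbove
  refine ⟨(max c 1)⁻¹, max b 0, by positivity, le_max_right _ _, fun s a s' => ⟨?_, ?_⟩⟩
  · have h1 : (P.prior s a s')⁻¹ ≤ c := hc ⟨(s, a, s'), rfl⟩
    exact inv_le_of_inv_le₀ (P.prior_pos s a s') (h1.trans (le_max_left _ _))
  · exact (hb ⟨(s, a, s'), rfl⟩).trans (le_max_left _ _)

lemma dirichlet_param_pos (P : Params S A) {n : ℕ} (H : Fin n → Obs S A h) (s : S) (a : A)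
    (s' : S) :
    0 < P.prior s a s' + ∑ i, ∑ j : Fin 2, (transCount ((H i).1 j) s a s' : ℝ) :=
  add_pos_of_pos_of_nonneg (P.prior_pos s a s') (transTotal_nonneg H s a s')

instance (P : Params S A) {n : ℕ} (H : Fin n → Obs S A h) :
    IsProbabilityMeasure (dynamicsPosterior P H) := by
  have := fun s a => isProbabilityMeasure_dirichlet (dirichlet_param_pos P H s a)
  unfold dynamicsPosterior
  infer_instance

lemma trans_le_one (mdp : MDP S A) (s : S) (a : A) (s' : S) : mdp.trans s a s' ≤ 1 := by
  rw [← mdp.trans_sum s a]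
  exact Finset.single_le_sum (fun y _ => mdp.trans_nonneg s a y) (Finset.mem_univ s')

/-- The posterior probability that the sampled dynamics are `z⁻²`-close to the true ones is at
least `exp (-O(z³))`, no matter how often the state-action pairs have been visited, as long as the
transition counts do not deviate too much from their predictions. -/
lemma exists_le_dynamicsPosterior (mdp : MDP S A) (P : Params S A) (h : ℕ) {K : ℝ} (hK : 0 ≤ K) :
    ∃ K' : ℝ, 0 ≤ K' ∧ ∀ (n : ℕ) (H : Fin n → Obs S A h) (z : ℝ), 1 ≤ z → CountsClose mdp K H →
      ENNReal.ofReal (Real.exp (-(K' * z ^ 3))) ≤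
        dynamicsPosterior P H {p | ∀ s a s', |p s a s' - mdp.trans s a s'| ≤ 1 / z ^ 2} := by
  obtain ⟨a₀, b₀, ha₀, hb₀, hab⟩ := exists_prior_bounds P
  obtain ⟨K₁, hK₁, hmass⟩ := exists_le_dirichlet S (K := K + b₀ + 1) (by positivity) ha₀
  refine ⟨Fintype.card S * (Fintype.card A * K₁), by positivity, ?_⟩
  intro n H z hz hcc
  have hprob := fun s a => isProbabilityMeasure_dirichlet (dirichlet_param_pos P H s a)
  have hset : {p : S → A → S → ℝ | ∀ s a s', |p s a s' - mdp.trans s a s'| ≤ 1 / z ^ 2} =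
      Set.univ.pi fun s => Set.univ.pi fun a =>
        {q : S → ℝ | ∀ s', |q s' - mdp.trans s a s'| ≤ 1 / z ^ 2} := by
    ext p; simp [Set.mem_pi]
  have hone : ∀ s a, ENNReal.ofReal (Real.exp (-(K₁ * z ^ 3))) ≤
      dirichlet (fun s' => P.prior s a s' +
        ∑ i, ∑ j : Fin 2, (transCount ((H i).1 j) s a s' : ℝ))
        {q : S → ℝ | ∀ s', |q s' - mdp.trans s a s'| ≤ 1 / z ^ 2} := by
    intro s a
    have hv := visits_nonneg H s a
    set u : ℝ := (1 + visits H s a) ^ (1 / 5 : ℝ) with hu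
    have hu1 : 1 ≤ u := Real.one_le_rpow (by linarith) (by norm_num)
    have hu5 : u ^ 5 = 1 + visits H s a := by
      rw [hu, ← Real.rpow_natCast, ← Real.rpow_mul (by linarith)]; norm_num
    have hu3 : u ^ 3 = (1 + visits H s a) ^ (3 / 5 : ℝ) := by
      rw [hu, ← Real.rpow_natCast, ← Real.rpow_mul (by linarith)]; norm_num
    refine hmass z u _ _ hz hu1 (mdp.trans_nonneg s a) (mdp.trans_sum s a) (fun s' => ?_)
      fun s' => ?_
    · exact (hab s a s').1.trans (le_add_of_nonneg_right (transTotal_nonneg H s a s'))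
    · have h1 := hcc s a s'
      rw [← hu3] at h1
      have h2 : (1 : ℝ) ≤ u ^ 3 := one_le_pow₀ hu1
      have h3 := hab s a s'
      have h4 := P.prior_pos s a s'
      have h5 := mdp.trans_nonneg s a s'
      have h6 := trans_le_one mdp s a s'
      have h7 : b₀ * 1 ≤ b₀ * u ^ 3 := mul_le_mul_of_nonneg_left h2 hb₀
      have h8 := abs_le.1 h1
      change |P.prior s a s' + transTotal H s a s' - _| ≤ _
      rw [hu5, abs_le]
      constructor <;> nlinarith [h8.1, h8.2]
  rw [hset, dynamicsPosterior, Measure.pi_pi]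
  simp_rw [Measure.pi_pi]
  calc ENNReal.ofReal (Real.exp (-(Fintype.card S * (Fintype.card A * K₁) * z ^ 3)))
      = ∏ _s : S, ∏ _a : A, ENNReal.ofReal (Real.exp (-(K₁ * z ^ 3))) := by
        rw [Finset.prod_const, Finset.prod_const, ← ENNReal.ofReal_pow (Real.exp_pos _).le,
          ← ENNReal.ofReal_pow (by positivity), ← Real.exp_nat_mul, ← Real.exp_nat_mul,
          Finset.card_univ, Finset.card_univ]
        congr 2
        ring
    _ ≤ _ := Finset.prod_le_prod' fun s _ => Finset.prod_le_prod' fun a _ => hone s a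

end GammaDirichlet

/-! ### The law of one iteration -/

section RoundLaw

variable {S A : Type*} [Fintype S] [DecidableEq S] [Fintype A] [DecidableEq A] {h : ℕ}

/-- Summing a product of kernels over all paths: if the kernel at time `t` has constant row sums
`c t`, the total is the total initial mass times `∏ c t`. -/
lemma sum_path_prod (h : ℕ) (p₀ : S → ℝ) (Q : Fin h → S → S → ℝ) (c : Fin h → ℝ)
    (hQ : ∀ t s, ∑ s', Q t s s' = c t) :
    ∑ x : Fin (h + 1) → S, p₀ (x 0) * ∏ t : Fin h, Q t (x t.castSucc) (x t.succ) =
      (∑ s, p₀ s) * ∏ t, c t := by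
  induction h with
  | zero =>
    simp only [Finset.univ_eq_empty, Finset.prod_empty, mul_one]
    exact Fintype.sum_equiv (Equiv.funUnique (Fin 1) S) _ _ fun x => by simp
  | succ h ih =>
    rw [← (Fin.snocEquiv fun _ : Fin (h + 2) => S).sum_comp, Fintype.sum_prod_type,
      Finset.sum_comm, Fin.prod_univ_castSucc, ← mul_assoc,
      ← ih (fun t => Q t.castSucc) (fun t => c t.castSucc) fun t s => hQ _ _, Finset.sum_mul]
    refine Finset.sum_congr rfl fun x _ => ?_
    have h1 : ∀ y : S, ∏ t : Fin (h + 1), Q t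
        ((Fin.snocEquiv fun _ : Fin (h + 2) => S) (y, x) t.castSucc)
        ((Fin.snocEquiv fun _ : Fin (h + 2) => S) (y, x) t.succ) =
        (∏ t : Fin h, Q t.castSucc (x t.castSucc) (x t.succ)) *
          Q (Fin.last h) (x (Fin.last h)) y := by
      intro y
      rw [Fin.prod_univ_castSucc]
      simp [Fin.snocEquiv, ← Fin.castSucc_succ]
    have h2 : ∀ y : S, (Fin.snocEquiv fun _ : Fin (h + 2) => S) (y, x) 0 = x 0 := by
      intro y
      have : (0 : Fin (h + 2)) = Fin.castSucc 0 := rfl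
      rw [this]
      simp [Fin.snocEquiv]
    simp only [h1, h2]
    rw [← Finset.mul_sum, ← Finset.mul_sum, hQ]
    ring

lemma sum_traj_prod (p₀ : S → ℝ) (π : Policy S A h) (Q : Fin h → S → A → S → ℝ) (c : Fin h → ℝ)
    (hQ : ∀ t s, ∑ s', Q t s (π.act s t) s' = c t) :
    ∑ τ : Traj S A h, p₀ (τ.state 0) * ∏ t : Fin h,
      ((if τ.act t = π.act (τ.state t.castSucc) t then 1 else 0) *
        Q t (τ.state t.castSucc) (τ.act t) (τ.state t.succ)) = (∑ s, p₀ s) * ∏ t, c t := by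
  rw [← sum_path_prod h p₀ (fun t s s' => Q t s (π.act s t) s') c hQ,
    ← (Traj.equivProd S A h).sum_comp, Fintype.sum_prod_type]
  refine Finset.sum_congr rfl fun x _ => ?_
  have key : ∑ f : Fin h → A, ∏ t : Fin h,
      ((if f t = π.act (x t.castSucc) t then 1 else 0) * Q t (x t.castSucc) (f t) (x t.succ)) =
      ∏ t, Q t (x t.castSucc) (π.act (x t.castSucc) t) (x t.succ) := by
    rw [← Fintype.piFinset_univ, Finset.sum_prod_piFinset (Finset.univ : Finset A) fun t a =>
      (if a = π.act (x t.castSucc) t then 1 else 0) * Q t (x t.castSucc) a (x t.succ)]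
    simp
  refine Eq.trans ?_ (congrArg (p₀ (x 0) * ·) key)
  simp only [Finset.mul_sum]
  rfl

variable (mdp : MDP S A)

lemma trajProb_nonneg (π : Policy S A h) (τ : Traj S A h) :
    0 ≤ trajProb mdp.init mdp.trans π τ := by
  refine mul_nonneg (mdp.init_nonneg _) (Finset.prod_nonneg fun t _ => mul_nonneg ?_
    (mdp.trans_nonneg _ _ _))
  split_ifs <;> simp

lemma sum_trajProb (π : Policy S A h) : ∑ τ, trajProb mdp.init mdp.trans π τ = 1 := by
  have := sum_traj_prod mdp.init π (fun _ => mdp.trans) (fun _ => 1)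
    fun _ _ => mdp.trans_sum _ _
  simpa [trajProb, mdp.init_sum] using this

lemma feasible_of_trajProb_ne_zero {π : Policy S A h} {τ : Traj S A h}
    (hτ : trajProb mdp.init mdp.trans π τ ≠ 0) : Feasible mdp τ := by
  obtain ⟨h1, h2⟩ := mul_ne_zero_iff.1 hτ
  refine ⟨lt_of_le_of_ne (mdp.init_nonneg _) h1.symm, fun t => ?_⟩
  have h3 := Finset.prod_ne_zero_iff.1 h2 t (Finset.mem_univ t)
  exact lt_of_le_of_ne (mdp.trans_nonneg _ _ _) (mul_ne_zero_iff.1 h3).2.symm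

/-- The compensated transition count has mean zero in every episode. -/
lemma sum_trajProb_mul_transCount (π : Policy S A h) (s : S) (a : A) (s' : S) :
    ∑ τ, trajProb mdp.init mdp.trans π τ *
      ((transCount τ s a s' : ℝ) - mdp.trans s a s' * ∑ s'', (transCount τ s a s'' : ℝ)) = 0 := by
  set g : S → A → S → ℝ := fun x b y =>
    if x = s ∧ b = a then (if y = s' then 1 else 0) - mdp.trans s a s' else 0 with hg
  have hcount : ∀ τ : Traj S A h,
      (transCount τ s a s' : ℝ) - mdp.trans s a s' * ∑ s'', (transCount τ s a s'' : ℝ) =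
        ∑ t : Fin h, g (τ.state t.castSucc) (τ.act t) (τ.state t.succ) := by
    intro τ
    have hc : ∀ y, (transCount τ s a y : ℝ) =
        ∑ t : Fin h, if τ.state t.castSucc = s ∧ τ.act t = a ∧ τ.state t.succ = y
          then (1 : ℝ) else 0 := by
      intro y
      rw [transCount, Finset.card_filter]
      push_cast
      rfl
    simp only [hc]
    rw [Finset.sum_comm, Finset.mul_sum, ← Finset.sum_sub_distrib]
    refine Finset.sum_congr rfl fun t _ => ?_
    simp only [hg]
    by_cases h1 : τ.state t.castSucc = s <;> by_cases h2 : τ.act t = a <;> simp [h1, h2]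
  simp only [hcount]
  simp only [Finset.mul_sum]
  rw [Finset.sum_comm]
  refine Finset.sum_eq_zero fun t₀ _ => ?_
  have hzero := sum_traj_prod mdp.init π
    (fun t x b y => mdp.trans x b y * if t = t₀ then g x b y else 1)
    (fun t => if t = t₀ then 0 else 1) fun t x => by
      by_cases ht : t = t₀
      · simp only [ht, if_true, hg]
        by_cases hx : x = s ∧ π.act x t₀ = a
        · obtain ⟨rfl, hb⟩ := hx
          simp only [hb, and_self, if_true, mul_sub, Finset.sum_sub_distrib]
          rw [← Finset.sum_mul, mdp.trans_sum]
          simp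
        · simp [hx]
      · simp [ht, mdp.trans_sum]
  rw [Finset.prod_eq_zero (Finset.mem_univ t₀) (by simp), mul_zero] at hzero
  rw [← hzero]
  refine Finset.sum_congr rfl fun τ _ => ?_
  rw [trajProb, mul_assoc]
  congr 1
  simp only [Finset.prod_mul_distrib, Finset.prod_ite_eq', Finset.mem_univ, if_true]
  ring

lemma continuous_value (p₀ : S → ℝ) (π : Policy S A h) :
    Continuous fun d : Draw S A => value p₀ d.1 d.2 π := by
  unfold value trajProb
  fun_prop

lemma selectProb_nonneg (p₀ : S → ℝ) (d : Draw S A) (π : Policy S A h) :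
    0 ≤ selectProb p₀ d π := by
  unfold selectProb; split_ifs <;> positivity

lemma selectProb_le_one (p₀ : S → ℝ) (d : Draw S A) (π : Policy S A h) :
    selectProb p₀ d π ≤ 1 := by
  unfold selectProb
  split_ifs with hπ
  · exact inv_le_one_of_one_le₀ (by exact_mod_cast Finset.card_pos.2 ⟨π, hπ⟩)
  · exact zero_le_one

lemma selectProb_eq_zero {p₀ : S → ℝ} {d : Draw S A} {π π' : Policy S A h}
    (hlt : value p₀ d.1 d.2 π < value p₀ d.1 d.2 π') : selectProb p₀ d π = 0 := by
  rw [selectProb, if_neg]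
  simp only [optimalPolicies, Finset.mem_filter, Finset.mem_univ, true_and, not_forall, not_le]
  exact ⟨π', hlt⟩

lemma sum_selectProb [Nonempty (Policy S A h)] (p₀ : S → ℝ) (d : Draw S A) :
    ∑ π : Policy S A h, selectProb p₀ d π = 1 := by
  classical
  obtain ⟨π, -, hπ⟩ := Finset.exists_max_image (Finset.univ : Finset (Policy S A h))
    (fun π => value p₀ d.1 d.2 π) Finset.univ_nonempty
  have hne : 0 < (optimalPolicies h p₀ d).card :=
    Finset.card_pos.2 ⟨π, by simpa [optimalPolicies] using fun π' => hπ π' (Finset.mem_univ _)⟩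
  have : ((optimalPolicies h p₀ d).card : ℝ) ≠ 0 := by positivity
  simp only [selectProb]
  rw [Finset.sum_ite_mem, Finset.univ_inter, Finset.sum_const, nsmul_eq_mul, mul_inv_cancel₀ this]

lemma measurable_selectProb (p₀ : S → ℝ) (π : Policy S A h) :
    Measurable fun d : Draw S A => selectProb p₀ d π := by
  classical
  let _ : MeasurableSpace (Finset (Policy S A h)) := ⊤
  have hopt : Measurable fun d : Draw S A => optimalPolicies h p₀ d := by
    refine measurable_to_countable' fun F => ?_
    have hset : (fun d : Draw S A => optimalPolicies h p₀ d) ⁻¹' {F} =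
        ⋂ π : Policy S A h,
          {d | (∀ π' : Policy S A h, value p₀ d.1 d.2 π' ≤ value p₀ d.1 d.2 π) ↔ π ∈ F} := by
      ext d
      simp [optimalPolicies, Finset.ext_iff]
    rw [hset]
    refine MeasurableSet.iInter fun π => ?_
    have hm : MeasurableSet {d : Draw S A |
        ∀ π' : Policy S A h, value p₀ d.1 d.2 π' ≤ value p₀ d.1 d.2 π} := by
      have : {d : Draw S A | ∀ π' : Policy S A h, value p₀ d.1 d.2 π' ≤ value p₀ d.1 d.2 π} =
          ⋂ π' : Policy S A h, {d : Draw S A | value p₀ d.1 d.2 π' ≤ value p₀ d.1 d.2 π} := by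
        ext; simp
      rw [this]
      exact MeasurableSet.iInter fun π' =>
        measurableSet_le (continuous_value p₀ π').measurable (continuous_value p₀ π).measurable
    by_cases hF : π ∈ F
    · simpa only [hF, iff_true] using hm
    · simp only [hF, iff_false]
      exact hm.compl
  have : Measurable fun F : Finset (Policy S A h) =>
      if π ∈ F then (F.card : ℝ)⁻¹ else 0 := measurable_from_top
  exact this.comp hopt

variable (r : EuclideanSpace ℝ (S × A)) (P : Params S A)

instance {n : ℕ} (H : Fin n → Obs S A h) : IsProbabilityMeasure (drawLaw P H) := by
  unfold drawLaw; infer_instance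

lemma integrable_selectProb {n : ℕ} (H : Fin n → Obs S A h) (p₀ : S → ℝ) (π : Policy S A h) :
    Integrable (fun d => selectProb p₀ d π) (drawLaw P H) :=
  Integrable.of_bound (measurable_selectProb p₀ π).aestronglyMeasurable 1
    (ae_of_all _ fun d => by
      rw [Real.norm_of_nonneg (selectProb_nonneg _ _ _)]
      exact selectProb_le_one _ _ _)

/-- The probability that a policy is selected given the history. -/
def selectMass {n : ℕ} (H : Fin n → Obs S A h) (π : Policy S A h) : ℝ :=
  ∫ d, selectProb mdp.init d π ∂drawLaw P H

/-- The probability that a trajectory is observed given the history. -/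
def trajMass {n : ℕ} (H : Fin n → Obs S A h) (τ : Traj S A h) : ℝ :=
  ∑ π, selectMass mdp P H π * trajProb mdp.init mdp.trans π τ

/-- The probability of an observation given the history. -/
def obsMass {n : ℕ} (H : Fin n → Obs S A h) (o : Obs S A h) : ℝ :=
  (trajMass mdp P H (o.1 0) * trajMass mdp P H (o.1 1)) * prefProb r o

lemma selectMass_nonneg {n : ℕ} (H : Fin n → Obs S A h) (π : Policy S A h) :
    0 ≤ selectMass mdp P H π := integral_nonneg fun _ => selectProb_nonneg _ _ _

lemma sum_selectMass [Nonempty (Policy S A h)] {n : ℕ} (H : Fin n → Obs S A h) :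
    ∑ π, selectMass mdp P H π = 1 := by
  simp only [selectMass]
  rw [← integral_finsetSum _ fun π _ => integrable_selectProb P H _ π]
  simp [sum_selectProb]

lemma trajMass_nonneg {n : ℕ} (H : Fin n → Obs S A h) (τ : Traj S A h) :
    0 ≤ trajMass mdp P H τ :=
  Finset.sum_nonneg fun _ _ => mul_nonneg (selectMass_nonneg _ _ _ _) (trajProb_nonneg _ _ _)

lemma sum_trajMass [Nonempty (Policy S A h)] {n : ℕ} (H : Fin n → Obs S A h) :
    ∑ τ, trajMass mdp P H τ = 1 := by
  simp only [trajMass]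
  rw [Finset.sum_comm]
  simp [← Finset.mul_sum, sum_trajProb, sum_selectMass]

lemma feasible_of_trajMass_ne_zero {n : ℕ} {H : Fin n → Obs S A h} {τ : Traj S A h}
    (hτ : trajMass mdp P H τ ≠ 0) : Feasible mdp τ := by
  obtain ⟨π, -, hπ⟩ := Finset.exists_ne_zero_of_sum_ne_zero hτ
  exact feasible_of_trajProb_ne_zero mdp (mul_ne_zero_iff.1 hπ).2

variable {mdp r}

lemma abs_inner_diff_le
    (hlink : ∀ τ τ' : Traj S A h, Feasible mdp τ → Feasible mdp τ' →
      |inner ℝ r (features τ' - features τ)| ≤ 1 / 2) {o : Obs S A h}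
    (h0 : Feasible mdp (o.1 0)) (h1 : Feasible mdp (o.1 1)) : |inner ℝ r (diff o)| ≤ 1 / 2 :=
  hlink _ _ h0 h1

lemma prefProb_nonneg
    (hlink : ∀ τ τ' : Traj S A h, Feasible mdp τ → Feasible mdp τ' →
      |inner ℝ r (features τ' - features τ)| ≤ 1 / 2) {o : Obs S A h}
    (h0 : Feasible mdp (o.1 0)) (h1 : Feasible mdp (o.1 1)) : 0 ≤ prefProb r o := by
  have := abs_le.1 (abs_inner_diff_le hlink h0 h1)
  unfold prefProb
  split_ifs <;> linarith

lemma prefProb_add (τ : Fin 2 → Traj S A h) : prefProb r (τ, true) + prefProb r (τ, false) = 1 := by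
  have : diff ((τ, true) : Obs S A h) = diff ((τ, false) : Obs S A h) := rfl
  simp only [prefProb, this]
  norm_num

lemma obsMass_nonneg
    (hlink : ∀ τ τ' : Traj S A h, Feasible mdp τ → Feasible mdp τ' →
      |inner ℝ r (features τ' - features τ)| ≤ 1 / 2) {n : ℕ} (H : Fin n → Obs S A h)
    (o : Obs S A h) : 0 ≤ obsMass mdp r P H o := by
  unfold obsMass
  by_cases h0 : trajMass mdp P H (o.1 0) = 0
  · simp [h0]
  by_cases h1 : trajMass mdp P H (o.1 1) = 0
  · simp [h1]
  exact mul_nonneg (mul_nonneg (trajMass_nonneg _ _ _ _) (trajMass_nonneg _ _ _ _))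
    (prefProb_nonneg hlink (feasible_of_trajMass_ne_zero mdp P h0)
      (feasible_of_trajMass_ne_zero mdp P h1))

/-- Expectations of functions of the next observation, as iterated sums over the two trajectories
and the preference. -/
lemma sum_obsMass_mul {n : ℕ} (H : Fin n → Obs S A h) (F : Obs S A h → ℝ) :
    ∑ o, obsMass mdp r P H o * F o =
      ∑ τ : Traj S A h, ∑ τ' : Traj S A h, trajMass mdp P H τ * trajMass mdp P H τ' *
        (prefProb r (![τ, τ'], true) * F (![τ, τ'], true) +
          prefProb r (![τ, τ'], false) * F (![τ, τ'], false)) := by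
  rw [Fintype.sum_prod_type, ← (finTwoArrowEquiv (Traj S A h)).symm.sum_comp,
    Fintype.sum_prod_type]
  refine Finset.sum_congr rfl fun τ _ => Finset.sum_congr rfl fun τ' _ => ?_
  simp [obsMass, finTwoArrowEquiv]
  ring

lemma sum_obsMass_mul_traj {n : ℕ} (H : Fin n → Obs S A h)
    (F : Traj S A h → Traj S A h → ℝ) :
    ∑ o, obsMass mdp r P H o * F (o.1 0) (o.1 1) =
      ∑ τ : Traj S A h, ∑ τ' : Traj S A h, trajMass mdp P H τ * trajMass mdp P H τ' * F τ τ' := by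
  rw [sum_obsMass_mul P H fun o => F (o.1 0) (o.1 1)]
  refine Finset.sum_congr rfl fun τ _ => Finset.sum_congr rfl fun τ' _ => ?_
  simp only [Matrix.cons_val_zero, Matrix.cons_val_one]
  rw [← add_mul, prefProb_add, one_mul]

lemma sum_obsMass [Nonempty (Policy S A h)] {n : ℕ} (H : Fin n → Obs S A h) :
    ∑ o, obsMass mdp r P H o = 1 := by
  have := sum_obsMass_mul_traj (mdp := mdp) (r := r) P H fun _ _ => 1
  simp only [mul_one] at this
  rw [this]
  simp [← Finset.mul_sum, sum_trajMass]

/-- The density of a round with respect to the product of the sampling law and the counting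
measure. -/
def roundDensity (mdp : MDP S A) (r : EuclideanSpace ℝ (S × A)) (w : Round S A h) : ENNReal :=
  ENNReal.ofReal
    ((∏ j, selectProb mdp.init (w.1 j) (w.2.1 j)) *
      (∏ j, trajProb mdp.init mdp.trans (w.2.1 j) (w.2.2.1 j)) * prefProb r w.2.2)

lemma rollout_nonneg
    (hlink : ∀ τ τ' : Traj S A h, Feasible mdp τ → Feasible mdp τ' →
      |inner ℝ r (features τ' - features τ)| ≤ 1 / 2) (π : Fin 2 → Policy S A h)
    (o : Obs S A h) :
    0 ≤ (∏ j, trajProb mdp.init mdp.trans (π j) (o.1 j)) * prefProb r o := by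
  by_cases h0 : ∏ j, trajProb mdp.init mdp.trans (π j) (o.1 j) = 0
  · simp [h0]
  have hf := fun j => feasible_of_trajProb_ne_zero mdp
    (Finset.prod_ne_zero_iff.1 h0 j (Finset.mem_univ j))
  exact mul_nonneg (Finset.prod_nonneg fun j _ => trajProb_nonneg _ _ _)
    (prefProb_nonneg hlink (hf 0) (hf 1))

lemma measurable_roundDensity : Measurable (roundDensity (h := h) mdp r) := by
  have : Measurable fun x : (Fin 2 → Draw S A) × ((Fin 2 → Policy S A h) × Obs S A h) =>
      roundDensity mdp r (x.1, x.2) := by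
    refine measurable_from_prod_countable_left fun c => ?_
    change Measurable fun x : Fin 2 → Draw S A => ENNReal.ofReal
      ((∏ j, selectProb mdp.init (x j) (c.1 j)) *
        (∏ j, trajProb mdp.init mdp.trans (c.1 j) (c.2.1 j)) * prefProb r c.2)
    refine Measurable.ennreal_ofReal (Measurable.mul_const (Measurable.mul_const ?_ _) _)
    exact Finset.measurable_prod _ fun j _ =>
      (measurable_selectProb mdp.init _).comp (measurable_pi_apply j)
  exact this

lemma roundLaw_apply {n : ℕ} (H : Fin n → Obs S A h) {B : Set (Round S A h)}
    (hB : MeasurableSet B) :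
    roundLaw mdp r P H B = ∫⁻ d, ∑ c : (Fin 2 → Policy S A h) × Obs S A h,
      B.indicator (roundDensity mdp r) (d, c) ∂Measure.pi fun _ : Fin 2 => drawLaw P H := by
  have h1 : roundLaw mdp r P H = ((Measure.pi fun _ : Fin 2 => drawLaw P H).prod
    (Measure.count : Measure ((Fin 2 → Policy S A h) × Obs S A h))).withDensity
      (roundDensity mdp r) := rfl
  rw [h1, withDensity_apply _ hB, ← lintegral_indicator hB,
    lintegral_prod _ (measurable_roundDensity.indicator hB).aemeasurable]
  refine lintegral_congr fun d => ?_
  rw [lintegral_count, tsum_fintype]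

lemma sum_roundDensity [Nonempty (Policy S A h)]
    (hlink : ∀ τ τ' : Traj S A h, Feasible mdp τ → Feasible mdp τ' →
      |inner ℝ r (features τ' - features τ)| ≤ 1 / 2) (d : Fin 2 → Draw S A) :
    ∑ c : (Fin 2 → Policy S A h) × Obs S A h, roundDensity mdp r (d, c) = 1 := by
  unfold roundDensity
  have hnn : ∀ c : (Fin 2 → Policy S A h) × Obs S A h,
      0 ≤ (∏ j, selectProb mdp.init (d j) (c.1 j)) *
        ((∏ j, trajProb mdp.init mdp.trans (c.1 j) (c.2.1 j)) * prefProb r c.2) := fun c =>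
    mul_nonneg (Finset.prod_nonneg fun j _ => selectProb_nonneg _ _ _) (rollout_nonneg hlink _ _)
  simp only [mul_assoc]
  rw [← ENNReal.ofReal_sum_of_nonneg fun c _ => hnn c]
  have h1 : ∑ c : (Fin 2 → Policy S A h) × Obs S A h,
      (∏ j, selectProb mdp.init (d j) (c.1 j)) *
        ((∏ j, trajProb mdp.init mdp.trans (c.1 j) (c.2.1 j)) * prefProb r c.2) = 1 := by
    simp only [Fintype.sum_prod_type, Fintype.sum_bool]
    have hp : ∀ τ : Fin 2 → Traj S A h, ∀ x y : ℝ,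
        x * (y * prefProb r (τ, true)) + x * (y * prefProb r (τ, false)) = x * y := fun τ x y => by
      linear_combination x * y * prefProb_add (r := r) τ
    simp only [hp, ← Finset.mul_sum]
    have ht : ∀ π : Fin 2 → Policy S A h, ∑ τ : Fin 2 → Traj S A h,
        ∏ j, trajProb mdp.init mdp.trans (π j) (τ j) = 1 := fun π => by
      rw [← Fintype.piFinset_univ,
        Finset.sum_prod_piFinset Finset.univ fun j τ => trajProb mdp.init mdp.trans (π j) τ]
      simp [sum_trajProb]
    simp only [ht, mul_one]
    rw [← Fintype.piFinset_univ,
      Finset.sum_prod_piFinset Finset.univ fun j π => selectProb mdp.init (d j) π]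
    simp [sum_selectProb]
  rw [h1, ENNReal.ofReal_one]

/-- The law of each reward sample of a round is the reward posterior. -/
lemma roundLaw_rewardSample [Nonempty (Policy S A h)]
    (hlink : ∀ τ τ' : Traj S A h, Feasible mdp τ → Feasible mdp τ' →
      |inner ℝ r (features τ' - features τ)| ≤ 1 / 2) {n : ℕ} (H : Fin n → Obs S A h) (j : Fin 2)
    {B : Set (EuclideanSpace ℝ (S × A))} (hB : MeasurableSet B) :
    roundLaw mdp r P H {w | (w.1 j).2 ∈ B} = rewardPosterior P H B := by
  have hm : MeasurableSet {d : Fin 2 → Draw S A | (d j).2 ∈ B} :=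
    (measurable_snd.comp (measurable_pi_apply j)) hB
  have hm' : MeasurableSet {w : Round S A h | (w.1 j).2 ∈ B} :=
    (measurable_snd.comp ((measurable_pi_apply j).comp measurable_fst)) hB
  rw [roundLaw_apply P H hm']
  have h1 : ∀ d : Fin 2 → Draw S A, ∑ c : (Fin 2 → Policy S A h) × Obs S A h,
      {w : Round S A h | (w.1 j).2 ∈ B}.indicator (roundDensity mdp r) (d, c) =
        {d : Fin 2 → Draw S A | (d j).2 ∈ B}.indicator 1 d := by
    intro d
    by_cases hd : (d j).2 ∈ B
    · simp [Set.indicator, hd, sum_roundDensity hlink]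
    · simp [Set.indicator, hd]
  simp only [h1]
  rw [lintegral_indicator_one hm]
  have h2 : {d : Fin 2 → Draw S A | (d j).2 ∈ B} =
      Function.eval j ⁻¹' (Prod.snd ⁻¹' B) := rfl
  rw [h2, (measurePreserving_eval (fun _ : Fin 2 => drawLaw P H) j).measure_preimage
    (measurable_snd hB).nullMeasurableSet, drawLaw,
    measurePreserving_snd.measure_preimage hB.nullMeasurableSet]

/-- The law of the observation of a round. -/
lemma roundLaw_obs
    (hlink : ∀ τ τ' : Traj S A h, Feasible mdp τ → Feasible mdp τ' →
      |inner ℝ r (features τ' - features τ)| ≤ 1 / 2) {n : ℕ} (H : Fin n → Obs S A h)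
    (o : Obs S A h) :
    roundLaw mdp r P H {w | w.2.2 = o} = ENNReal.ofReal (obsMass mdp r P H o) := by
  have hm : MeasurableSet {w : Round S A h | w.2.2 = o} :=
    (measurable_snd.comp measurable_snd) (measurableSet_singleton o)
  rw [roundLaw_apply P H hm]
  set c : (Fin 2 → Policy S A h) → ℝ := fun π =>
    (∏ j, trajProb mdp.init mdp.trans (π j) (o.1 j)) * prefProb r o
  have h1 : ∀ d : Fin 2 → Draw S A, ∑ c : (Fin 2 → Policy S A h) × Obs S A h,
      {w : Round S A h | w.2.2 = o}.indicator (roundDensity mdp r) (d, c) =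
        ∑ π : Fin 2 → Policy S A h,
          ENNReal.ofReal (∏ j, selectProb mdp.init (d j) (π j)) * ENNReal.ofReal (c π) := by
    intro d
    rw [Fintype.sum_prod_type]
    refine Finset.sum_congr rfl fun π _ => ?_
    rw [Finset.sum_eq_single o]
    · rw [Set.indicator_of_mem (by rfl), roundDensity, mul_assoc, ENNReal.ofReal_mul
        (Finset.prod_nonneg fun j _ => selectProb_nonneg _ _ _)]
    · intro o' _ ho'
      exact Set.indicator_of_notMem (by simpa using ho') _
    · simp
  have hmeas : ∀ π : Fin 2 → Policy S A h, Measurable fun d : Fin 2 → Draw S A =>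
      ∏ j, selectProb mdp.init (d j) (π j) := fun π =>
    Finset.measurable_prod _ fun j _ =>
      (measurable_selectProb mdp.init _).comp (measurable_pi_apply j)
  have hint : ∀ π : Fin 2 → Policy S A h,
      ∫⁻ d, ENNReal.ofReal (∏ j, selectProb mdp.init (d j) (π j))
        ∂Measure.pi (fun _ : Fin 2 => drawLaw P H) =
      ENNReal.ofReal (∏ j, selectMass mdp P H (π j)) := by
    intro π
    rw [← ofReal_integral_eq_lintegral_ofReal]
    · congr 1
      exact integral_fintype_prod_eq_prod (μ := fun _ : Fin 2 => drawLaw P H)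
        fun j d => selectProb mdp.init d (π j)
    · refine Integrable.of_bound (hmeas π).aestronglyMeasurable 1 (ae_of_all _ fun d => ?_)
      rw [Real.norm_of_nonneg (Finset.prod_nonneg fun j _ => selectProb_nonneg _ _ _)]
      exact Finset.prod_le_one (fun j _ => selectProb_nonneg _ _ _)
        fun j _ => selectProb_le_one _ _ _
    · exact ae_of_all _ fun d => Finset.prod_nonneg fun j _ => selectProb_nonneg _ _ _
  simp only [h1]
  rw [lintegral_finsetSum _ fun π _ => (hmeas π).ennreal_ofReal.mul_const _]
  simp only [lintegral_mul_const _ (hmeas _).ennreal_ofReal, hint]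
  have hs : ∀ π : Fin 2 → Policy S A h, 0 ≤ ∏ j, selectMass mdp P H (π j) := fun π =>
    Finset.prod_nonneg fun j _ => selectMass_nonneg _ _ _ _
  simp only [← ENNReal.ofReal_mul (hs _)]
  rw [← ENNReal.ofReal_sum_of_nonneg fun π _ => mul_nonneg (hs π) (rollout_nonneg hlink π o)]
  congr 1
  rw [obsMass, trajMass, trajMass, Finset.sum_mul_sum, Finset.sum_mul,
    ← (finTwoArrowEquiv (Policy S A h)).symm.sum_comp, Fintype.sum_prod_type]
  refine Finset.sum_congr rfl fun π _ => ?_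
  rw [Finset.sum_mul]
  refine Finset.sum_congr rfl fun π' _ => ?_
  simp [finTwoArrowEquiv, Fin.prod_univ_two]
  ring

end RoundLaw

/-! ### Gaussian posteriors and the expected information gain -/

section Marginals

variable {S A : Type*} [Fintype S] [DecidableEq S] [Fintype A] [DecidableEq A] {h : ℕ}
variable (P : Params S A)

lemma posSemidef_posteriorCov {n : ℕ} (H : Fin n → Obs S A h) :
    (beta P H ^ 2 • (gram P H)⁻¹).PosSemidef :=
  (gram_posDef P H).inv.posSemidef.smul (sq_nonneg _)

lemma posteriorCov_quadratic {n : ℕ} (H : Fin n → Obs S A h) (v : EuclideanSpace ℝ (S × A)) :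
    v.ofLp ⬝ᵥ Matrix.mulVec (beta P H ^ 2 • (gram P H)⁻¹) v.ofLp = beta P H ^ 2 * unc P H v := by
  rw [Matrix.smul_mulVec, dotProduct_smul, smul_eq_mul, unc, invQuad]

instance {n : ℕ} (H : Fin n → Obs S A h) : IsGaussian (rewardPosterior P H) := by
  unfold rewardPosterior; infer_instance

lemma integral_inner_rewardPosterior {n : ℕ} (H : Fin n → Obs S A h)
    (v : EuclideanSpace ℝ (S × A)) :
    ∫ x, inner ℝ v x ∂rewardPosterior P H = inner ℝ v (ridge P H) := by
  have h1 := (innerSL ℝ v).integral_comp_id_comm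
    (IsGaussian.integrable_id (μ := rewardPosterior P H))
  have h2 : ∫ x, x ∂rewardPosterior P H = ridge P H := integral_id_multivariateGaussian
  simpa [h2] using h1

lemma variance_inner_rewardPosterior {n : ℕ} (H : Fin n → Obs S A h)
    (v : EuclideanSpace ℝ (S × A)) :
    Var[fun x => inner ℝ v x; rewardPosterior P H] = beta P H ^ 2 * unc P H v := by
  rw [← covarianceBilin_self IsGaussian.memLp_two_id, rewardPosterior,
    covarianceBilin_multivariateGaussian (posSemidef_posteriorCov P H), posteriorCov_quadratic]

/-- Chebyshev's inequality for the reward posterior, in one direction. -/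
lemma rewardPosterior_abs_ge_le {n : ℕ} (H : Fin n → Obs S A h) (v : EuclideanSpace ℝ (S × A))
    {t : ℝ} (ht : 0 < t) :
    (rewardPosterior P H).real {x | t ≤ |inner ℝ v (x - ridge P H)|} ≤
      beta P H ^ 2 * unc P H v / t ^ 2 := by
  have hL : MemLp (fun x : EuclideanSpace ℝ (S × A) => inner ℝ v x) 2 (rewardPosterior P H) :=
    (innerSL ℝ v).comp_memLp' IsGaussian.memLp_two_id
  have h1 := meas_ge_le_variance_div_sq hL ht
  rw [variance_inner_rewardPosterior, integral_inner_rewardPosterior] at h1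
  simp only [inner_sub_right]
  exact ENNReal.toReal_le_of_le_ofReal
    (div_nonneg (mul_nonneg (sq_nonneg _) (unc_nonneg P H v)) (sq_nonneg _)) h1

lemma map_inner_rewardPosterior {n : ℕ} (H : Fin n → Obs S A h) (v : EuclideanSpace ℝ (S × A)) :
    (rewardPosterior P H).map (fun x => inner ℝ v x) =
      gaussianReal (inner ℝ v (ridge P H)) (beta P H ^ 2 * unc P H v).toNNReal := by
  have h1 := IsGaussian.map_eq_gaussianReal (μ := rewardPosterior P H) (innerSL ℝ v)
  have h2 := integral_inner_rewardPosterior P H v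
  have h3 := variance_inner_rewardPosterior P H v
  have h4 : (⇑(innerSL ℝ v) : EuclideanSpace ℝ (S × A) → ℝ) = fun x => inner ℝ v x := rfl
  rw [h4, h3] at h1
  rw [h1, ← h2]

/-- The probability that a standard Gaussian variable is at least `T`. -/
def gaussianTail (T : ℝ) : ℝ := (gaussianReal 0 1).real (Set.Ici T)

lemma gaussianTail_pos (T : ℝ) : 0 < gaussianTail T := by
  have h1 : gaussianReal 0 1 (Set.Ici T) ≠ 0 := fun h0 => by
    have := gaussianReal_absolutelyContinuous' 0 one_ne_zero h0
    simp at this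
  exact ENNReal.toReal_pos h1 (measure_ne_top _ _)

/-- The probability of an upward deviation by `T` standard deviations. -/
lemma rewardPosterior_ge {n : ℕ} (H : Fin n → Obs S A h) (v : EuclideanSpace ℝ (S × A)) {σ : ℝ}
    (hσ : 0 < σ) (hσ2 : σ ^ 2 = beta P H ^ 2 * unc P H v) (T : ℝ) :
    (rewardPosterior P H).real {x | T * σ ≤ inner ℝ v (x - ridge P H)} = gaussianTail T := by
  set m := inner ℝ v (ridge P H) with hm
  have h1 := map_inner_rewardPosterior P H v
  rw [← hσ2] at h1
  have h2 : gaussianReal m (σ ^ 2).toNNReal = (gaussianReal 0 1).map (fun x => σ * x + m) := by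
    have h3 := gaussianReal_map_const_mul (μ := 0) (v := 1) σ
    have h4 := gaussianReal_map_add_const (μ := σ * 0) (v := NNReal.mk (σ ^ 2) (sq_nonneg _) * 1) m
    rw [← h3, Measure.map_map (by fun_prop) (by fun_prop)] at h4
    rw [mul_zero, zero_add, mul_one] at h4
    have h5 : (σ ^ 2).toNNReal = NNReal.mk (σ ^ 2) (sq_nonneg _) :=
      Real.toNNReal_of_nonneg (sq_nonneg _)
    rw [h5, ← h4]
    rfl
  have hset : {x | T * σ ≤ inner ℝ v (x - ridge P H)} =
      (fun x => inner ℝ v x) ⁻¹' Set.Ici (T * σ + m) := by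
    ext x
    simp only [inner_sub_right, Set.mem_preimage, Set.mem_Ici, Set.mem_ofPred_eq, ← hm]
    constructor <;> intro hx <;> linarith
  rw [measureReal_def, hset, ← Measure.map_apply (by fun_prop) measurableSet_Ici, h1, h2,
    Measure.map_apply (by fun_prop) measurableSet_Ici, gaussianTail, measureReal_def]
  congr 2
  ext x
  simp only [Set.mem_preimage, Set.mem_Ici]
  rw [add_le_add_iff_right, mul_comm T σ, mul_le_mul_iff_right₀ hσ]

end Marginals

section MeanFeatures

variable {S A : Type*} [Fintype S] [DecidableEq S] [Fintype A] [DecidableEq A] {h : ℕ}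

/-- The expected features of a policy in the true process. -/
def meanFeatures (mdp : MDP S A) (π : Policy S A h) : EuclideanSpace ℝ (S × A) :=
  ∑ τ, trajProb mdp.init mdp.trans π τ • features τ

lemma value_eq_inner (mdp : MDP S A) (x : EuclideanSpace ℝ (S × A)) (π : Policy S A h) :
    value mdp.init mdp.trans x π = inner ℝ x (meanFeatures mdp π) := by
  simp [value, meanFeatures, inner_sum, inner_smul_right]

lemma unc_convexOn (P : Params S A) {n : ℕ} (H : Fin n → Obs S A h) :
    ConvexOn ℝ Set.univ (unc P H) := by
  refine ⟨convex_univ, fun v _ w _ a b ha hb hab => ?_⟩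
  have hM := gram_posDef P H
  have h1 := invQuad_add_smul hM v.ofLp w.ofLp (-1)
  have h2 := invQuad_nonneg hM (v.ofLp + (-1 : ℝ) • w.ofLp)
  have h3 := invQuad_add_smul hM (a • v.ofLp) w.ofLp b
  rw [invQuad_smul, smul_dotProduct] at h3
  have h4 : unc P H (a • v + b • w) = invQuad (gram P H) (a • v.ofLp + b • w.ofLp) := rfl
  rw [h4, h3]
  simp only [unc, smul_eq_mul]
  obtain rfl : b = 1 - a := by linarith
  rw [h1] at h2
  nlinarith [mul_nonneg (mul_nonneg ha hb) h2]

/-- The expected information gain of the next observation. -/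
def infoGain (mdp : MDP S A) (r : EuclideanSpace ℝ (S × A)) (P : Params S A) {n : ℕ}
    (H : Fin n → Obs S A h) : ℝ :=
  ∑ o, obsMass mdp r P H o * Real.log (1 + unc P H (diff o))

variable {mdp : MDP S A} {r : EuclideanSpace ℝ (S × A)} (P : Params S A)

/-- The expected squared length of the feature difference of two policies dominates the squared
length of the expected difference. -/
lemma unc_meanFeatures_sub_le {n : ℕ} (H : Fin n → Obs S A h) (π π' : Policy S A h) :
    unc P H (meanFeatures mdp π' - meanFeatures mdp π) ≤
      ∑ τ, ∑ τ', trajProb mdp.init mdp.trans π τ * trajProb mdp.init mdp.trans π' τ' *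
        unc P H (features τ' - features τ) := by
  have h1 := (unc_convexOn P H).map_sum_le
    (t := (Finset.univ : Finset (Traj S A h × Traj S A h)))
    (w := fun x => trajProb mdp.init mdp.trans π x.1 * trajProb mdp.init mdp.trans π' x.2)
    (p := fun x => features x.2 - features x.1)
    (fun x _ => mul_nonneg (trajProb_nonneg _ _ _) (trajProb_nonneg _ _ _))
    (by simp only [Fintype.sum_prod_type, ← Finset.mul_sum, sum_trajProb, mul_one])
    fun x _ => Set.mem_univ _
  have h2 : ∑ x : Traj S A h × Traj S A h,
      (trajProb mdp.init mdp.trans π x.1 * trajProb mdp.init mdp.trans π' x.2) •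
        (features x.2 - features x.1) = meanFeatures mdp π' - meanFeatures mdp π := by
    simp only [smul_sub, Finset.sum_sub_distrib, Fintype.sum_prod_type]
    congr 1
    · simp only [mul_smul, ← Finset.smul_sum]
      rw [← Finset.sum_smul, sum_trajProb, one_smul, meanFeatures]
    · simp only [mul_comm (trajProb mdp.init mdp.trans π _), mul_smul]
      rw [Finset.sum_comm]
      simp only [← Finset.smul_sum]
      rw [← Finset.sum_smul, sum_trajProb, one_smul, meanFeatures]
  rw [h2, Fintype.sum_prod_type] at h1
  exact h1

/-- The information gain is at least a multiple of the expected squared length of the difference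
of the mean features of two independently selected policies. -/
lemma le_infoGain {B : ℝ} (hB1 : 1 ≤ B) (hB : ∀ o : Obs S A h, ‖diff o‖ ^ 2 ≤ B)
    (hlink : ∀ τ τ' : Traj S A h, Feasible mdp τ → Feasible mdp τ' →
      |inner ℝ r (features τ' - features τ)| ≤ 1 / 2) {n : ℕ} (H : Fin n → Obs S A h) :
    (1 + B)⁻¹ * ∑ π, ∑ π', selectMass mdp P H π * selectMass mdp P H π' *
        unc P H (meanFeatures mdp π' - meanFeatures mdp π) ≤ infoGain mdp r P H := by
  have hlog : ∀ o : Obs S A h, (1 + B)⁻¹ * unc P H (diff o) ≤ Real.log (1 + unc P H (diff o)) := by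
    intro o
    have h0 := unc_nonneg P H (diff o)
    have h1 := (unc_le_norm_sq P H (diff o)).trans (hB o)
    have h2 := Real.one_sub_inv_le_log_of_pos (x := 1 + unc P H (diff o)) (by linarith)
    refine le_trans ?_ h2
    have h3 : 1 - (1 + unc P H (diff o))⁻¹ = (1 + unc P H (diff o))⁻¹ * unc P H (diff o) := by
      field_simp; ring
    rw [h3]
    exact mul_le_mul_of_nonneg_right (inv_anti₀ (by linarith) (by linarith)) h0
  have h1 : (1 + B)⁻¹ * ∑ o, obsMass mdp r P H o * unc P H (diff o) ≤ infoGain mdp r P H := by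
    rw [Finset.mul_sum]
    refine Finset.sum_le_sum fun o _ => ?_
    have := mul_le_mul_of_nonneg_left (hlog o) (obsMass_nonneg P hlink H o)
    linarith
  refine le_trans (mul_le_mul_of_nonneg_left ?_ (by positivity)) h1
  have h2 := sum_obsMass_mul_traj (mdp := mdp) (r := r) P H
    fun τ τ' => unc P H (features τ' - features τ)
  have h3 : ∀ o : Obs S A h, diff o = features (o.1 1) - features (o.1 0) := fun _ => rfl
  simp only [h3]
  rw [h2]
  calc ∑ π, ∑ π', selectMass mdp P H π * selectMass mdp P H π' *
        unc P H (meanFeatures mdp π' - meanFeatures mdp π)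
      ≤ ∑ π : Policy S A h, ∑ π' : Policy S A h, ∑ τ : Traj S A h, ∑ τ' : Traj S A h,
          selectMass mdp P H π * selectMass mdp P H π' *
            (trajProb mdp.init mdp.trans π τ * trajProb mdp.init mdp.trans π' τ' *
              unc P H (features τ' - features τ)) := by
        refine Finset.sum_le_sum fun π _ => Finset.sum_le_sum fun π' _ => ?_
        simp only [← Finset.mul_sum]
        exact mul_le_mul_of_nonneg_left (unc_meanFeatures_sub_le P H π π')
          (mul_nonneg (selectMass_nonneg _ _ _ _) (selectMass_nonneg _ _ _ _))
    _ = ∑ τ : Traj S A h, ∑ τ' : Traj S A h, ∑ π : Policy S A h, ∑ π' : Policy S A h,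
          selectMass mdp P H π * selectMass mdp P H π' *
            (trajProb mdp.init mdp.trans π τ * trajProb mdp.init mdp.trans π' τ' *
              unc P H (features τ' - features τ)) := by
        refine (Finset.sum_congr rfl fun π _ => Finset.sum_comm.trans
          (Finset.sum_congr rfl fun τ _ => Finset.sum_comm)).trans ?_
        exact Finset.sum_comm.trans (Finset.sum_congr rfl fun τ _ => Finset.sum_comm)
    _ = _ := by
        refine Finset.sum_congr rfl fun τ _ => Finset.sum_congr rfl fun τ' _ => ?_
        rw [trajMass, trajMass, Finset.sum_mul_sum, Finset.sum_mul]
        refine Finset.sum_congr rfl fun π _ => ?_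
        rw [Finset.sum_mul]
        exact Finset.sum_congr rfl fun π' _ => by ring

lemma exists_abs_inner_meanFeatures_sub_le (mdp : MDP S A) (h : ℕ) (r : EuclideanSpace ℝ (S × A)) :
    ∃ G : ℝ, 0 ≤ G ∧ ∀ π π' : Policy S A h,
      |inner ℝ (meanFeatures mdp π - meanFeatures mdp π') r| ≤ G := by
  obtain ⟨G, hG⟩ := (Set.finite_range fun x : Policy S A h × Policy S A h =>
    |inner ℝ (meanFeatures mdp x.1 - meanFeatures mdp x.2) r|).bddAbove
  exact ⟨max G 0, le_max_right _ _, fun π π' => (hG ⟨(π, π'), rfl⟩).trans (le_max_left _ _)⟩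

/-- Near the true dynamics, the value depends on the dynamics in a Lipschitz way, with a constant
proportional to the size of the rewards. -/
lemma exists_abs_value_sub_le (mdp : MDP S A) (h : ℕ) :
    ∃ C ρ₀ : ℝ, 0 ≤ C ∧ 0 < ρ₀ ∧ ∀ (p : S → A → S → ℝ) (ρ : ℝ), 0 ≤ ρ → ρ ≤ ρ₀ →
      (∀ s a s', |p s a s' - mdp.trans s a s'| ≤ ρ) →
        ∀ (x : EuclideanSpace ℝ (S × A)) (π : Policy S A h),
          |value mdp.init p x π - value mdp.init mdp.trans x π| ≤ C * ρ * ‖x‖ := by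
  set F : (S → A → S → ℝ) → (Policy S A h × Traj S A h → ℝ) := fun p y =>
    trajProb mdp.init p y.1 y.2 with hF
  have hsmooth : ContDiff ℝ 1 F := by
    rw [contDiff_pi]
    intro y
    simp only [hF, trajProb]
    fun_prop
  obtain ⟨K, t, ht, hK⟩ := (hsmooth.contDiffAt (x := mdp.trans)).exists_lipschitzOnWith
  obtain ⟨ρ₀, hρ₀, hball⟩ := Metric.nhds_basis_closedBall.mem_iff.1 ht
  refine ⟨K * ∑ τ : Traj S A h, ‖features τ‖, ρ₀, by positivity, hρ₀, ?_⟩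
  intro p ρ hρ hρρ hp x π
  have hdist : dist p mdp.trans ≤ ρ := by
    rw [dist_pi_le_iff hρ]
    intro s
    rw [dist_pi_le_iff hρ]
    intro a
    rw [dist_pi_le_iff hρ]
    intro s'
    rw [Real.dist_eq]
    exact hp s a s'
  have hFd : dist (F p) (F mdp.trans) ≤ K * ρ :=
    (hK.dist_le_mul p (hball (hdist.trans hρρ)) mdp.trans (mem_of_mem_nhds ht)).trans
      (mul_le_mul_of_nonneg_left hdist K.coe_nonneg)
  have hτ : ∀ τ : Traj S A h,
      |trajProb mdp.init p π τ - trajProb mdp.init mdp.trans π τ| ≤ K * ρ := fun τ => by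
    have := (dist_le_pi_dist (F p) (F mdp.trans) (π, τ)).trans hFd
    rwa [Real.dist_eq] at this
  rw [value, value, ← Finset.sum_sub_distrib]
  refine (Finset.abs_sum_le_sum_abs _ _).trans ?_
  have : K * (∑ τ : Traj S A h, ‖features τ‖) * ρ * ‖x‖ =
      ∑ τ : Traj S A h, K * ρ * (‖x‖ * ‖features τ‖) := by
    rw [← Finset.mul_sum, ← Finset.mul_sum]; ring
  rw [this]
  refine Finset.sum_le_sum fun τ _ => ?_
  rw [← sub_mul, abs_mul]
  exact mul_le_mul (hτ τ) (abs_real_inner_le_norm _ _) (abs_nonneg _)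
    (mul_nonneg K.coe_nonneg hρ)

lemma norm_le_of_abs_inner_single_le {x : EuclideanSpace ℝ (S × A)} {t : ℝ}
    (hx : ∀ k, |inner ℝ (EuclideanSpace.single k (1 : ℝ)) x| ≤ t) :
    ‖x‖ ≤ Fintype.card (S × A) * t := by
  have h1 : ∀ k, |x k| ≤ t := fun k => by
    have := hx k
    rwa [EuclideanSpace.inner_single_left, map_one, one_mul] at this
  have h2 : ‖x‖ ≤ ∑ k, |x k| := by
    refine abs_le_of_sq_le_sq' ?_ (Finset.sum_nonneg fun _ _ => abs_nonneg _) |>.2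
    rw [EuclideanSpace.real_norm_sq_eq]
    calc ∑ k, x k ^ 2 = ∑ k, |x k| ^ 2 := by simp
      _ ≤ _ := Finset.sum_sq_le_sq_sum_of_nonneg fun _ _ => abs_nonneg _
  refine h2.trans ((Finset.sum_le_sum fun k _ => h1 k).trans ?_)
  simp

end MeanFeatures

/-! ### Exploration by posterior sampling -/

section Exploration

variable {S A : Type*} [Fintype S] [DecidableEq S] [Fintype A] [DecidableEq A] {h : ℕ}
variable {mdp : MDP S A} {r : EuclideanSpace ℝ (S × A)} (P : Params S A)

/-- The ridge estimate is within a multiple of the confidence radius of the true rewards, in the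
metric `M` (in dual form). -/
def RidgeClose (r : EuclideanSpace ℝ (S × A)) (P : Params S A) (K : ℝ) {n : ℕ}
    (H : Fin n → Obs S A h) : Prop :=
  ∀ v, (inner ℝ v (ridge P H - r)) ^ 2 ≤ K * (1 + logDet P H) * unc P H v

lemma norm_ridge_sub_le {K : ℝ} (hK : 0 ≤ K) {n : ℕ} {H : Fin n → Obs S A h}
    (hrc : RidgeClose r P K H) : ‖ridge P H - r‖ ≤ √K * √(1 + logDet P H) := by
  have hm : 0 ≤ 1 + logDet P H := by linarith [logDet_nonneg P H]
  have h2 := hrc (ridge P H - r)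
  rw [real_inner_self_eq_norm_sq] at h2
  have h3 := unc_le_norm_sq P H (ridge P H - r)
  rw [← Real.sqrt_mul hK]
  refine Real.le_sqrt_of_sq_le ?_
  by_contra hcon
  push Not at hcon
  have h4 : 0 < ‖ridge P H - r‖ ^ 2 := lt_of_le_of_lt (by positivity) hcon
  have h5 := mul_lt_mul_of_pos_right hcon h4
  have h6 := mul_le_mul_of_nonneg_left h3 (by positivity : 0 ≤ K * (1 + logDet P H))
  rw [sq (‖ridge P H - r‖ ^ 2)] at h2
  linarith

/-- If no policy outside `F` is optimal for models in `D × G`, then a policy in `F` is selected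
with at least the posterior probability of `D × G`. -/
lemma le_sum_selectMass [Nonempty (Policy S A h)] {n : ℕ} (H : Fin n → Obs S A h)
    (F : Finset (Policy S A h)) (D : Set (S → A → S → ℝ)) (G : Set (EuclideanSpace ℝ (S × A)))
    (hDG : ∀ p ∈ D, ∀ x ∈ G, ∀ π ∉ F, ∃ π' : Policy S A h,
      value mdp.init p x π < value mdp.init p x π') :
    (dynamicsPosterior P H).real D * (rewardPosterior P H).real G ≤
      ∑ π ∈ F, selectMass mdp P H π := by
  classical
  have hsub : D ×ˢ G ⊆ {d : Draw S A | 1 ≤ ∑ π ∈ F, selectProb mdp.init d π} := by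
    rintro ⟨p, x⟩ ⟨hp, hx⟩
    have h1 := sum_selectProb (h := h) mdp.init (p, x)
    rw [← Finset.sum_add_sum_compl F] at h1
    have h2 : ∑ π ∈ Fᶜ, selectProb mdp.init (p, x) π = 0 := Finset.sum_eq_zero fun π hπ => by
      obtain ⟨π', hlt⟩ := hDG p hp x hx π (Finset.mem_compl.1 hπ)
      exact selectProb_eq_zero hlt
    rw [Set.mem_ofPred_eq]
    linarith
  have hint := mul_meas_ge_le_integral_of_nonneg (μ := drawLaw P H)
    (f := fun d => ∑ π ∈ F, selectProb mdp.init d π)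
    (ae_of_all _ fun d => Finset.sum_nonneg fun π _ => selectProb_nonneg _ _ _)
    (integrable_finsetSum _ fun π _ => integrable_selectProb P H mdp.init π) 1
  rw [one_mul, integral_finsetSum _ fun π _ => integrable_selectProb P H mdp.init π] at hint
  refine le_trans ?_ hint
  refine le_trans (le_of_eq ?_) (measureReal_mono hsub)
  rw [drawLaw, measureReal_prod_prod]

/-- A lower bound for the posterior probability that the reward sample is large in the direction
`Δ`, while it stays close to its mean in the directions `u π` and in norm. -/
lemma le_rewardPosterior_event {n : ℕ} (H : Fin n → Obs S A h) (Δ : EuclideanSpace ℝ (S × A))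
    {σ : ℝ} (hσ : 0 < σ) (hσ2 : σ ^ 2 = beta P H ^ 2 * unc P H Δ) (T : ℝ)
    (N : Finset (Policy S A h)) (u : Policy S A h → EuclideanSpace ℝ (S × A)) {t e : ℝ}
    (ht : 0 < t) (he : ∀ π ∈ N, beta P H ^ 2 * unc P H (u π) ≤ e) (he0 : 0 ≤ e) :
    gaussianTail T - Fintype.card (Policy S A h) * e -
        Fintype.card (S × A) * (beta P H ^ 2 / t ^ 2) ≤
      (rewardPosterior P H).real {x | T * σ ≤ inner ℝ Δ (x - ridge P H) ∧
        (∀ π ∈ N, |inner ℝ (u π) (x - ridge P H)| ≤ 1) ∧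
        ‖x - ridge P H‖ ≤ Fintype.card (S × A) * t} := by
  set ν := rewardPosterior P H with hν
  set G := {x | T * σ ≤ inner ℝ Δ (x - ridge P H) ∧
        (∀ π ∈ N, |inner ℝ (u π) (x - ridge P H)| ≤ 1) ∧
        ‖x - ridge P H‖ ≤ Fintype.card (S × A) * t} with hG
  set B1 : Policy S A h → Set (EuclideanSpace ℝ (S × A)) := fun π =>
    {x | 1 ≤ |inner ℝ (u π) (x - ridge P H)|} with hB1
  set B2 : S × A → Set (EuclideanSpace ℝ (S × A)) := fun k =>
    {x | t ≤ |inner ℝ (EuclideanSpace.single k (1 : ℝ)) (x - ridge P H)|} with hB2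
  have hsub : {x | T * σ ≤ inner ℝ Δ (x - ridge P H)} ⊆
      G ∪ ((⋃ π ∈ N, B1 π) ∪ ⋃ k ∈ (Finset.univ : Finset (S × A)), B2 k) := by
    intro x hx
    by_contra hcon
    simp only [Set.mem_union, Set.mem_iUnion, not_or, not_exists, Finset.mem_univ,
      exists_const, hB1, hB2, Set.mem_ofPred_eq, not_le] at hcon
    refine hcon.1 ⟨hx, fun π hπ => (hcon.2.1 π hπ).le, ?_⟩
    exact norm_le_of_abs_inner_single_le fun k => (hcon.2.2 k).le
  have h1 : ν.real (⋃ π ∈ N, B1 π) ≤ Fintype.card (Policy S A h) * e := by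
    refine (measureReal_biUnion_finset_le _ _).trans ?_
    calc ∑ π ∈ N, ν.real (B1 π) ≤ ∑ _π ∈ N, e := Finset.sum_le_sum fun π hπ => by
          have := rewardPosterior_abs_ge_le P H (u π) one_pos
          rw [one_pow, div_one] at this
          exact this.trans (he π hπ)
      _ = N.card * e := by simp
      _ ≤ _ := mul_le_mul_of_nonneg_right (by exact_mod_cast Finset.card_le_univ N) he0
  have h2 : ν.real (⋃ k ∈ (Finset.univ : Finset (S × A)), B2 k) ≤
      Fintype.card (S × A) * (beta P H ^ 2 / t ^ 2) := by
    refine (measureReal_biUnion_finset_le _ _).trans ?_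
    calc ∑ k, ν.real (B2 k) ≤ ∑ _k : S × A, beta P H ^ 2 / t ^ 2 :=
          Finset.sum_le_sum fun k _ => by
            refine (rewardPosterior_abs_ge_le P H _ ht).trans ?_
            have := unc_le_norm_sq P H (EuclideanSpace.single k (1 : ℝ))
            rw [PiLp.norm_single, norm_one, one_pow] at this
            exact div_le_div_of_nonneg_right
              (mul_le_of_le_one_right (sq_nonneg _) this) (sq_nonneg _)
      _ = _ := by simp
  have h3 : gaussianTail T ≤ ν.real G + (ν.real (⋃ π ∈ N, B1 π) +
      ν.real (⋃ k ∈ (Finset.univ : Finset (S × A)), B2 k)) := by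
    rw [← rewardPosterior_ge P H Δ hσ hσ2 T]
    refine (measureReal_mono hsub).trans ((measureReal_union_le _ _).trans ?_)
    exact add_le_add_right (measureReal_union_le _ _) _
  linarith

set_option maxHeartbeats 1000000 in
/-- Uncertainty in the direction of the feature difference of two policies forces exploration: it
makes the expected information gain at least `exp (-o(log det M))`.

Some policy `π*` is selected with probability at least `1 / #policies`. One of the two given
policies, `π₀`, has expected features far from those of `π*` in the metric `M⁻¹`. A Gaussian
fluctuation of bounded relative size makes `π₀` better than all policies that are close to `π*`,
provided the sampled dynamics are close enough to the true ones for the rewards of size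
`√(log det M)` that occur. -/
lemma exists_le_infoGain [Nonempty (Policy S A h)] (hR : 0 < P.R) (hS : 0 ≤ P.Sr)
    (hlink : ∀ τ τ' : Traj S A h, Feasible mdp τ → Feasible mdp τ' →
      |inner ℝ r (features τ' - features τ)| ≤ 1 / 2) {K ε : ℝ} (hK : 0 ≤ K) (hε : 0 < ε) :
    ∃ c K' : ℝ, 0 < c ∧ 0 ≤ K' ∧ ∀ (n : ℕ) (H : Fin n → Obs S A h) (πa πb : Policy S A h),
      CountsClose mdp K H → RidgeClose r P K H →
      ε ≤ (1 + logDet P H) * unc P H (meanFeatures mdp πa - meanFeatures mdp πb) →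
      c / (1 + logDet P H) * Real.exp (-(K' * (1 + logDet P H) ^ (3 / 4 : ℝ))) ≤
        infoGain mdp r P H := by
  classical
  obtain ⟨cβ, hcβ, hβlow⟩ := exists_le_beta_sq (h := h) P hR hS
  obtain ⟨Cβ, hCβ, hβup⟩ := exists_beta_sq_le (h := h) P
  obtain ⟨B, hB1, hB⟩ := exists_norm_diff_sq_le (S := S) (A := A) (h := h)
  obtain ⟨G, hG0, hG⟩ := exists_abs_inner_meanFeatures_sub_le mdp h r
  obtain ⟨CL, ρ₀, hCL, hρ₀, hLip⟩ := exists_abs_value_sub_le mdp h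
  obtain ⟨K₁, hK₁, hdyn⟩ := exists_le_dynamicsPosterior mdp P h hK
  set np : ℝ := (Fintype.card (Policy S A h) : ℝ) with hnp
  have hnp0 : 0 < np := by
    rw [hnp]; exact_mod_cast Fintype.card_pos
  set d : ℝ := (Fintype.card (S × A) : ℝ) with hd
  have hd0 : 0 ≤ d := by positivity
  -- `σ₀` bounds the standard deviation of the fluctuation from below.
  set σ₀ : ℝ := √(cβ * (ε / 4)) with hσ₀
  have hσ₀0 : 0 < σ₀ := Real.sqrt_pos.2 (by positivity)
  set T : ℝ := √(K / cβ) + (2 * G + 4 + √K) / σ₀ with hT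
  set q : ℝ := gaussianTail T with hq
  have hq0 : 0 < q := gaussianTail_pos T
  -- `e` is the squared radius, in the metric `(1 + log det M) M⁻¹`, of the set of policies that
  -- count as close to `π*`; `τ` controls the size of the reward sample.
  set e : ℝ := min 1 (q / (4 * np * Cβ)) with he
  have he0 : 0 < e := lt_min one_pos (by positivity)
  have he1 : e ≤ 1 := min_le_left _ _
  have heq : np * (Cβ * e) ≤ q / 4 := by
    calc np * (Cβ * e) ≤ np * (Cβ * (q / (4 * np * Cβ))) := by
          gcongr; exact min_le_right _ _
      _ = q / 4 := by field_simp
  set τ : ℝ := 4 * (d + 1) * Cβ / q with hτ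
  have hτ0 : 0 < τ := by positivity
  have hτq : d * (Cβ / τ) ≤ q / 4 := by
    have : d * (Cβ / τ) = d / (d + 1) * (q / 4) := by rw [hτ]; field_simp
    rw [this]
    refine mul_le_of_le_one_left (by positivity) ?_
    rw [div_le_one (by positivity)]
    linarith
  set X : ℝ := ‖r‖ + √K + d * √τ with hX
  have hX0 : 0 ≤ X := by positivity
  set Z : ℝ := CL * X + 1 / ρ₀ + 1 with hZ
  have hZ1 : 1 ≤ Z := by
    have : 0 ≤ CL * X + 1 / ρ₀ := by positivity
    linarith
  refine ⟨(1 + B)⁻¹ * np⁻¹ * e * (q / 2), K₁ * Z ^ (3 / 2 : ℝ), by positivity, by positivity, ?_⟩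
  intro n H πa πb hcc hrc hbad
  set m : ℝ := 1 + logDet P H with hm
  have hm1 : 1 ≤ m := by have := logDet_nonneg P H; linarith
  have hm0 : 0 < m := by linarith
  have hb1 := hβlow n H
  have hb2 := hβup n H
  rw [← hm] at hb1 hb2
  set φ := meanFeatures (h := h) mdp with hφ
  -- the most likely policy
  obtain ⟨πs, -, hπs⟩ := Finset.exists_max_image (Finset.univ : Finset (Policy S A h))
    (selectMass mdp P H) Finset.univ_nonempty
  have hsel : np⁻¹ ≤ selectMass mdp P H πs := by
    have h1 : (1 : ℝ) ≤ np * selectMass mdp P H πs := by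
      rw [← sum_selectMass mdp P H]
      refine (Finset.sum_le_sum fun π _ => hπs π (Finset.mem_univ _)).trans ?_
      simp [hnp]
    rw [inv_le_iff_one_le_mul₀ hnp0]
    linarith
  -- a policy far from it
  obtain ⟨π₀, hπ₀⟩ : ∃ π₀ : Policy S A h, ε / 4 ≤ m * unc P H (φ π₀ - φ πs) := by
    by_contra hcon
    push Not at hcon
    have h1 := hcon πa
    have h2 := hcon πb
    have h3 := unc_add_le P H (φ πa - φ πs) (φ πs - φ πb)
    rw [sub_add_sub_cancel, unc_sub_comm P H (φ πs)] at h3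
    have h4 := mul_le_mul_of_nonneg_left h3 hm0.le
    linarith
  set Δ := φ π₀ - φ πs with hΔ
  have hβ0 : 0 < beta P H ^ 2 := lt_of_lt_of_le (by positivity) hb1
  have hUΔ : 0 < unc P H Δ := by
    by_contra hcon
    have h1 : unc P H Δ = 0 := le_antisymm (not_lt.1 hcon) (unc_nonneg P H Δ)
    rw [h1, mul_zero] at hπ₀
    linarith
  set σ : ℝ := √(beta P H ^ 2 * unc P H Δ) with hσ
  have hσ2 : σ ^ 2 = beta P H ^ 2 * unc P H Δ := Real.sq_sqrt (by positivity)
  have hσσ₀ : σ₀ ≤ σ := by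
    refine Real.sqrt_le_sqrt ?_
    calc cβ * (ε / 4) ≤ cβ * (m * unc P H Δ) := by gcongr
      _ = cβ * m * unc P H Δ := by ring
      _ ≤ _ := by gcongr
  have hσ0 : 0 < σ := hσ₀0.trans_le hσσ₀
  set N : Finset (Policy S A h) :=
    Finset.univ.filter fun π => m * unc P H (φ πs - φ π) ≤ e with hN
  set t : ℝ := √(τ * m) with ht
  have ht0 : 0 < t := Real.sqrt_pos.2 (by positivity)
  have ht2 : t ^ 2 = τ * m := Real.sq_sqrt (by positivity)
  have hev := le_rewardPosterior_event P H Δ hσ0 hσ2 T N (fun π => φ πs - φ π) (t := t)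
    (e := Cβ * e) ht0 (fun π hπ => by
      have h1 : m * unc P H (φ πs - φ π) ≤ e := (Finset.mem_filter.1 hπ).2
      calc beta P H ^ 2 * unc P H (φ πs - φ π) ≤ Cβ * m * unc P H (φ πs - φ π) :=
            mul_le_mul_of_nonneg_right hb2 (unc_nonneg P H _)
        _ = Cβ * (m * unc P H (φ πs - φ π)) := by ring
        _ ≤ _ := by gcongr) (by positivity)
  set Gs := {x | T * σ ≤ inner ℝ Δ (x - ridge P H) ∧
        (∀ π ∈ N, |inner ℝ (φ πs - φ π) (x - ridge P H)| ≤ 1) ∧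
        ‖x - ridge P H‖ ≤ Fintype.card (S × A) * t} with hGs
  have hGmass : q / 2 ≤ (rewardPosterior P H).real Gs := by
    have h1 : beta P H ^ 2 / t ^ 2 ≤ Cβ / τ := by
      rw [ht2, div_le_div_iff₀ (by positivity) hτ0]
      nlinarith
    have h2 : d * (beta P H ^ 2 / t ^ 2) ≤ q / 4 :=
      (mul_le_mul_of_nonneg_left h1 hd0).trans hτq
    linarith
  -- the precision required of the sampled dynamics
  set z : ℝ := √(Z * √m) with hz
  have hsm1 : 1 ≤ √m := Real.one_le_sqrt.2 hm1
  have hz1 : 1 ≤ z := Real.one_le_sqrt.2 (one_le_mul_of_one_le_of_one_le hZ1 hsm1)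
  have hz2 : z ^ 2 = Z * √m := Real.sq_sqrt (by positivity)
  have hz3 : z ^ 3 = Z ^ (3 / 2 : ℝ) * m ^ (3 / 4 : ℝ) := by
    have hZ0 : 0 ≤ Z := by linarith
    rw [hz, Real.sqrt_eq_rpow, Real.sqrt_eq_rpow, ← Real.rpow_natCast, ← Real.rpow_mul
      (by positivity), Real.mul_rpow hZ0 (by positivity), ← Real.rpow_mul hm0.le]
    norm_num
  set D := {p : S → A → S → ℝ | ∀ s a s', |p s a s' - mdp.trans s a s'| ≤ 1 / z ^ 2} with hD
  have hDmass : Real.exp (-(K₁ * z ^ 3)) ≤ (dynamicsPosterior P H).real D := by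
    have := hdyn n H z hz1 hcc
    exact (ENNReal.ofReal_le_iff_le_toReal (measure_ne_top _ _)).1 this
  have hρle : 1 / z ^ 2 ≤ ρ₀ := by
    rw [hz2, div_le_iff₀ (by positivity)]
    have h1 : 1 ≤ ρ₀ * Z := by
      have : 1 / ρ₀ ≤ Z := by
        have : 0 ≤ CL * X := by positivity
        linarith
      rwa [div_le_iff₀' hρ₀] at this
    calc (1 : ℝ) ≤ (ρ₀ * Z) * √m := one_le_mul_of_one_le_of_one_le h1 hsm1
      _ = _ := by ring
  have hfar : (dynamicsPosterior P H).real D * (rewardPosterior P H).real Gs ≤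
      ∑ π ∈ Nᶜ, selectMass mdp P H π := by
    refine le_sum_selectMass P H Nᶜ D Gs fun p hp x hx π hπ => ⟨π₀, ?_⟩
    have hπN : π ∈ N := by simpa using hπ
    obtain ⟨hx1, hx2, hx3⟩ := hx
    have hπe : m * unc P H (φ πs - φ π) ≤ e := (Finset.mem_filter.1 hπN).2
    -- size of the sample
    have hxnorm : ‖x‖ ≤ X * √m := by
      have h1 : ‖ridge P H - r‖ ≤ √K * √m := norm_ridge_sub_le P hK hrc
      have h2 : d * t = d * √τ * √m := by rw [ht, Real.sqrt_mul hτ0.le]; ring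
      have h3 : ‖x‖ ≤ ‖r‖ + ‖ridge P H - r‖ + ‖x - ridge P H‖ := by
        have : x = r + (ridge P H - r) + (x - ridge P H) := by abel
        calc ‖x‖ = ‖r + (ridge P H - r) + (x - ridge P H)‖ := by rw [← this]
          _ ≤ _ := norm_add₃_le
      have h4 : ‖r‖ ≤ ‖r‖ * √m := le_mul_of_one_le_right (norm_nonneg _) hsm1
      have h5 : X * √m = ‖r‖ * √m + √K * √m + d * √τ * √m := by rw [hX]; ring
      rw [h5]
      linarith
    have hval : CL * (1 / z ^ 2) * ‖x‖ ≤ 1 := by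
      rw [hz2]
      calc CL * (1 / (Z * √m)) * ‖x‖ ≤ CL * (1 / (Z * √m)) * (X * √m) := by gcongr
        _ = CL * X / Z := by field_simp
        _ ≤ 1 := by
          rw [div_le_one (by linarith)]
          have : 0 ≤ 1 / ρ₀ := by positivity
          linarith
    -- gain in the direction `Δ`
    have hgain : G + 4 + √K ≤ inner ℝ Δ x := by
      have h1 : inner ℝ Δ x = inner ℝ Δ r + inner ℝ Δ (ridge P H - r) +
          inner ℝ Δ (x - ridge P H) := by
        rw [← inner_add_right, ← inner_add_right]; congr 1; abel
      have h2 := (abs_le.1 (hG π₀ πs)).1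
      have h3 : |inner ℝ Δ (ridge P H - r)| ≤ √(K / cβ) * σ := by
        rw [hσ, ← Real.sqrt_mul (by positivity)]
        refine Real.abs_le_sqrt ((hrc Δ).trans ?_)
        rw [← hm]
        calc K * m * unc P H Δ = K / cβ * (cβ * m * unc P H Δ) := by field_simp
          _ ≤ _ := by gcongr
      have h4 := (abs_le.1 h3).1
      have h5 : T * σ = √(K / cβ) * σ + (2 * G + 4 + √K) * (σ / σ₀) := by rw [hT]; ring
      have h6 : 1 ≤ σ / σ₀ := (one_le_div hσ₀0).2 hσσ₀
      have h7 : 2 * G + 4 + √K ≤ (2 * G + 4 + √K) * (σ / σ₀) :=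
        le_mul_of_one_le_right (by positivity) h6
      rw [h1]
      linarith
    -- loss among the policies close to `π*`
    have hloss : -(G + √K + 1) ≤ inner ℝ (φ πs - φ π) x := by
      have h1 : inner ℝ (φ πs - φ π) x = inner ℝ (φ πs - φ π) r +
          inner ℝ (φ πs - φ π) (ridge P H - r) + inner ℝ (φ πs - φ π) (x - ridge P H) := by
        rw [← inner_add_right, ← inner_add_right]; congr 1; abel
      have h2 := (abs_le.1 (hG πs π)).1
      have h3 : |inner ℝ (φ πs - φ π) (ridge P H - r)| ≤ √K := by
        refine Real.abs_le_sqrt ((hrc _).trans ?_)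
        rw [← hm, mul_assoc]
        exact mul_le_of_le_one_right hK (hπe.trans he1)
      have h4 := (abs_le.1 h3).1
      have h5 := (abs_le.1 (hx2 π hπN)).1
      rw [h1]
      linarith
    have hsum : inner ℝ Δ x + inner ℝ (φ πs - φ π) x =
        value mdp.init mdp.trans x π₀ - value mdp.init mdp.trans x π := by
      rw [value_eq_inner, value_eq_inner, ← inner_add_left, hΔ, sub_add_sub_cancel,
        inner_sub_left, real_inner_comm, real_inner_comm x]
    have hl0 := (abs_le.1 (hLip p (1 / z ^ 2) (by positivity) hρle hp x π₀)).1
    have hl1 := (abs_le.1 (hLip p (1 / z ^ 2) (by positivity) hρle hp x π)).2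
    linarith
  have hfar2 : Real.exp (-(K₁ * z ^ 3)) * (q / 2) ≤ ∑ π ∈ Nᶜ, selectMass mdp P H π :=
    (mul_le_mul hDmass hGmass (by positivity) measureReal_nonneg).trans hfar
  refine le_trans ?_ (le_infoGain P hB1 hB hlink H)
  have hterm : ∀ π ∈ Nᶜ, e / m ≤ unc P H (φ π - φ πs) := by
    intro π hπ
    have h1 : e < m * unc P H (φ πs - φ π) := by
      simpa [hN] using hπ
    rw [unc_sub_comm, div_le_iff₀ hm0]
    linarith
  have hnn : ∀ π π' : Policy S A h, 0 ≤ selectMass mdp P H π * selectMass mdp P H π' *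
      unc P H (φ π' - φ π) := fun π π' =>
    mul_nonneg (mul_nonneg (selectMass_nonneg _ _ _ _) (selectMass_nonneg _ _ _ _))
      (unc_nonneg _ _ _)
  calc (1 + B)⁻¹ * np⁻¹ * e * (q / 2) / m * Real.exp (-(K₁ * Z ^ (3 / 2 : ℝ) * m ^ (3 / 4 : ℝ)))
      = (1 + B)⁻¹ * (np⁻¹ * (e / m * (Real.exp (-(K₁ * z ^ 3)) * (q / 2)))) := by
        rw [hz3]; ring_nf
    _ ≤ (1 + B)⁻¹ * (selectMass mdp P H πs * (e / m * ∑ π ∈ Nᶜ, selectMass mdp P H π)) := by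
        gcongr
        exact selectMass_nonneg _ _ _ _
    _ = (1 + B)⁻¹ * ∑ π ∈ Nᶜ, selectMass mdp P H πs * selectMass mdp P H π * (e / m) := by
        congr 1
        rw [Finset.mul_sum, Finset.mul_sum]
        exact Finset.sum_congr rfl fun π _ => by ring
    _ ≤ (1 + B)⁻¹ * ∑ π ∈ Nᶜ, selectMass mdp P H πs * selectMass mdp P H π *
          unc P H (φ π - φ πs) := by
        gcongr with π hπ
        · exact mul_nonneg (selectMass_nonneg _ _ _ _) (selectMass_nonneg _ _ _ _)
        · exact hterm π hπ
    _ ≤ (1 + B)⁻¹ * ∑ π, selectMass mdp P H πs * selectMass mdp P H π *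
          unc P H (φ π - φ πs) := by
        refine mul_le_mul_of_nonneg_left ?_ (by positivity)
        exact Finset.sum_le_sum_of_subset_of_nonneg (Finset.subset_univ _) fun π _ _ => hnn πs π
    _ ≤ _ := by
        refine mul_le_mul_of_nonneg_left ?_ (by positivity)
        exact Finset.single_le_sum (f := fun π => ∑ π', selectMass mdp P H π *
          selectMass mdp P H π' * unc P H (φ π' - φ π))
          (fun π _ => Finset.sum_nonneg fun π' _ => hnn π π') (Finset.mem_univ πs)

end Exploration

/-! ### Uncertainty along a single path -/

section Window

variable {S A : Type*} [Fintype S] [DecidableEq S] [Fintype A] [DecidableEq A] {h : ℕ}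
variable {mdp : MDP S A} {r : EuclideanSpace ℝ (S × A)} {P : Params S A}

lemma rpow_three_quarters_mul {x : ℝ} (hx : 0 < x) :
    x ^ (3 / 4 : ℝ) * x ^ (1 / 4 : ℝ) = x := by
  rw [← Real.rpow_add hx]; norm_num

/-- The logarithm of `x³ exp (O(x^{3/4}))` is eventually smaller than any multiple of `x`. -/
lemma exists_mul_log_lt {d a b c : ℝ} (hd : 0 ≤ d) (ha : 1 ≤ a) (hb : 0 ≤ b) (hc : 0 ≤ c) :
    ∃ x₀ : ℝ, ∀ x, x₀ ≤ x → 1 ≤ x →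
      d * Real.log (a + b * (x ^ 3 * Real.exp (c * x ^ (3 / 4 : ℝ)))) < x / 2 := by
  set C : ℝ := Real.log (a + b) + 4 + c with hC
  have hlog : 0 ≤ Real.log (a + b) := Real.log_nonneg (by linarith)
  refine ⟨(2 * (d * C)) ^ 4 + 1, fun x hx hx1 => ?_⟩
  have hx0 : 0 < x := by linarith
  set y := x ^ (3 / 4 : ℝ) with hy
  have hy1 : 1 ≤ y := Real.one_le_rpow hx1 (by norm_num)
  have h1 : a + b * (x ^ 3 * Real.exp (c * y)) ≤ (a + b) * (x ^ 3 * Real.exp (c * y)) := by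
    have h2 : 1 ≤ x ^ 3 * Real.exp (c * y) :=
      one_le_mul_of_one_le_of_one_le (one_le_pow₀ hx1) (Real.one_le_exp (by positivity))
    nlinarith
  have h2 : Real.log (a + b * (x ^ 3 * Real.exp (c * y))) ≤ C * y := by
    refine (Real.log_le_log (by positivity) h1).trans ?_
    rw [Real.log_mul (by positivity) (by positivity), Real.log_mul (by positivity)
      (Real.exp_pos _).ne', Real.log_exp, Real.log_pow]
    have h3 := Real.log_le_rpow_div hx0.le (ε := 3 / 4) (by norm_num)
    rw [← hy] at h3
    have h4 : Real.log (a + b) ≤ Real.log (a + b) * y := le_mul_of_one_le_right hlog hy1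
    rw [hC]
    push_cast
    linarith
  have hw : 2 * (d * C) < x ^ (1 / 4 : ℝ) := by
    have h3 : (2 * (d * C)) ^ 4 < (x ^ (1 / 4 : ℝ)) ^ 4 := by
      rw [← Real.rpow_natCast (x ^ (1 / 4 : ℝ)), ← Real.rpow_mul hx0.le]
      norm_num
      linarith
    exact lt_of_pow_lt_pow_left₀ 4 (by positivity) h3
  calc d * Real.log (a + b * (x ^ 3 * Real.exp (c * y))) ≤ d * (C * y) :=
        mul_le_mul_of_nonneg_left h2 hd
    _ = y * (2 * (d * C)) / 2 := by ring
    _ < y * x ^ (1 / 4 : ℝ) / 2 := by gcongr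
    _ = x / 2 := by rw [hy, rpow_three_quarters_mul hx0]

/-- Along a sequence of observations with bounded discounted information gain, the uncertainty
about the difference of the mean features of any two policies vanishes, even after multiplication
by the growth rate of the squared confidence radius.

Otherwise there are infinitely many bad rounds. A bad round makes all earlier rounds almost as bad
as long as `1 + log det M` has not dropped by more than a factor `2`. Since `log det M` grows only
logarithmically along any window, this gives a window of exponential length in which each round
has a subexponentially small expected gain, and their sum is unbounded. -/
lemma tendsto_unc_of_infoGain_bounded [Nonempty (Policy S A h)] (hR : 0 < P.R) (hS : 0 ≤ P.Sr)
    (hlink : ∀ τ τ' : Traj S A h, Feasible mdp τ → Feasible mdp τ' →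
      |inner ℝ r (features τ' - features τ)| ≤ 1 / 2) {K C : ℝ} (hK : 0 ≤ K) (o : ℕ → Obs S A h)
    (hcc : ∀ n, CountsClose mdp K (firstObs o n)) (hrc : ∀ n, RidgeClose r P K (firstObs o n))
    (hgain : ∀ s : Finset ℕ, ∑ k ∈ s,
      infoGain mdp r P (firstObs o k) / (1 + logDet P (firstObs o k)) ^ 2 ≤ C)
    (πa πb : Policy S A h) :
    Tendsto (fun n => (1 + logDet P (firstObs o n)) *
      unc P (firstObs o n) (meanFeatures mdp πa - meanFeatures mdp πb)) atTop (𝓝 0) := by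
  set m : ℕ → ℝ := fun n => 1 + logDet P (firstObs o n) with hm
  set U : ℕ → ℝ := fun n => unc P (firstObs o n) (meanFeatures mdp πa - meanFeatures mdp πb)
    with hU
  have hm1 : ∀ n, 1 ≤ m n := fun n => by
    have := logDet_nonneg P (firstObs o n)
    simp only [hm]; linarith
  have hm0 : ∀ n, 0 < m n := fun n => one_pos.trans_le (hm1 n)
  have hmmono : Monotone m := fun i j hij =>
    add_le_add_right (logDet_firstObs_monotone P o hij) 1
  have hU0 : ∀ n, 0 ≤ U n := fun n => unc_nonneg P _ _
  have hUanti : Antitone U := unc_firstObs_antitone P o _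
  have hC : 0 ≤ C := by simpa using hgain ∅
  by_contra hnot
  obtain ⟨ε, hε, hbad⟩ : ∃ ε > 0, ∀ N, ∃ i ≥ N, ε ≤ m i * U i := by
    rw [Metric.tendsto_atTop] at hnot
    push Not at hnot
    obtain ⟨ε, hε, hbad⟩ := hnot
    refine ⟨ε, hε, fun N => ?_⟩
    obtain ⟨i, hi, hdi⟩ := hbad N
    refine ⟨i, hi, ?_⟩
    rwa [Real.dist_eq, sub_zero, abs_of_nonneg (mul_nonneg (hm0 i).le (hU0 i))] at hdi
  -- a lower bound for the discounted gain that is decreasing in `m`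
  have hgainlow : ∀ ε' > 0, ∃ c K' : ℝ, 0 < c ∧ 0 ≤ K' ∧ ∀ (j : ℕ) (x : ℝ), m j ≤ x →
      ε' ≤ m j * U j → c / (x ^ 3 * Real.exp (K' * x ^ (3 / 4 : ℝ))) ≤
        infoGain mdp r P (firstObs o j) / m j ^ 2 := by
    intro ε' hε'
    obtain ⟨c, K', hc, hK', hexp⟩ := exists_le_infoGain (mdp := mdp) (r := r) P hR hS hlink hK hε'
    refine ⟨c, K', hc, hK', fun j x hjx hj => ?_⟩
    have h1 := hexp j (firstObs o j) πa πb (hcc j) (hrc j) hj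
    change c / m j * Real.exp (-(K' * m j ^ (3 / 4 : ℝ))) ≤ _ at h1
    have hj0 := hm0 j
    have hx0 : 0 < x := hj0.trans_le hjx
    calc c / (x ^ 3 * Real.exp (K' * x ^ (3 / 4 : ℝ)))
        ≤ c / (m j ^ 3 * Real.exp (K' * m j ^ (3 / 4 : ℝ))) := by gcongr
      _ = (c / m j * Real.exp (-(K' * m j ^ (3 / 4 : ℝ)))) / m j ^ 2 := by
          rw [Real.exp_neg]; field_simp
      _ ≤ _ := by gcongr
  by_cases hbdd : ∃ M, ∀ n, m n ≤ M
  · obtain ⟨M, hM⟩ := hbdd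
    have hM0 : 0 < M := (hm0 0).trans_le (hM 0)
    obtain ⟨c, K', hc, hK', hlow⟩ := hgainlow (ε / M) (by positivity)
    set g := c / (M ^ 3 * Real.exp (K' * M ^ (3 / 4 : ℝ))) with hg
    have hg0 : 0 < g := by positivity
    have hall : ∀ j, g ≤ infoGain mdp r P (firstObs o j) / m j ^ 2 := by
      intro j
      refine hlow j M (hM j) ?_
      obtain ⟨i, hij, hi⟩ := hbad j
      rw [div_le_iff₀ hM0]
      calc ε ≤ m i * U i := hi
        _ ≤ M * U j := mul_le_mul (hM i) (hUanti hij) (hU0 i) hM0.le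
        _ ≤ m j * U j * M := by nlinarith [hm1 j, mul_nonneg hM0.le (hU0 j)]
    obtain ⟨n, hn⟩ := exists_nat_gt (C / g)
    have h1 := hgain (Finset.range n)
    have h2 : n * g ≤ C := by
      refine le_trans ?_ h1
      have := Finset.card_nsmul_le_sum (Finset.range n) _ g fun j _ => hall j
      simpa using this
    rw [div_lt_iff₀ hg0] at hn
    linarith
  · push Not at hbdd
    obtain ⟨c, K', hc, hK', hlow⟩ := hgainlow (ε / 2) (by positivity)
    obtain ⟨B, hB1, hB⟩ := exists_norm_diff_sq_le (S := S) (A := A) (h := h)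
    set d : ℝ := (Fintype.card (S × A) : ℝ) with hd
    obtain ⟨x₀, hx₀⟩ := exists_mul_log_lt (d := d) (a := d + 1 + B) (b := B * (C / c)) (c := K')
      (by positivity) (by have : 0 ≤ d := by positivity
                          linarith) (by positivity) hK'
    obtain ⟨N, hN⟩ := hbdd (max x₀ 2)
    obtain ⟨i, hNi, hi⟩ := hbad N
    have hmi : max x₀ 2 < m i := hN.trans_le (hmmono hNi)
    have hmi1 : x₀ < m i := (le_max_left _ _).trans_lt hmi
    have hmi2 : 2 < m i := (le_max_right _ _).trans_lt hmi
    have hex : ∃ j, m i ≤ 2 * m j := ⟨i, by linarith [hm0 i]⟩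
    classical
    set j₀ := Nat.find hex with hj₀
    have hj₀spec : m i ≤ 2 * m j₀ := Nat.find_spec hex
    have hj₀i : j₀ ≤ i := Nat.find_min' hex (by linarith [hm0 i])
    have hm00 : m 0 = 1 := by simp [hm, logDet_zero]
    have hj₀pos : j₀ ≠ 0 := fun h0 => by
      rw [h0, hm00] at hj₀spec
      linarith
    obtain ⟨j₁, hj₁⟩ := Nat.exists_eq_succ_of_ne_zero hj₀pos
    have hj₁lt : 2 * m j₁ < m i := by
      have := Nat.find_min hex (m := j₁) (by omega)
      exact not_le.1 this
    -- the number of rounds in the window is bounded by the total gain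
    set V := m i ^ 3 * Real.exp (K' * m i ^ (3 / 4 : ℝ)) with hV
    have hV0 : 0 < V := by have := hm0 i; positivity
    have hcount : ((i - j₀ : ℕ) : ℝ) * (c / V) ≤ C := by
      refine le_trans ?_ (hgain (Finset.Ico j₀ i))
      have := Finset.card_nsmul_le_sum (Finset.Ico j₀ i) (fun k =>
        infoGain mdp r P (firstObs o k) / (1 + logDet P (firstObs o k)) ^ 2) (c / V)
        fun j hj => by
          obtain ⟨hj1, hj2⟩ := Finset.mem_Ico.1 hj
          refine hlow j (m i) (hmmono hj2.le) ?_
          have h1 : m i ≤ 2 * m j := hj₀spec.trans (by linarith [hmmono hj1])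
          have h2 := hUanti hj2.le
          have h3 : m i * U i ≤ 2 * m j * U j :=
            mul_le_mul h1 h2 (hU0 i) (by linarith [hm0 j])
          linarith
      simpa using this
    have hwin := logDet_firstObs_le P hB1 hB o j₁ (i - j₁)
    rw [Nat.add_sub_cancel' (by omega : j₁ ≤ i)] at hwin
    have hlen : ((i - j₁ : ℕ) : ℝ) ≤ C / c * V + 1 := by
      have h1 : i - j₁ = (i - j₀) + 1 := by omega
      rw [h1]
      push_cast
      have h2 : ((i - j₀ : ℕ) : ℝ) ≤ C / c * V := by
        rw [mul_div_assoc', div_le_iff₀ hV0] at hcount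
        rw [div_mul_eq_mul_div, le_div_iff₀ hc]
        linarith
      linarith
    have hd0 : 0 ≤ d := by positivity
    have hlog : d * Real.log (d + 1 + B * ((i - j₁ : ℕ) : ℝ)) ≤
        d * Real.log (d + 1 + B + B * (C / c) * V) := by
      refine mul_le_mul_of_nonneg_left (Real.log_le_log (by positivity) ?_) hd0
      have := mul_le_mul_of_nonneg_left hlen (by linarith : 0 ≤ B)
      linarith
    have hfin := hx₀ (m i) hmi1.le (hm1 i)
    rw [← hV] at hfin
    have e1 : m i = 1 + logDet P (firstObs o i) := rfl
    have e2 : m j₁ = 1 + logDet P (firstObs o j₁) := rfl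
    linarith

end Window

/-! ### Supermartingales of the observed history -/

section HistoryLaw

variable {S A : Type*} [Fintype S] [DecidableEq S] [Fintype A] [DecidableEq A] {h : ℕ}
variable {mdp : MDP S A} {r : EuclideanSpace ℝ (S × A)} {P : Params S A}
variable {Ω : Type*} [MeasurableSpace Ω] {μ : Measure Ω} [IsProbabilityMeasure μ]
variable {W : ℕ → Ω → Round S A h}

lemma measurable_obs (hW : IsDPS μ mdp r P W) (n : ℕ) : Measurable fun ω => (W n ω).2.2 :=
  measurable_snd.comp (measurable_snd.comp (hW.measurable n))

lemma measurable_history (hW : IsDPS μ mdp r P W) (n : ℕ) : Measurable (history W n) :=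
  measurable_pi_lambda _ fun i => measurable_obs hW i

lemma history_succ (W : ℕ → Ω → Round S A h) (n : ℕ) (ω : Ω) :
    history W (n + 1) ω = extend (history W n ω) (W n ω).2.2 :=
  firstObs_succ (fun k => (W k ω).2.2) n

lemma IsDPS.nonempty_policy (W : ℕ → Ω → Round S A h) (μ : Measure Ω) [IsProbabilityMeasure μ] :
    Nonempty (Policy S A h) := by
  have : Nonempty Ω := μ.nonempty_of_neZero
  exact ⟨(W 0 this.some).2.1 0⟩

lemma measure_history_inter (hW : IsDPS μ mdp r P W) (n : ℕ) (H : Fin n → Obs S A h)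
    {B : Set (Round S A h)} (hB : MeasurableSet B) :
    μ {ω | history W n ω = H ∧ W n ω ∈ B} = μ {ω | history W n ω = H} * roundLaw mdp r P H B := by
  simpa using hW.law n H Set.univ B MeasurableSet.univ hB

/-- The tower property: the next observation is integrated out with `obsMass`. -/
lemma lintegral_history_obs (hW : IsDPS μ mdp r P W)
    (hlink : ∀ τ τ' : Traj S A h, Feasible mdp τ → Feasible mdp τ' →
      |inner ℝ r (features τ' - features τ)| ≤ 1 / 2) (n : ℕ)
    (F : (Fin n → Obs S A h) → Obs S A h → ENNReal) :
    ∫⁻ ω, F (history W n ω) (W n ω).2.2 ∂μ =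
      ∫⁻ ω, ∑ o, ENNReal.ofReal (obsMass mdp r P (history W n ω) o) * F (history W n ω) o ∂μ := by
  have hZ : Measurable fun ω => (history W n ω, (W n ω).2.2) :=
    (measurable_history hW n).prodMk (measurable_obs hW n)
  have h1 := lintegral_map (μ := μ) (f := fun z : (Fin n → Obs S A h) × Obs S A h => F z.1 z.2)
    (measurable_of_countable _) hZ
  have h2 := lintegral_map (μ := μ) (f := fun H : Fin n → Obs S A h =>
    ∑ o, ENNReal.ofReal (obsMass mdp r P H o) * F H o)
    (measurable_of_countable _) (measurable_history hW n)
  rw [← h1, ← h2, lintegral_fintype, lintegral_fintype, Fintype.sum_prod_type]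
  refine Finset.sum_congr rfl fun H _ => ?_
  rw [Finset.sum_mul]
  refine Finset.sum_congr rfl fun o _ => ?_
  rw [Measure.map_apply hZ (measurableSet_singleton _),
    Measure.map_apply (measurable_history hW n) (measurableSet_singleton _)]
  have hB : MeasurableSet {w : Round S A h | w.2.2 = o} :=
    (measurable_snd.comp measurable_snd) (measurableSet_singleton o)
  have h3 : (fun ω => (history W n ω, (W n ω).2.2)) ⁻¹' {(H, o)} =
      {ω | history W n ω = H ∧ W n ω ∈ {w : Round S A h | w.2.2 = o}} := by
    ext ω; simp
  have h4 : history W n ⁻¹' {H} = {ω | history W n ω = H} := rfl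
  rw [h3, measure_history_inter hW n H hB, roundLaw_obs P hlink, h4]
  ring

/-- Nonnegative functions of the history that decrease in conditional mean by at least `g`. -/
structure IsSupermart (mdp : MDP S A) (r : EuclideanSpace ℝ (S × A)) (P : Params S A)
    (f g : ∀ n, (Fin n → Obs S A h) → ℝ) : Prop where
  nonneg : ∀ n H, 0 ≤ f n H
  gap_nonneg : ∀ n H, 0 ≤ g n H
  step : ∀ n H, ∑ o, obsMass mdp r P H o * f (n + 1) (extend H o) + g n H ≤ f n H

variable {f g : ∀ n, (Fin n → Obs S A h) → ℝ}

lemma sum_ofReal_obsMass_mul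
    (hlink : ∀ τ τ' : Traj S A h, Feasible mdp τ → Feasible mdp τ' →
      |inner ℝ r (features τ' - features τ)| ≤ 1 / 2) {n : ℕ} (H : Fin n → Obs S A h)
    {F : Obs S A h → ℝ} (hF : ∀ o, 0 ≤ F o) :
    ∑ o, ENNReal.ofReal (obsMass mdp r P H o) * ENNReal.ofReal (F o) =
      ENNReal.ofReal (∑ o, obsMass mdp r P H o * F o) := by
  rw [ENNReal.ofReal_sum_of_nonneg fun o _ => mul_nonneg (obsMass_nonneg P hlink H o) (hF o)]
  exact Finset.sum_congr rfl fun o _ => (ENNReal.ofReal_mul (obsMass_nonneg P hlink H o)).symm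

/-- The compensator of a nonnegative supermartingale is almost surely bounded. -/
lemma IsSupermart.ae_sum_le (hf : IsSupermart mdp r P f g) (hW : IsDPS μ mdp r P W)
    (hlink : ∀ τ τ' : Traj S A h, Feasible mdp τ → Feasible mdp τ' →
      |inner ℝ r (features τ' - features τ)| ≤ 1 / 2) :
    ∀ᵐ ω ∂μ, ∃ C : ℝ, ∀ s : Finset ℕ, ∑ k ∈ s, g k (history W k ω) ≤ C := by
  set a : ℕ → ENNReal := fun n => ∫⁻ ω, ENNReal.ofReal (f n (history W n ω)) ∂μ with ha
  set b : ℕ → ENNReal := fun n => ∫⁻ ω, ENNReal.ofReal (g n (history W n ω)) ∂μ with hb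
  have hmeas : ∀ (k : ∀ n, (Fin n → Obs S A h) → ℝ) (n : ℕ),
      Measurable fun ω => ENNReal.ofReal (k n (history W n ω)) := fun k n =>
    ((measurable_of_countable (k n)).comp (measurable_history hW n)).ennreal_ofReal
  have hstep : ∀ n, a (n + 1) + b n ≤ a n := by
    intro n
    have h1 : a (n + 1) = ∫⁻ ω, ENNReal.ofReal (∑ o, obsMass mdp r P (history W n ω) o *
        f (n + 1) (extend (history W n ω) o)) ∂μ := by
      simp only [ha, history_succ]
      rw [lintegral_history_obs hW hlink n fun H o => ENNReal.ofReal (f (n + 1) (extend H o))]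
      refine lintegral_congr fun ω => ?_
      exact sum_ofReal_obsMass_mul hlink _ fun o => hf.nonneg _ _
    rw [h1, hb, ← lintegral_add_right _ (hmeas g n)]
    refine lintegral_mono fun ω => ?_
    rw [← ENNReal.ofReal_add (Finset.sum_nonneg fun o _ =>
      mul_nonneg (obsMass_nonneg P hlink _ o) (hf.nonneg _ _)) (hf.gap_nonneg _ _)]
    exact ENNReal.ofReal_le_ofReal (hf.step n _)
  have hsum : ∀ n, a n + ∑ k ∈ Finset.range n, b k ≤ a 0 := by
    intro n
    induction n with
    | zero => simp
    | succ n ih =>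
      rw [Finset.sum_range_succ, add_comm (∑ k ∈ Finset.range n, b k), ← add_assoc]
      exact (add_le_add_left (hstep n) _).trans ih
  have ha0 : a 0 ≠ ⊤ := by
    have h1 : ∀ ω, history W 0 ω = fun i => i.elim0 := fun ω => Subsingleton.elim _ _
    simp only [ha, h1, lintegral_const, measure_univ, mul_one]
    exact ENNReal.ofReal_ne_top
  have htsum : ∫⁻ ω, ∑' n, ENNReal.ofReal (g n (history W n ω)) ∂μ ≠ ⊤ := by
    rw [lintegral_tsum fun n => (hmeas g n).aemeasurable]
    refine ne_top_of_le_ne_top ha0 (ENNReal.tsum_le_of_sum_range_le fun n => ?_)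
    exact le_trans le_add_self (hsum n)
  filter_upwards [ae_lt_top (Measurable.tsum fun n => hmeas g n) htsum] with ω hω
  refine ⟨(∑' n, ENNReal.ofReal (g n (history W n ω))).toReal, fun s => ?_⟩
  rw [← ENNReal.ofReal_le_iff_le_toReal hω.ne,
    ENNReal.ofReal_sum_of_nonneg fun k _ => hf.gap_nonneg _ _]
  exact ENNReal.sum_le_tsum s

/-- The maximal inequality for nonnegative supermartingales. -/
lemma IsSupermart.measure_exists_ge_le [Nonempty (Policy S A h)] (hf : IsSupermart mdp r P f g)
    (hW : IsDPS μ mdp r P W)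
    (hlink : ∀ τ τ' : Traj S A h, Feasible mdp τ → Feasible mdp τ' →
      |inner ℝ r (features τ' - features τ)| ≤ 1 / 2) (K : ℝ) :
    ENNReal.ofReal K * μ {ω | ∃ n, K ≤ f n (history W n ω)} ≤
      ENNReal.ofReal (f 0 fun i => i.elim0) := by
  classical
  set reached : ∀ n, (Fin n → Obs S A h) → Prop := fun n H =>
    ∃ k, ∃ hk : k ≤ n, K ≤ f k fun i => H (Fin.castLE hk i) with hreach
  have hreach_iff : ∀ n ω, reached n (history W n ω) ↔ ∃ k ≤ n, K ≤ f k (history W k ω) :=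
    fun n ω => ⟨fun ⟨k, hk, h⟩ => ⟨k, hk, h⟩, fun ⟨k, hk, h⟩ => ⟨k, hk, h⟩⟩
  -- the expectation of the supermartingale frozen at `K` from the first time that it
  -- is at least `K`
  set b : ℕ → ENNReal := fun n => ∫⁻ ω, (if reached n (history W n ω) then ENNReal.ofReal K
    else ENNReal.ofReal (f n (history W n ω))) ∂μ with hb
  have hstep : ∀ n, b (n + 1) ≤ b n := by
    intro n
    have h1 : b (n + 1) ≤ ∫⁻ ω, (if reached n (history W n ω) then ENNReal.ofReal K
        else ENNReal.ofReal (f (n + 1) (extend (history W n ω) (W n ω).2.2))) ∂μ := by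
      refine lintegral_mono fun ω => ?_
      simp only [hreach_iff, ← history_succ]
      by_cases h1 : ∃ k ≤ n, K ≤ f k (history W k ω)
      · obtain ⟨k, hk, hK⟩ := h1
        rw [if_pos ⟨k, hk.trans n.le_succ, hK⟩, if_pos ⟨k, hk, hK⟩]
      · rw [if_neg h1]
        split_ifs with h2
        · obtain ⟨k, hk, hK⟩ := h2
          rcases Nat.lt_or_ge n k with hnk | hnk
          · obtain rfl : k = n + 1 := by omega
            exact ENNReal.ofReal_le_ofReal hK
          · exact absurd ⟨k, hnk, hK⟩ h1
        · exact le_rfl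
    refine h1.trans ?_
    rw [lintegral_history_obs hW hlink n fun H o => if reached n H then ENNReal.ofReal K
      else ENNReal.ofReal (f (n + 1) (extend H o))]
    refine lintegral_mono fun ω => ?_
    by_cases h2 : reached n (history W n ω)
    · simp only [h2, if_true]
      rw [← Finset.sum_mul, ← ENNReal.ofReal_sum_of_nonneg fun o _ => obsMass_nonneg P hlink _ o,
        sum_obsMass, ENNReal.ofReal_one, one_mul]
    · simp only [h2, if_false]
      rw [sum_ofReal_obsMass_mul hlink _ fun o => hf.nonneg _ _]
      refine ENNReal.ofReal_le_ofReal ?_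
      linarith [hf.step n (history W n ω), hf.gap_nonneg n (history W n ω)]
  have hb0 : b 0 ≤ ENNReal.ofReal (f 0 fun i => i.elim0) := by
    have h1 : ∀ ω, history W 0 ω = fun i => i.elim0 := fun ω => Subsingleton.elim _ _
    calc b 0 ≤ ∫⁻ _, ENNReal.ofReal (f 0 fun i => i.elim0) ∂μ := by
          refine lintegral_mono fun ω => ?_
          simp only [hreach_iff]
          split_ifs with h2
          · obtain ⟨k, hk, hK⟩ := h2
            obtain rfl : k = 0 := by omega
            rw [h1] at hK
            exact ENNReal.ofReal_le_ofReal hK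
          · rw [h1]
      _ = _ := by simp
  have hbn : ∀ n, b n ≤ ENNReal.ofReal (f 0 fun i => i.elim0) := fun n =>
    (antitone_nat_of_succ_le hstep (Nat.zero_le n)).trans hb0
  have hmono : Monotone fun n => {ω | ∃ k ≤ n, K ≤ f k (history W k ω)} :=
    fun m n hmn ω ⟨k, hk, hK⟩ => ⟨k, hk.trans hmn, hK⟩
  have hunion : {ω | ∃ n, K ≤ f n (history W n ω)} =
      ⋃ n, {ω | ∃ k ≤ n, K ≤ f k (history W k ω)} := by
    ext ω
    simp only [Set.mem_ofPred_eq, Set.mem_iUnion]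
    exact ⟨fun ⟨n, hn⟩ => ⟨n, n, le_rfl, hn⟩, fun ⟨_, k, _, hk⟩ => ⟨k, hk⟩⟩
  rw [hunion, hmono.measure_iUnion, ENNReal.mul_iSup]
  refine iSup_le fun n => le_trans ?_ (hbn n)
  have hm : MeasurableSet {ω | ∃ k ≤ n, K ≤ f k (history W k ω)} := by
    have : {ω | ∃ k ≤ n, K ≤ f k (history W k ω)} = history W n ⁻¹' {H | reached n H} := by
      ext ω; exact (hreach_iff n ω).symm
    rw [this]
    exact measurable_history hW n (Set.toFinite _).measurableSet
  rw [← setLIntegral_const, ← lintegral_indicator hm]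
  refine lintegral_mono fun ω => ?_
  by_cases hω : ∃ k ≤ n, K ≤ f k (history W k ω)
  · rw [Set.indicator_of_mem (by exact hω), if_pos ((hreach_iff n ω).2 hω)]
  · rw [Set.indicator_of_notMem (by exact hω)]
    exact zero_le

lemma IsSupermart.ae_bounded [Nonempty (Policy S A h)] (hf : IsSupermart mdp r P f g)
    (hW : IsDPS μ mdp r P W)
    (hlink : ∀ τ τ' : Traj S A h, Feasible mdp τ → Feasible mdp τ' →
      |inner ℝ r (features τ' - features τ)| ≤ 1 / 2) :
    ∀ᵐ ω ∂μ, ∃ C : ℝ, ∀ n, f n (history W n ω) ≤ C := by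
  rw [ae_iff]
  set N := {ω | ¬∃ C : ℝ, ∀ n, f n (history W n ω) ≤ C} with hN
  have hle : ∀ K : ℕ, (K : ENNReal) * μ N ≤ ENNReal.ofReal (f 0 fun i => i.elim0) := by
    intro K
    have h1 := hf.measure_exists_ge_le hW hlink K
    rw [ENNReal.ofReal_natCast] at h1
    refine le_trans (mul_le_mul_right (measure_mono fun ω hω => ?_) _) h1
    by_contra hcon
    refine hω ⟨K, fun n => ?_⟩
    by_contra hlt
    exact hcon ⟨n, (not_le.1 hlt).le⟩
  by_contra hne
  have htop : (⊤ : ENNReal) ≤ ENNReal.ofReal (f 0 fun i => i.elim0) := by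
    rw [← ENNReal.top_mul hne, ← ENNReal.iSup_natCast, ENNReal.iSup_mul]
    exact iSup_le hle
  exact ENNReal.ofReal_ne_top (top_le_iff.1 htop)

end HistoryLaw

/-! ### The three supermartingales -/

section Supermartingales

variable {S A : Type*} [Fintype S] [DecidableEq S] [Fintype A] [DecidableEq A] {h : ℕ}
variable {mdp : MDP S A} {r : EuclideanSpace ℝ (S × A)} {P : Params S A}
variable {Ω : Type*} [MeasurableSpace Ω] {μ : Measure Ω} [IsProbabilityMeasure μ]
variable {W : ℕ → Ω → Round S A h}

/-- The centred label noise, which takes two values at distance `1`, is `1`-sub-Gaussian. -/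
lemma two_point_exp_le {ρ : ℝ} (hρ : |ρ| ≤ 1 / 2) (s : ℝ) :
    (1 / 2 + ρ) * Real.exp ((1 / 2 - ρ) * s) + (1 / 2 - ρ) * Real.exp ((-(1 / 2) - ρ) * s) ≤
      Real.exp (s ^ 2 / 2) := by
  obtain ⟨h1, h2⟩ := abs_le.1 hρ
  have e1 := Real.exp_mul_le_cosh_add_mul_sinh (t := 1 / 2 - ρ)
    (abs_le.2 ⟨by linarith, by linarith⟩) s
  have e2 := Real.exp_mul_le_cosh_add_mul_sinh (t := -(1 / 2) - ρ)
    (abs_le.2 ⟨by linarith, by linarith⟩) s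
  have := Real.cosh_le_exp_half_sq s
  nlinarith [mul_le_mul_of_nonneg_left e1 (by linarith : 0 ≤ 1 / 2 + ρ),
    mul_le_mul_of_nonneg_left e2 (by linarith : 0 ≤ 1 / 2 - ρ)]

/-- The increment of the self-normalized noise, compensated by that of the log-determinant, is at
most the increment of an exponential supermartingale for bounded noise. -/
lemma selfNorm_increment_le {q : ℝ} (hq : 0 ≤ q) (w : ℝ) {η : ℝ} (hη : |η| ≤ 1) :
    ((-w ^ 2 + 2 * η * w + η ^ 2 * q) / (1 + q) - Real.log (1 + q)) / 2 ≤
      η * (w / (1 + q)) - (w / (1 + q)) ^ 2 / 2 := by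
  have h1 : 0 < 1 + q := by linarith
  have hlog := Real.one_sub_inv_le_log_of_pos h1
  have hη2 : η ^ 2 ≤ 1 := by rw [← sq_abs]; nlinarith [abs_nonneg η]
  have e1 : η ^ 2 * q / (1 + q) ≤ 1 - (1 + q)⁻¹ := by
    rw [show 1 - (1 + q)⁻¹ = q / (1 + q) by field_simp; ring]
    gcongr
    nlinarith
  have e2 : (w / (1 + q)) ^ 2 ≤ w ^ 2 / (1 + q) := by
    rw [div_pow]
    refine div_le_div_of_nonneg_left (sq_nonneg w) h1 ?_
    nlinarith
  have e3 : (-w ^ 2 + 2 * η * w + η ^ 2 * q) / (1 + q) =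
      -(w ^ 2 / (1 + q)) + 2 * (η * (w / (1 + q))) + η ^ 2 * q / (1 + q) := by
    field_simp
  rw [e3]
  linarith

/-- The exponential supermartingale of the self-normalized noise. -/
lemma isSupermart_exp_selfNorm [Nonempty (Policy S A h)]
    (hlink : ∀ τ τ' : Traj S A h, Feasible mdp τ → Feasible mdp τ' →
      |inner ℝ r (features τ' - features τ)| ≤ 1 / 2) :
    IsSupermart mdp r P
      (fun n (H : Fin n → Obs S A h) => Real.exp ((selfNorm P r H - logDet P H) / 2))
      fun _ _ => 0 where
  nonneg _ _ := (Real.exp_pos _).le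
  gap_nonneg _ _ := le_rfl
  step n H := by
    rw [add_zero, sum_obsMass_mul P H
      fun o => Real.exp ((selfNorm P r (extend H o) - logDet P (extend H o)) / 2)]
    set f := Real.exp ((selfNorm P r H - logDet P H) / 2) with hf
    have hsum : ∑ τ : Traj S A h, ∑ τ' : Traj S A h,
        trajMass mdp P H τ * trajMass mdp P H τ' * f = f := by
      simp only [← Finset.sum_mul, ← Finset.mul_sum, sum_trajMass, mul_one, one_mul]
    refine le_trans (Finset.sum_le_sum fun τ _ => Finset.sum_le_sum fun τ' _ => ?_) hsum.le
    by_cases h0 : trajMass mdp P H τ = 0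
    · simp [h0]
    by_cases h1 : trajMass mdp P H τ' = 0
    · simp [h1]
    refine mul_le_mul_of_nonneg_left ?_
      (mul_nonneg (trajMass_nonneg _ _ _ _) (trajMass_nonneg _ _ _ _))
    set o : Obs S A h := (![τ, τ'], true) with ho
    have hρ : |inner ℝ r (diff o)| ≤ 1 / 2 :=
      abs_inner_diff_le hlink (feasible_of_trajMass_ne_zero mdp P h0)
        (feasible_of_trajMass_ne_zero mdp P h1)
    obtain ⟨w, hw⟩ := selfNorm_extend P r H o
    have hd : ∀ b : Bool, diff (![τ, τ'], b) = diff o := fun _ => rfl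
    set ρ : ℝ := inner ℝ r (diff o) with hρdef
    set q := unc P H (diff o) with hqdef
    have hq : 0 ≤ q := unc_nonneg P H _
    obtain ⟨hρ1, hρ2⟩ := abs_le.1 hρ
    have hb : ∀ b : Bool, Real.exp ((selfNorm P r (extend H (![τ, τ'], b)) -
        logDet P (extend H (![τ, τ'], b))) / 2) ≤
        f * (Real.exp ((label ((![τ, τ'], b) : Obs S A h) - ρ) * (w / (1 + q))) *
          Real.exp (-((w / (1 + q)) ^ 2 / 2))) := by
      intro b
      rw [hf, ← Real.exp_add, ← Real.exp_add, Real.exp_le_exp, hw b, logDet_extend, hd]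
      have hη : |label ((![τ, τ'], b) : Obs S A h) - ρ| ≤ 1 := by
        unfold label
        rw [abs_le]
        split_ifs <;> constructor <;> linarith
      have := selfNorm_increment_le hq w hη
      have hl : label (o.1, b) = label ((![τ, τ'], b) : Obs S A h) := rfl
      rw [hl]
      linarith
    have hp1 : prefProb r ((![τ, τ'], true) : Obs S A h) = 1 / 2 + ρ := rfl
    have hp2 : prefProb r ((![τ, τ'], false) : Obs S A h) = 1 / 2 - ρ := rfl
    have hl1 : label ((![τ, τ'], true) : Obs S A h) = 1 / 2 := rfl
    have hl2 : label ((![τ, τ'], false) : Obs S A h) = -(1 / 2) := by simp [label]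
    have b1 := hb true
    have b2 := hb false
    rw [hl1] at b1
    rw [hl2] at b2
    rw [hp1, hp2]
    set s := w / (1 + q)
    calc _ ≤ (1 / 2 + ρ) * (f * (Real.exp ((1 / 2 - ρ) * s) * Real.exp (-(s ^ 2 / 2)))) +
          (1 / 2 - ρ) * (f * (Real.exp ((-(1 / 2) - ρ) * s) * Real.exp (-(s ^ 2 / 2)))) :=
          add_le_add (mul_le_mul_of_nonneg_left b1 (by linarith))
            (mul_le_mul_of_nonneg_left b2 (by linarith))
      _ = f * Real.exp (-(s ^ 2 / 2)) * ((1 / 2 + ρ) * Real.exp ((1 / 2 - ρ) * s) +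
          (1 / 2 - ρ) * Real.exp ((-(1 / 2) - ρ) * s)) := by ring
      _ ≤ f * Real.exp (-(s ^ 2 / 2)) * Real.exp (s ^ 2 / 2) :=
          mul_le_mul_of_nonneg_left (two_point_exp_le hρ s)
            (mul_nonneg (Real.exp_pos _).le (Real.exp_pos _).le)
      _ = f := by rw [mul_assoc, ← Real.exp_add]; simp

/-- Almost surely, the ridge estimates stay within a multiple of the confidence radius of the
true rewards. -/
lemma ae_ridgeClose [Nonempty (Policy S A h)] (hW : IsDPS μ mdp r P W)
    (hlink : ∀ τ τ' : Traj S A h, Feasible mdp τ → Feasible mdp τ' →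
      |inner ℝ r (features τ' - features τ)| ≤ 1 / 2) :
    ∀ᵐ ω ∂μ, ∃ K : ℝ, ∀ n, RidgeClose r P K (history W n ω) := by
  filter_upwards [(isSupermart_exp_selfNorm (P := P) hlink).ae_bounded hW hlink] with ω hω
  obtain ⟨C, hC⟩ := hω
  have hC0 : 0 < C := (Real.exp_pos _).trans_le (hC 0)
  refine ⟨2 + 4 * |Real.log C| + 2 * (P.lam ^ 2 * ‖r‖ ^ 2), fun n v => ?_⟩
  refine (inner_ridge_sub_sq_le P r (history W n ω) v).trans ?_
  rw [mul_comm]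
  refine mul_le_mul_of_nonneg_right ?_ (unc_nonneg P _ v)
  have h1 := Real.log_le_log (Real.exp_pos _) (hC n)
  rw [Real.log_exp] at h1
  have h2 := logDet_nonneg P (history W n ω)
  have h3 := le_abs_self (Real.log C)
  have h4 : 0 ≤ P.lam ^ 2 * ‖r‖ ^ 2 := by positivity
  nlinarith [mul_nonneg (abs_nonneg (Real.log C)) h2, mul_nonneg h4 h2]

/-- The compensator of the supermartingale `(1 + B) / (1 + logDet)` is the information gain,
discounted by the square of `1 + logDet`. -/
lemma isSupermart_logDet [Nonempty (Policy S A h)]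
    (hlink : ∀ τ τ' : Traj S A h, Feasible mdp τ → Feasible mdp τ' →
      |inner ℝ r (features τ' - features τ)| ≤ 1 / 2) {B : ℝ} (hB1 : 1 ≤ B)
    (hB : ∀ o : Obs S A h, ‖diff o‖ ^ 2 ≤ B) :
    IsSupermart mdp r P (fun n (H : Fin n → Obs S A h) => (1 + B) / (1 + logDet P H))
      fun _ H => infoGain mdp r P H / (1 + logDet P H) ^ 2 where
  nonneg n H := div_nonneg (by linarith) (by linarith [logDet_nonneg P H])
  gap_nonneg n H := div_nonneg (Finset.sum_nonneg fun o _ =>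
    mul_nonneg (obsMass_nonneg P hlink H o) (log_one_add_unc_nonneg P H _)) (sq_nonneg _)
  step n H := by
    set m := 1 + logDet P H with hm
    have hm1 : 1 ≤ m := by linarith [logDet_nonneg P H]
    have hm0 : 0 < m := by linarith
    have key : ∀ o : Obs S A h, (1 + B) / (1 + logDet P (extend H o)) ≤
        (1 + B) / m - Real.log (1 + unc P H (diff o)) / m ^ 2 := by
      intro o
      rw [logDet_extend, ← add_assoc, ← hm]
      set X := Real.log (1 + unc P H (diff o)) with hX
      have hX0 : 0 ≤ X := log_one_add_unc_nonneg P H _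
      have hXB : X ≤ B := by
        have h1 := unc_nonneg P H (diff o)
        have h2 := Real.log_le_sub_one_of_pos (by linarith : 0 < 1 + unc P H (diff o))
        have h3 := unc_le_norm_sq P H (diff o)
        linarith [hB o]
      have hmX : 0 < m + X := by linarith
      rw [div_sub_div _ _ hm0.ne' (by positivity), div_le_div_iff₀ hmX (by positivity)]
      have : X * m ^ 2 * (m + X) ≤ X * m ^ 2 * (m * (1 + B)) := by
        refine mul_le_mul_of_nonneg_left ?_ (by positivity)
        nlinarith
      nlinarith
    have hle : ∑ o, obsMass mdp r P H o * ((1 + B) / (1 + logDet P (extend H o))) ≤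
        ∑ o, obsMass mdp r P H o *
          ((1 + B) / m - Real.log (1 + unc P H (diff o)) / m ^ 2) :=
      Finset.sum_le_sum fun o _ => mul_le_mul_of_nonneg_left (key o) (obsMass_nonneg P hlink H o)
    have heq : ∑ o, obsMass mdp r P H o *
        ((1 + B) / m - Real.log (1 + unc P H (diff o)) / m ^ 2) =
        (1 + B) / m - infoGain mdp r P H / m ^ 2 := by
      simp only [mul_sub, Finset.sum_sub_distrib, ← Finset.sum_mul, sum_obsMass, one_mul,
        infoGain, Finset.sum_div, mul_div_assoc]
    have := hle.trans heq.le
    exact le_sub_iff_add_le.1 this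

/-- Almost surely, the discounted information gains are summable. -/
lemma ae_infoGain_bounded [Nonempty (Policy S A h)] (hW : IsDPS μ mdp r P W)
    (hlink : ∀ τ τ' : Traj S A h, Feasible mdp τ → Feasible mdp τ' →
      |inner ℝ r (features τ' - features τ)| ≤ 1 / 2) :
    ∀ᵐ ω ∂μ, ∃ C : ℝ, ∀ s : Finset ℕ,
      ∑ k ∈ s, infoGain mdp r P (history W k ω) / (1 + logDet P (history W k ω)) ^ 2 ≤ C := by
  obtain ⟨B, hB1, hB⟩ := exists_norm_diff_sq_le (S := S) (A := A) (h := h)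
  exact (isSupermart_logDet hlink hB1 hB).ae_sum_le hW hlink

/-- The number of visits of a state-action pair in an observation. -/
def obsVisits (s : S) (a : A) (o : Obs S A h) : ℝ :=
  ∑ j : Fin 2, ∑ s', (transCount (o.1 j) s a s' : ℝ)

/-- The compensated number of transitions in an observation. -/
def obsDev (mdp : MDP S A) (s : S) (a : A) (s' : S) (o : Obs S A h) : ℝ :=
  ∑ j : Fin 2, ((transCount (o.1 j) s a s' : ℝ) -
    mdp.trans s a s' * ∑ s'', (transCount (o.1 j) s a s'' : ℝ))

lemma transTotal_extend {n : ℕ} (H : Fin n → Obs S A h) (o : Obs S A h) (s : S) (a : A)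
    (s' : S) : transTotal (extend H o) s a s' =
      transTotal H s a s' + ∑ j : Fin 2, (transCount (o.1 j) s a s' : ℝ) := by
  rw [transTotal, Fin.sum_univ_castSucc]
  simp only [extend, Fin.snoc_castSucc, Fin.snoc_last, transTotal]

lemma visits_extend {n : ℕ} (H : Fin n → Obs S A h) (o : Obs S A h) (s : S) (a : A) :
    visits (extend H o) s a = visits H s a + obsVisits s a o := by
  simp only [visits, transTotal_extend, Finset.sum_add_distrib, obsVisits]
  rw [Finset.sum_comm (s := (Finset.univ : Finset S))]

lemma transTotal_extend_sub (mdp : MDP S A) {n : ℕ} (H : Fin n → Obs S A h) (o : Obs S A h)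
    (s : S) (a : A) (s' : S) :
    transTotal (extend H o) s a s' - mdp.trans s a s' * visits (extend H o) s a =
      transTotal H s a s' - mdp.trans s a s' * visits H s a + obsDev mdp s a s' o := by
  rw [visits_extend, transTotal_extend]
  simp only [obsDev, obsVisits, Finset.sum_sub_distrib, ← Finset.mul_sum]
  ring

lemma obsVisits_nonneg (s : S) (a : A) (o : Obs S A h) : 0 ≤ obsVisits s a o := by
  unfold obsVisits; positivity

lemma abs_obsDev_le (mdp : MDP S A) (s : S) (a : A) (s' : S) (o : Obs S A h) :
    |obsDev mdp s a s' o| ≤ obsVisits s a o := by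
  refine (Finset.abs_sum_le_sum_abs _ _).trans (Finset.sum_le_sum fun j _ => ?_)
  have h1 : (transCount (o.1 j) s a s' : ℝ) ≤ ∑ y, (transCount (o.1 j) s a y : ℝ) :=
    Finset.single_le_sum (f := fun y => (transCount (o.1 j) s a y : ℝ))
      (fun y _ => Nat.cast_nonneg _) (Finset.mem_univ s')
  have h2 : (0 : ℝ) ≤ transCount (o.1 j) s a s' := Nat.cast_nonneg _
  have h3 := mdp.trans_nonneg s a s'
  have h4 := trans_le_one mdp s a s'
  rw [abs_le]
  constructor <;> nlinarith

/-- Martingale property of the compensated transition counts. -/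
lemma sum_obsMass_mul_obsDev [Nonempty (Policy S A h)] {n : ℕ} (H : Fin n → Obs S A h)
    (s : S) (a : A) (s' : S) : ∑ o, obsMass mdp r P H o * obsDev mdp s a s' o = 0 := by
  set g : Traj S A h → ℝ := fun τ => (transCount τ s a s' : ℝ) -
    mdp.trans s a s' * ∑ s'', (transCount τ s a s'' : ℝ) with hg
  have hzero : ∑ τ, trajMass mdp P H τ * g τ = 0 := by
    simp only [trajMass, Finset.sum_mul]
    rw [Finset.sum_comm]
    refine Finset.sum_eq_zero fun π _ => ?_
    simp only [mul_assoc, ← Finset.mul_sum]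
    rw [sum_trajProb_mul_transCount, mul_zero]
  have h1 : ∀ o : Obs S A h, obsDev mdp s a s' o = g (o.1 0) + g (o.1 1) := fun o => by
    simp only [obsDev, Fin.sum_univ_two, hg]
  simp only [h1]
  rw [sum_obsMass_mul_traj P H fun τ τ' => g τ + g τ']
  have h2 : ∀ τ τ' : Traj S A h, trajMass mdp P H τ * trajMass mdp P H τ' * (g τ + g τ') =
      trajMass mdp P H τ * g τ * trajMass mdp P H τ' +
        trajMass mdp P H τ * (trajMass mdp P H τ' * g τ') := fun τ τ' => by ring
  simp only [h2, Finset.sum_add_distrib, ← Finset.mul_sum, hzero, ← Finset.sum_mul]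
  simp

/-- The decrease of `x ^ (-1/5)` when `x` grows by `ν`. Multiplied by a constant, it pays for the
quadratic variation of the compensated counts, normalized by `x ^ (6/5)`. -/
lemma inv_fifth_root_sub_ge {u u' ν V : ℝ} (hu : 1 ≤ u) (huu : u ≤ u') (hν : 0 ≤ ν) (hV : ν ≤ V)
    (h5 : u' ^ 5 = u ^ 5 + ν) : ν / (5 * (1 + V) * u ^ 6) ≤ 1 / u - 1 / u' := by
  have hu0 : 0 < u := by linarith
  have hu0' : 0 < u' := by linarith
  have hV0 : 0 ≤ V := hν.trans hV
  have hge : ν ≤ (u' - u) * (5 * u' ^ 4) := by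
    have e : ν = (u' - u) * (u' ^ 4 + u' ^ 3 * u + u' ^ 2 * u ^ 2 + u' * u ^ 3 + u ^ 4) := by
      linear_combination -h5
    have h1 : u' ^ 3 * u ≤ u' ^ 3 * u' := by gcongr
    have h2 : u' ^ 2 * u ^ 2 ≤ u' ^ 2 * u' ^ 2 := by gcongr
    have h3 : u' * u ^ 3 ≤ u' * u' ^ 3 := by gcongr
    have h4 : u ^ 4 ≤ u' ^ 4 := by gcongr
    rw [e]
    refine mul_le_mul_of_nonneg_left ?_ (by linarith)
    nlinarith
  have hu5 : u' ^ 5 ≤ (1 + V) * u ^ 5 := by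
    have : 1 ≤ u ^ 5 := one_le_pow₀ hu
    nlinarith
  rw [div_sub_div _ _ hu0.ne' hu0'.ne', div_le_div_iff₀ (by positivity) (by positivity)]
  calc ν * (u * u') ≤ (u' - u) * (5 * u' ^ 4) * (u * u') := by gcongr
    _ = (u' - u) * 5 * u * u' ^ 5 := by ring
    _ ≤ (u' - u) * 5 * u * ((1 + V) * u ^ 5) := by
        refine mul_le_mul_of_nonneg_left hu5 ?_
        have : 0 ≤ u' - u := by linarith
        positivity
    _ = (1 * u' - u * 1) * (5 * (1 + V) * u ^ 6) := by ring

/-- The fifth root of the number of visits, shifted by one. -/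
def visitRoot {n : ℕ} (H : Fin n → Obs S A h) (s : S) (a : A) : ℝ :=
  (1 + visits H s a) ^ (1 / 5 : ℝ)

lemma one_le_visitRoot {n : ℕ} (H : Fin n → Obs S A h) (s : S) (a : A) :
    1 ≤ visitRoot H s a :=
  Real.one_le_rpow (by linarith [visits_nonneg H s a]) (by norm_num)

lemma visitRoot_pow {n : ℕ} (H : Fin n → Obs S A h) (s : S) (a : A) :
    visitRoot H s a ^ 5 = 1 + visits H s a := by
  rw [visitRoot, ← Real.rpow_natCast, ← Real.rpow_mul (by linarith [visits_nonneg H s a])]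
  norm_num

/-- The supermartingale of the normalized squared compensated counts. -/
lemma isSupermart_counts [Nonempty (Policy S A h)]
    (hlink : ∀ τ τ' : Traj S A h, Feasible mdp τ → Feasible mdp τ' →
      |inner ℝ r (features τ' - features τ)| ≤ 1 / 2) (s : S) (a : A) (s' : S) {V : ℝ}
    (hV0 : 0 ≤ V) (hV : ∀ o : Obs S A h, obsVisits s a o ≤ V) :
    IsSupermart mdp r P
      (fun n (H : Fin n → Obs S A h) =>
        (transTotal H s a s' - mdp.trans s a s' * visits H s a) ^ 2 / visitRoot H s a ^ 6 +
          5 * V * (1 + V) / visitRoot H s a) fun _ _ => 0 where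
  nonneg n H := by
    have := one_le_visitRoot H s a
    have : 0 < visitRoot H s a := by linarith
    positivity
  gap_nonneg _ _ := le_rfl
  step n H := by
    set u := visitRoot H s a with hu
    set D := transTotal H s a s' - mdp.trans s a s' * visits H s a with hD
    have hu1 : 1 ≤ u := one_le_visitRoot H s a
    have hu0 : 0 < u := by linarith
    have key : ∀ o : Obs S A h,
        (transTotal (extend H o) s a s' - mdp.trans s a s' * visits (extend H o) s a) ^ 2 /
          visitRoot (extend H o) s a ^ 6 + 5 * V * (1 + V) / visitRoot (extend H o) s a ≤
        D ^ 2 / u ^ 6 + 5 * V * (1 + V) / u + 2 * D / u ^ 6 * obsDev mdp s a s' o := by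
      intro o
      rw [transTotal_extend_sub, ← hD]
      set δ := obsDev mdp s a s' o with hδ
      set ν := obsVisits s a o with hν
      set u' := visitRoot (extend H o) s a with hu'
      have hν0 : 0 ≤ ν := obsVisits_nonneg s a o
      have h5 : u' ^ 5 = u ^ 5 + ν := by
        rw [hu', hu, visitRoot_pow, visitRoot_pow, visits_extend]; ring
      have huu : u ≤ u' := by
        refine Real.rpow_le_rpow (by linarith [visits_nonneg H s a]) ?_ (by norm_num)
        rw [visits_extend]; linarith
      have hroot := inv_fifth_root_sub_ge hu1 huu hν0 (hV o) h5
      have hroot' := mul_le_mul_of_nonneg_left hroot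
        (by positivity : (0 : ℝ) ≤ 5 * V * (1 + V))
      have e1 : 5 * V * (1 + V) * (ν / (5 * (1 + V) * u ^ 6)) = V * ν / u ^ 6 := by
        field_simp
      have hδ2 : δ ^ 2 ≤ V * ν := by
        have h1 := abs_obsDev_le mdp s a s' o
        rw [← sq_abs]
        calc |δ| ^ 2 ≤ ν ^ 2 := by gcongr
          _ = ν * ν := sq ν
          _ ≤ V * ν := mul_le_mul_of_nonneg_right (hV o) hν0
      have hsq : (D + δ) ^ 2 / u' ^ 6 ≤ (D ^ 2 + 2 * D * δ + V * ν) / u ^ 6 := by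
        calc (D + δ) ^ 2 / u' ^ 6 ≤ (D + δ) ^ 2 / u ^ 6 := by gcongr
          _ ≤ _ := by gcongr; nlinarith
      have e2 : (D ^ 2 + 2 * D * δ + V * ν) / u ^ 6 =
          D ^ 2 / u ^ 6 + 2 * D / u ^ 6 * δ + V * ν / u ^ 6 := by ring
      have e3 : 5 * V * (1 + V) * (1 / u - 1 / u') =
          5 * V * (1 + V) / u - 5 * V * (1 + V) / u' := by ring
      linarith
    rw [add_zero]
    refine (Finset.sum_le_sum fun o _ => mul_le_mul_of_nonneg_left (key o)
      (obsMass_nonneg P hlink H o)).trans ?_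
    have h1 : ∀ o : Obs S A h, obsMass mdp r P H o * (D ^ 2 / u ^ 6 + 5 * V * (1 + V) / u +
        2 * D / u ^ 6 * obsDev mdp s a s' o) =
        obsMass mdp r P H o * (D ^ 2 / u ^ 6 + 5 * V * (1 + V) / u) +
          2 * D / u ^ 6 * (obsMass mdp r P H o * obsDev mdp s a s' o) := fun o => by ring
    simp only [h1, Finset.sum_add_distrib, ← Finset.sum_mul, ← Finset.mul_sum, sum_obsMass,
      sum_obsMass_mul_obsDev, one_mul, mul_zero, add_zero, le_refl]

/-- Almost surely, the transition counts stay close to their compensators. -/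
lemma ae_countsClose [Nonempty (Policy S A h)] (hW : IsDPS μ mdp r P W)
    (hlink : ∀ τ τ' : Traj S A h, Feasible mdp τ → Feasible mdp τ' →
      |inner ℝ r (features τ' - features τ)| ≤ 1 / 2) :
    ∀ᵐ ω ∂μ, ∃ K : ℝ, ∀ n, CountsClose mdp K (history W n ω) := by
  have hone : ∀ s a s', ∀ᵐ ω ∂μ, ∃ K : ℝ, 0 ≤ K ∧ ∀ n,
      |transTotal (history W n ω) s a s' - mdp.trans s a s' * visits (history W n ω) s a| ≤
        K * (1 + visits (history W n ω) s a) ^ (3 / 5 : ℝ) := by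
    intro s a s'
    have hV : ∀ o : Obs S A h, obsVisits s a o ≤ ∑ o : Obs S A h, obsVisits s a o := fun o =>
      Finset.single_le_sum (f := fun o : Obs S A h => obsVisits s a o)
        (fun o _ => obsVisits_nonneg s a o) (Finset.mem_univ o)
    have hV0 : 0 ≤ ∑ o : Obs S A h, obsVisits s a o :=
      Finset.sum_nonneg fun o _ => obsVisits_nonneg s a o
    filter_upwards [(isSupermart_counts (P := P) hlink s a s' hV0 hV).ae_bounded hW hlink]
      with ω hω
    obtain ⟨C, hC⟩ := hω
    refine ⟨√C, Real.sqrt_nonneg C, fun n => ?_⟩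
    set H := history W n ω
    have hu1 := one_le_visitRoot H s a
    have hu0 : 0 < visitRoot H s a := by linarith
    have h1 : (transTotal H s a s' - mdp.trans s a s' * visits H s a) ^ 2 /
        visitRoot H s a ^ 6 ≤ C := by
      refine le_trans (le_add_of_nonneg_right ?_) (hC n)
      positivity
    have hC0 : 0 ≤ C := le_trans (by positivity) h1
    rw [div_le_iff₀ (by positivity)] at h1
    have h3 : (1 + visits H s a) ^ (3 / 5 : ℝ) = visitRoot H s a ^ 3 := by
      rw [visitRoot, ← Real.rpow_natCast, ← Real.rpow_mul (by linarith [visits_nonneg H s a])]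
      norm_num
    rw [h3]
    refine abs_le_of_sq_le_sq ?_ (by positivity)
    rw [mul_pow, Real.sq_sqrt hC0, ← pow_mul]
    exact h1
  have hall : ∀ᵐ ω ∂μ, ∀ s a s', ∃ K : ℝ, 0 ≤ K ∧ ∀ n,
      |transTotal (history W n ω) s a s' - mdp.trans s a s' * visits (history W n ω) s a| ≤
        K * (1 + visits (history W n ω) s a) ^ (3 / 5 : ℝ) := by
    simp only [ae_all_iff]
    exact hone
  filter_upwards [hall] with ω hω
  choose K hK0 hK using hω
  refine ⟨∑ s, ∑ a, ∑ s', K s a s', fun n s a s' => (hK s a s' n).trans ?_⟩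
  refine mul_le_mul_of_nonneg_right ?_
    (Real.rpow_nonneg (by linarith [visits_nonneg (history W n ω) s a]) _)
  calc K s a s' ≤ ∑ y, K s a y :=
        Finset.single_le_sum (f := fun y => K s a y) (fun y _ => hK0 s a y) (Finset.mem_univ s')
    _ ≤ ∑ b, ∑ y, K s b y :=
        Finset.single_le_sum (f := fun b => ∑ y, K s b y)
          (fun b _ => Finset.sum_nonneg fun y _ => hK0 s b y) (Finset.mem_univ a)
    _ ≤ _ :=
        Finset.single_le_sum (f := fun x => ∑ b, ∑ y, K x b y)
          (fun x _ => Finset.sum_nonneg fun b _ => Finset.sum_nonneg fun y _ => hK0 x b y)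
          (Finset.mem_univ s)

end Supermartingales

/-! ### Convergence in distribution -/

section Convergence

variable {S A : Type*} [Fintype S] [DecidableEq S] [Fintype A] [DecidableEq A] {h : ℕ}
variable {mdp : MDP S A} {r : EuclideanSpace ℝ (S × A)} {P : Params S A}
variable {Ω : Type*} [MeasurableSpace Ω] {μ : Measure Ω} [IsProbabilityMeasure μ]
variable {W : ℕ → Ω → Round S A h}

/-- The sub-Gaussian parameter is positive: two copies of one trajectory of positive probability
have equal features, so the first label noise takes the values `1/2` and `-1/2` with positive
probability. -/
lemma SubGaussianNoise.R_pos (hnoise : SubGaussianNoise μ r W P.R) (hW : IsDPS μ mdp r P W)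
    (hlink : ∀ τ τ' : Traj S A h, Feasible mdp τ → Feasible mdp τ' →
      |inner ℝ r (features τ' - features τ)| ≤ 1 / 2) : 0 < P.R := by
  have : Nonempty (Policy S A h) := IsDPS.nonempty_policy W μ
  refine lt_of_le_of_ne P.R_nonneg fun hR => ?_
  set η : Obs S A h → ℝ := fun o => label o - inner ℝ r (diff o) with hη
  have hcond : ∀ s : ℝ, ∫ ω, Real.exp (s * noise r W 0 ω) ∂μ ≤ 1 := by
    intro s
    have h1 := hnoise 0 s
    have h2 : (fun ω (i : Fin 0) => (diff (W i ω).2.2, noise r W i ω)) =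
        fun _ : Ω => (fun i : Fin 0 => i.elim0) := funext fun ω => Subsingleton.elim _ _
    rw [h2, MeasurableSpace.comap_const, condExp_bot, ← hR] at h1
    obtain ⟨ω, hω⟩ := h1.exists
    simpa using hω
  have hint : ∀ s : ℝ, Integrable (fun ω => Real.exp (s * noise r W 0 ω)) μ := fun s =>
    (Integrable.of_finite (μ := μ.map fun ω => (W 0 ω).2.2)
      (f := fun o => Real.exp (s * η o))).comp_measurable (measurable_obs hW 0)
  have hnn : 0 ≤ fun ω => Real.exp (1 * noise r W 0 ω) + Real.exp (-1 * noise r W 0 ω) - 2 := by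
    intro ω
    have h1 := Real.one_le_cosh (noise r W 0 ω)
    rw [Real.cosh_eq] at h1
    simp only [Pi.zero_apply, one_mul, neg_mul]
    linarith
  have hzero : ∫ ω, (Real.exp (1 * noise r W 0 ω) + Real.exp (-1 * noise r W 0 ω) - 2) ∂μ = 0 := by
    refine le_antisymm ?_ (integral_nonneg hnn)
    rw [integral_sub (f := fun ω => Real.exp (1 * noise r W 0 ω) + Real.exp (-1 * noise r W 0 ω))
      ((hint 1).add (hint (-1))) (integrable_const _), integral_add (hint 1) (hint (-1))]
    have h1 := hcond 1
    have h2 := hcond (-1)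
    simp only [integral_const, probReal_univ, smul_eq_mul]
    linarith
  rw [integral_eq_zero_iff_of_nonneg hnn
    (((hint 1).add (hint (-1))).sub (integrable_const _))] at hzero
  set H₀ : Fin 0 → Obs S A h := fun i => i.elim0 with hH
  obtain ⟨τ, -, hτ⟩ : ∃ τ ∈ Finset.univ, trajMass mdp P H₀ τ ≠ 0 := by
    refine Finset.exists_ne_zero_of_sum_ne_zero ?_
    rw [sum_trajMass]
    exact one_ne_zero
  set o : Obs S A h := (![τ, τ], true) with ho
  have hdiff : diff o = 0 := sub_self _
  have hmass : 0 < obsMass mdp r P H₀ o := by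
    have h1 : 0 < trajMass mdp P H₀ τ := lt_of_le_of_ne (trajMass_nonneg mdp P H₀ τ) hτ.symm
    have h2 : prefProb r o = 1 / 2 := by
      rw [prefProb, hdiff]
      simp [ho]
    rw [obsMass, h2]
    exact mul_pos (mul_pos h1 h1) (by norm_num)
  have hB : MeasurableSet {w : Round S A h | w.2.2 = o} :=
    (measurable_snd.comp measurable_snd) (measurableSet_singleton o)
  have hmeas : μ {ω | (W 0 ω).2.2 = o} = ENNReal.ofReal (obsMass mdp r P H₀ o) := by
    have h1 := measure_history_inter hW 0 H₀ hB
    rw [roundLaw_obs P hlink] at h1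
    have h2 : ∀ ω, history W 0 ω = H₀ := fun ω => Subsingleton.elim _ _
    simpa [h2] using h1
  have hnull : μ {ω | (W 0 ω).2.2 = o} = 0 := by
    suffices hsub : {ω | (W 0 ω).2.2 = o} ⊆ {ω | ¬(Real.exp (1 * noise r W 0 ω) +
        Real.exp (-1 * noise r W 0 ω) - 2 = 0)} from
      measure_mono_null hsub (ae_iff.1 hzero)
    intro ω hω hcon
    have h1 : noise r W 0 ω = 1 / 2 := by
      have : (W 0 ω).2.2 = o := hω
      rw [noise, this, hdiff]
      simp [label, ho]
    have h2 : Real.exp (1 * noise r W 0 ω) + Real.exp (-1 * noise r W 0 ω) - 2 = 0 := hcon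
    have h3 := Real.one_lt_cosh.2 (by rw [h1]; norm_num : noise r W 0 ω ≠ 0)
    rw [Real.cosh_eq] at h3
    simp only [one_mul, neg_mul] at h2
    linarith
  rw [hnull] at hmeas
  exact absurd hmeas.symm (ENNReal.ofReal_pos.2 hmass).ne'

/-- The relevant subspace is spanned by the differences of mean feature vectors. -/
lemma orthogonal_irrelevant_le (mdp : MDP S A) (h : ℕ) :
    (irrelevant mdp h)ᗮ ≤ Submodule.span ℝ (Set.range fun π : Policy S A h × Policy S A h =>
      meanFeatures mdp π.1 - meanFeatures mdp π.2) := by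
  set U := Submodule.span ℝ (Set.range fun π : Policy S A h × Policy S A h =>
      meanFeatures mdp π.1 - meanFeatures mdp π.2) with hU
  rw [← U.orthogonal_orthogonal]
  refine Submodule.orthogonal_le fun v hv π π' => ?_
  have h1 : meanFeatures mdp π - meanFeatures mdp π' ∈ U :=
    Submodule.subset_span ⟨(π, π'), rfl⟩
  have h2 := Submodule.inner_left_of_mem_orthogonal h1 hv
  rw [inner_sub_right] at h2
  rw [value_eq_inner, value_eq_inner]
  linarith

/-- Almost surely, in every relevant direction, the uncertainty vanishes even after
multiplication with the squared confidence radius. -/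
lemma ae_tendsto_unc (hW : IsDPS μ mdp r P W) (hnoise : SubGaussianNoise μ r W P.R)
    (hr : ‖r‖ ≤ P.Sr)
    (hlink : ∀ τ τ' : Traj S A h, Feasible mdp τ → Feasible mdp τ' →
      |inner ℝ r (features τ' - features τ)| ≤ 1 / 2) :
    ∀ᵐ ω ∂μ, ∀ v ∈ (irrelevant mdp h)ᗮ,
      Tendsto (fun n => beta P (history W n ω) ^ 2 * unc P (history W n ω) v) atTop (𝓝 0) ∧
        Tendsto (fun n => inner ℝ v (ridge P (history W n ω) - r)) atTop (𝓝 0) := by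
  have : Nonempty (Policy S A h) := IsDPS.nonempty_policy W μ
  have hR : 0 < P.R := hnoise.R_pos hW hlink
  have hS : 0 ≤ P.Sr := (norm_nonneg r).trans hr
  obtain ⟨Cβ, hCβ, hβ⟩ := exists_beta_sq_le (h := h) P
  filter_upwards [ae_ridgeClose hW hlink, ae_countsClose hW hlink, ae_infoGain_bounded hW hlink]
    with ω ⟨K₁, h1⟩ ⟨K₂, h2⟩ ⟨C, hC⟩
  set K := max 0 (max K₁ K₂) with hK
  have hK0 : 0 ≤ K := le_max_left _ _
  have hrc : ∀ n, RidgeClose r P K (history W n ω) := fun n v => (h1 n v).trans <| by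
    have e1 : K₁ ≤ K := (le_max_left _ _).trans (le_max_right _ _)
    have e2 := logDet_nonneg P (history W n ω)
    have e3 := unc_nonneg P (history W n ω) v
    gcongr
  have hcc : ∀ n, CountsClose mdp K (history W n ω) := fun n s a s' => (h2 n s a s').trans <| by
    have e1 : K₂ ≤ K := (le_max_right _ _).trans (le_max_right _ _)
    have e2 := visits_nonneg (history W n ω) s a
    gcongr
  have hm : ∀ n, 0 ≤ 1 + logDet P (history W n ω) := fun n => by
    linarith [logDet_nonneg P (history W n ω)]
  have key : ∀ v ∈ (irrelevant mdp h)ᗮ, Tendsto (fun n =>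
      (1 + logDet P (history W n ω)) * unc P (history W n ω) v) atTop (𝓝 0) := by
    intro v hv
    refine Submodule.span_induction ?_ ?_ ?_ ?_ (orthogonal_irrelevant_le mdp h hv)
    · rintro _ ⟨⟨πa, πb⟩, rfl⟩
      exact tendsto_unc_of_infoGain_bounded hR hS hlink hK0 (fun k => (W k ω).2.2) hcc hrc hC
        πa πb
    · have : ∀ n, unc P (history W n ω) 0 = 0 := fun n => by
        simpa using unc_smul P (history W n ω) 0 0
      simp [this]
    · intro x y _ _ hx hy
      refine squeeze_zero (fun n => mul_nonneg (hm n) (unc_nonneg P _ _)) (fun n => ?_)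
        (by simpa using (hx.add hy).const_mul 2)
      have := mul_le_mul_of_nonneg_left (unc_add_le P (history W n ω) x y) (hm n)
      linarith
    · intro c x _ hx
      have := hx.const_mul (c ^ 2)
      rw [mul_zero] at this
      refine this.congr fun n => ?_
      rw [unc_smul]
      ring
  intro v hv
  have hv := key v hv
  constructor
  · refine squeeze_zero (fun n => mul_nonneg (sq_nonneg _) (unc_nonneg P _ _)) (fun n => ?_)
      (by simpa using hv.const_mul Cβ)
    rw [← mul_assoc]
    exact mul_le_mul_of_nonneg_right (hβ n _) (unc_nonneg P _ _)
  · have hsq : Tendsto (fun n => (inner ℝ v (ridge P (history W n ω) - r)) ^ 2) atTop (𝓝 0) := by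
      refine squeeze_zero (fun n => sq_nonneg _) (fun n => ?_)
        (by simpa using hv.const_mul K)
      rw [← mul_assoc]
      exact hrc n v
    rw [tendsto_zero_iff_abs_tendsto_zero]
    have := hsq.sqrt
    simpa [Real.sqrt_sq_eq_abs, Function.comp_def] using this

lemma continuous_relProj (mdp : MDP S A) (h : ℕ) : Continuous (relProj mdp h) :=
  (relProj mdp h).continuous

lemma inner_relProj_left (mdp : MDP S A) (h : ℕ) (v w : EuclideanSpace ℝ (S × A)) :
    inner ℝ (relProj mdp h v) w = inner ℝ v (relProj mdp h w) :=
  Submodule.inner_starProjection_left_eq_right _ v w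

lemma relProj_mem (mdp : MDP S A) (h : ℕ) (v : EuclideanSpace ℝ (S × A)) :
    relProj mdp h v ∈ (irrelevant mdp h)ᗮ := Submodule.starProjection_apply_mem _ v

lemma charFun_map_relProj (mdp : MDP S A) (h : ℕ) (ν : Measure (EuclideanSpace ℝ (S × A)))
    (t : EuclideanSpace ℝ (S × A)) :
    charFun (ν.map fun v => relProj mdp h v) t = charFun ν (relProj mdp h t) := by
  rw [charFun_apply, charFun_apply, integral_map (continuous_relProj mdp h).aemeasurable
    (by fun_prop)]
  simp only [inner_relProj_left]

/-- Convergence of the characteristic functions of the reward posteriors in relevant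
directions. -/
lemma tendsto_charFun_rewardPosterior {H : ∀ n, Fin n → Obs S A h}
    {v : EuclideanSpace ℝ (S × A)}
    (h1 : Tendsto (fun n => beta P (H n) ^ 2 * unc P (H n) v) atTop (𝓝 0))
    (h2 : Tendsto (fun n => inner ℝ v (ridge P (H n) - r)) atTop (𝓝 0)) :
    Tendsto (fun n => charFun (rewardPosterior P (H n)) v) atTop
      (𝓝 (charFun (Measure.dirac r) v)) := by
  have h3 : Tendsto (fun n => inner ℝ v (ridge P (H n))) atTop (𝓝 (inner ℝ v r)) := by
    have := h2.add_const (inner ℝ v r)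
    simpa [inner_sub_right] using this
  have h4 : ∀ n, charFun (rewardPosterior P (H n)) v =
      Complex.exp ((inner ℝ v (ridge P (H n)) : ℝ) * Complex.I -
        ((beta P (H n) ^ 2 * unc P (H n) v : ℝ) : ℂ) / 2) := by
    intro n
    rw [rewardPosterior, charFun_multivariateGaussian (posSemidef_posteriorCov P (H n)),
      posteriorCov_quadratic]
  simp only [h4, charFun_dirac]
  have h5 : Tendsto (fun n => ((inner ℝ v (ridge P (H n)) : ℝ) : ℂ) * Complex.I -
        ((beta P (H n) ^ 2 * unc P (H n) v : ℝ) : ℂ) / 2) atTop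
      (𝓝 (((inner ℝ v r : ℝ) : ℂ) * Complex.I - ((0 : ℝ) : ℂ) / 2)) :=
    (((Complex.continuous_ofReal.tendsto _).comp h3).mul_const _).sub
      (((Complex.continuous_ofReal.tendsto _).comp h1).div_const _)
  have h6 := (Complex.continuous_exp.tendsto _).comp h5
  simpa [real_inner_comm r v, Function.comp_def] using h6

lemma measurable_rewardSample (hW : IsDPS μ mdp r P W) (n : ℕ) (j : Fin 2) :
    Measurable (rewardSample W n j) :=
  measurable_snd.comp ((measurable_pi_apply j).comp (measurable_fst.comp (hW.measurable n)))

/-- The law of a reward sample is the mixture of the posteriors over the histories. -/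
lemma map_rewardSample (hW : IsDPS μ mdp r P W)
    (hlink : ∀ τ τ' : Traj S A h, Feasible mdp τ → Feasible mdp τ' →
      |inner ℝ r (features τ' - features τ)| ≤ 1 / 2) (n : ℕ) (j : Fin 2) :
    μ.map (rewardSample W n j) =
      ∑ H : Fin n → Obs S A h, (μ.map (history W n)) {H} • rewardPosterior P H := by
  have : Nonempty (Policy S A h) := IsDPS.nonempty_policy W μ
  ext B hB
  rw [Measure.map_apply (measurable_rewardSample hW n j) hB, Measure.finsetSum_apply]
  have hB' : MeasurableSet {w : Round S A h | (w.1 j).2 ∈ B} :=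
    (measurable_snd.comp ((measurable_pi_apply j).comp measurable_fst)) hB
  have h1 : ∀ H : Fin n → Obs S A h, (μ.map (history W n) {H} • rewardPosterior P H) B =
      μ (history W n ⁻¹' {H} ∩ rewardSample W n j ⁻¹' B) := by
    intro H
    have h2 := measure_history_inter hW n H hB'
    rw [roundLaw_rewardSample P hlink H j hB] at h2
    rw [Measure.smul_apply, smul_eq_mul, Measure.map_apply (measurable_history hW n)
      (measurableSet_singleton _)]
    exact h2.symm
  simp only [h1]
  have h3 : rewardSample W n j ⁻¹' B =
      ⋃ H ∈ (Finset.univ : Finset (Fin n → Obs S A h)),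
        (history W n ⁻¹' {H} ∩ rewardSample W n j ⁻¹' B) := by
    ext ω; simp
  conv_lhs => rw [h3]
  refine measure_biUnion_finset (fun H _ H' _ hne => ?_) fun H _ => ?_
  · refine Set.disjoint_left.2 fun ω hω hω' => hne ?_
    exact hω.1.symm.trans hω'.1
  · exact (measurable_history hW n (measurableSet_singleton _)).inter
      (measurable_rewardSample hW n j hB)

lemma charFun_map_rewardSample (hW : IsDPS μ mdp r P W)
    (hlink : ∀ τ τ' : Traj S A h, Feasible mdp τ → Feasible mdp τ' →
      |inner ℝ r (features τ' - features τ)| ≤ 1 / 2) (n : ℕ) (j : Fin 2)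
    (t : EuclideanSpace ℝ (S × A)) :
    charFun (μ.map (rewardSample W n j)) t =
      ∫ ω, charFun (rewardPosterior P (history W n ω)) t ∂μ := by
  have : IsProbabilityMeasure (μ.map (history W n)) :=
    Measure.isProbabilityMeasure_map (measurable_history hW n).aemeasurable
  have h1 : ∫ ω, charFun (rewardPosterior P (history W n ω)) t ∂μ =
      ∫ H, charFun (rewardPosterior P H) t ∂(μ.map (history W n)) :=
    (integral_map (f := fun H => charFun (rewardPosterior P H) t)
      (measurable_history hW n).aemeasurable (measurable_of_countable _).aestronglyMeasurable).symm
  rw [h1, integral_fintype Integrable.of_finite, map_rewardSample hW hlink, charFun_apply,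
    integral_finsetSum_measure]
  · refine Finset.sum_congr rfl fun H _ => ?_
    rw [integral_smul_measure, charFun_apply]
    rfl
  · intro H _
    refine Integrable.smul_measure ?_ (measure_ne_top _ _)
    refine Integrable.of_bound (C := 1) (by fun_prop) (ae_of_all _ fun x => ?_)
    rw [Complex.norm_exp_ofReal_mul_I]

lemma tendstoInDistribution_rewardPosterior {H : ∀ n, Fin n → Obs S A h}
    (hH : ∀ v ∈ (irrelevant mdp h)ᗮ,
      Tendsto (fun n => beta P (H n) ^ 2 * unc P (H n) v) atTop (𝓝 0) ∧
        Tendsto (fun n => inner ℝ v (ridge P (H n) - r)) atTop (𝓝 0)) :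
    TendstoInDistribution (fun (_ : ℕ) v => relProj mdp h v) atTop (fun v => relProj mdp h v)
      (fun n => rewardPosterior P (H n)) (Measure.dirac r) where
  forall_aemeasurable _ := (continuous_relProj mdp h).aemeasurable
  aemeasurable_limit := (continuous_relProj mdp h).aemeasurable
  tendsto := by
    refine ProbabilityMeasure.tendsto_iff_tendsto_charFun.2 fun t => ?_
    simp only [ProbabilityMeasure.coe_mk, charFun_map_relProj]
    obtain ⟨h1, h2⟩ := hH _ (relProj_mem mdp h t)
    exact tendsto_charFun_rewardPosterior h1 h2

lemma tendstoInDistribution_rewardSample (hW : IsDPS μ mdp r P W)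
    (hlink : ∀ τ τ' : Traj S A h, Feasible mdp τ → Feasible mdp τ' →
      |inner ℝ r (features τ' - features τ)| ≤ 1 / 2)
    (hconv : ∀ᵐ ω ∂μ, ∀ v ∈ (irrelevant mdp h)ᗮ,
      Tendsto (fun n => beta P (history W n ω) ^ 2 * unc P (history W n ω) v) atTop (𝓝 0) ∧
        Tendsto (fun n => inner ℝ v (ridge P (history W n ω) - r)) atTop (𝓝 0)) (j : Fin 2) :
    TendstoInDistribution (fun n ω => relProj mdp h (rewardSample W n j ω)) atTop
      (fun _ : Ω => relProj mdp h r) (fun _ => μ) μ where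
  forall_aemeasurable n :=
    ((continuous_relProj mdp h).measurable.comp (measurable_rewardSample hW n j)).aemeasurable
  aemeasurable_limit := aemeasurable_const
  tendsto := by
    refine ProbabilityMeasure.tendsto_iff_tendsto_charFun.2 fun t => ?_
    have h1 : ∀ n, charFun (μ.map fun ω => relProj mdp h (rewardSample W n j ω)) t =
        ∫ ω, charFun (rewardPosterior P (history W n ω)) (relProj mdp h t) ∂μ := by
      intro n
      rw [← charFun_map_rewardSample hW hlink n j, ← charFun_map_relProj,
        Measure.map_map (continuous_relProj mdp h).measurable (measurable_rewardSample hW n j)]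
      rfl
    have h2 : charFun (μ.map fun _ : Ω => relProj mdp h r) t =
        ∫ _, charFun (Measure.dirac r) (relProj mdp h t) ∂μ := by
      rw [Measure.map_const, integral_const, charFun_dirac]
      simp [charFun_dirac, inner_relProj_left]
    simp only [ProbabilityMeasure.coe_mk, h1, h2]
    refine tendsto_integral_of_dominated_convergence (fun _ => (1 : ℝ)) (fun n => ?_)
      (integrable_const _) (fun n => ae_of_all _ fun ω => norm_charFun_le_one _) ?_
    · exact ((measurable_of_countable fun H : Fin n → Obs S A h =>
        charFun (rewardPosterior P H) (relProj mdp h t)).comp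
          (measurable_history hW n)).aestronglyMeasurable
    · filter_upwards [hconv] with ω hω
      obtain ⟨h3, h4⟩ := hω _ (relProj_mem mdp h t)
      exact tendsto_charFun_rewardPosterior h3 h4

end Convergence

end DPS

end

theorem proposition2 {S A : Type*} [Fintype S] [DecidableEq S] [Fintype A] [DecidableEq A]
    (h : ℕ) (mdp : DPS.MDP S A) (r : EuclideanSpace ℝ (S × A)) (P : DPS.Params S A)
    (hr : ‖r‖ ≤ P.Sr)
    (hlink : ∀ τ τ' : DPS.Traj S A h, DPS.Feasible mdp τ → DPS.Feasible mdp τ' →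
      |inner ℝ r (DPS.features τ' - DPS.features τ)| ≤ 1 / 2)
    {Ω : Type*} [MeasurableSpace Ω] (μ : Measure Ω) [IsProbabilityMeasure μ]
    (W : ℕ → Ω → DPS.Round S A h) (hW : DPS.IsDPS μ mdp r P W)
    (hnoise : DPS.SubGaussianNoise μ r W P.R) :
    ∃ E : Set Ω, MeasurableSet E ∧ ENNReal.ofReal (1 - P.delta) ≤ μ E ∧
      (∀ ω ∈ E,
        TendstoInDistribution (fun (_ : ℕ) v => DPS.relProj mdp h v) atTop
          (fun v => DPS.relProj mdp h v)
          (fun n => DPS.rewardPosterior P (DPS.history W n ω)) (Measure.dirac r)) ∧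
      ∃ _ : IsProbabilityMeasure μ[|E], ∀ j : Fin 2,
        TendstoInDistribution (fun n ω => DPS.relProj mdp h (DPS.rewardSample W n j ω)) atTop
          (fun _ : Ω => DPS.relProj mdp h r) (fun _ => μ[|E]) μ[|E] := by
  have hconv := DPS.ae_tendsto_unc hW hnoise hr hlink
  obtain ⟨N, hsub, hN, hN0⟩ := exists_measurable_superset_of_null (ae_iff.1 hconv)
  have hE1 : μ Nᶜ = 1 := (prob_compl_eq_one_iff hN).2 hN0
  -- the event has full measure, so conditioning on it does nothing
  have hcond : μ[|Nᶜ] = μ := by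
    rw [ProbabilityTheory.cond, hE1, inv_one, one_smul]
    exact Measure.restrict_eq_self_of_ae_mem (compl_mem_ae_iff.2 hN0)
  refine ⟨Nᶜ, hN.compl, ?_, fun ω hω => ?_, ?_⟩
  · rw [hE1]
    exact ENNReal.ofReal_le_one.2 (by linarith [P.delta_pos])
  · exact DPS.tendstoInDistribution_rewardPosterior (by_contra fun hcon => hω (hsub hcon))
  · rw [hcond]
    exact ⟨inferInstance, DPS.tendstoInDistribution_rewardSample hW hlink hconv⟩
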